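/- Let $\lambda=(\lambda_1,\lambda_2)\in\mathbb R^2$ with $\lambda_2\neq 0$. Let $\mathfrak n$ be the six-dimensional two-step nilpotent Lie algebra with basis $X_1,Y_1,X_2,Y_2,T_1,T_2$ and non-zero brackets $[X_1,Y_1]=T_1$, $[X_1,X_2]=[Y_1,Y_2]=T_2$, and let $\mathcal L=-(X_1^2+Y_1^2+X_2^2+Y_2^2)$. Consider the infinitesimal representations $d\pi_\lambda$, $d\rho_\lambda$ of $\mathfrak n$ on $L^2(\mathbb R^2)$ given by $$d\pi_\lambda(X_1)=\partial_{u_1},\quad d\pi_\lambda(Y_1)=i\lambda_1u_1-i\lambda_2u_2,\quad d\pi_\lambda(X_2)=i\lambda_2u_1,\quad d\pi_\lambda(Y_2)=\partial_{u_2},$$ $$d\rho_\lambda(X_1)=\partial_x-\tfrac i2\lambda_1y,\quad d\rho_\lambda(Y_1)=\partial_y+\tfrac i2\lambda_1x,\quad d\rho_\lambda(X_2)=i\lambda_2x,\quad d\rho_\lambda(Y_2)=i\lambda_2y,$$ (and $T_j\mapsto i\lambda_j$ in both cases), so that $d\pi_\lambda(\mathcal L)=-\partial_{u_1}^2-\partial_{u_2}^2+(\lambda_1u_1-\lambda_2u_2)^2+(\lambda_2u_1)^2$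 and $d\rho_\lambda(\mathcal L)=-(\partial_x-\tfrac i2\lambda_1y)^2-(\partial_y+\tfrac i2\lambda_1x)^2+\lambda_2^2(x^2+y^2)$. Denote by the same symbols the closures in $L^2(\mathbb R^2)$ of these two operators with domain the Schwartz space. Put $\mu_{\pm}=\frac12\big(\lambda_1^2+2\lambda_2^2\pm|\lambda_1|\sqrt{\lambda_1^2+4\lambda_2^2}\big)$, $b_\pm=\frac12\big(\lambda_1^2\mp|\lambda_1|\sqrt{\lambda_1^2+4\lambda_2^2}\big)$, and let $k_\lambda$ be the orthogonal $2\times2$ matrix with columns $\frac{(\lambda_1\lambda_2,\,b_+)^t}{\sqrt{(\lambda_1\lambda_2)^2+b_+^2}}$ and $\frac{(\lambda_1\lambda_2,\,b_-)^t}{\sqrt{(\lambda_1\lambda_2)^2+b_-^2}}$ if $\lambda_1\ne0$, and $k_\lambda=I$ if $\lambda_1=0$. Write $u'=k_\lambda^{-1}u$ for $u\in\mathbb R^2$; in these coordinates $(\lambda_1u_1-\lambda_2u_2)^2+(\lambda_2u_1)^2=\mu_+u_1'^2+\mu_-u_2'^2$. For $t,\mu>0$ let $$Q_t(x,y)=\pi^{-1/2}(1-e^{-4t})^{-1/2}\exp\Big(-\frac{\frac12(1+e^{-4t})(x^2+y^2)-2e^{-2t}xy}{1-e^{-4t}}\Big),$$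 $$K_{t,\mu}(x,y)=\mu^{1/4}e^{-t\sqrt\mu}\,Q_{t\sqrt\mu}(\mu^{1/4}x,\mu^{1/4}y).$$ **Proposition.** The operators $-d\pi_\lambda(\mathcal L)$ and $-d\rho_\lambda(\mathcal L)$ each generate a unique strongly continuous semigroup on $L^2(\mathbb R^2)$, denoted $e^{-t\,d\pi_\lambda(\mathcal L)}$ and $e^{-t\,d\rho_\lambda(\mathcal L)}$, $t\ge0$. For every $t>0$: 1. $e^{-t\,d\pi_\lambda(\mathcal L)}$ has the integral kernel $$\kappa_{t,\lambda}(u,v)=K_{t,\mu_+}(u_1',v_1')\,K_{t,\mu_-}(u_2',v_2').$$ 2. $e^{-t\,d\rho_\lambda(\mathcal L)}$ has the integral kernel $$Q_{t,\lambda}\big((x_o,y_o),(x,y)\big)=\frac{|\lambda_2|}{2\pi}\,e^{i\frac{\lambda_1}2(x_oy_o-xy)}\int_{\mathbb R^2}e^{i\lambda_2(y_2y-y_oy_1)}\,\kappa_{t,\lambda}\big((x_o,y_1),(x,y_2)\big)\,dy_1\,dy_2,$$ where the integral converges absolutely for all $x_o,y_o,x,y\in\mathbb R$. Moreover, for all $t\ge0$,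 $e^{-t\,d\rho_\lambda(\mathcal L)}=T\,e^{-t\,d\pi_\lambda(\mathcal L)}\,T^{-1}$, where $T$ is the unitary operator of $L^2(\mathbb R^2)$ given, together with its inverse, on Schwartz functions by $$Th(x,y)=\sqrt{\tfrac{|\lambda_2|}{2\pi}}\;e^{i\frac{\lambda_1}2xy}\int_{\mathbb R}e^{-i\lambda_2yz}h(x,z)\,dz,\qquad T^{-1}f(x,z)=\sqrt{\tfrac{|\lambda_2|}{2\pi}}\int_{\mathbb R}e^{-i\frac{\lambda_1}2xy}e^{i\lambda_2yz}f(x,y)\,dy.$$ -/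

import Mathlib

open MeasureTheory Filter Topology
open scoped NNReal ENNReal SchwartzMap

noncomputable section

namespace HeisenbergOscillator

/-! ### Operators on `L²(ℝ²)` and their heat semigroups -/

/-- The Hilbert space `L²(ℝ²)` of complex-valued functions (Lebesgue measure). -/
abbrev L2 : Type := Lp ℂ 2 (volume : Measure (ℝ × ℝ))

/-- For an operator `A` acting on smooth functions, the graph of the closure in `L²(ℝ²)` of `A`
with domain the Schwartz space (for the representations below: the space of smooth vectors). -/
def closedGraph (A : (ℝ × ℝ → ℂ) → (ℝ × ℝ → ℂ)) : Set (L2 × L2) :=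
  closure {p | ∃ φ : 𝓢(ℝ × ℝ, ℂ), p.1 =ᵐ[volume] (φ : ℝ × ℝ → ℂ) ∧ p.2 =ᵐ[volume] A φ}

/-- `S t = exp (-t A)` for all `t ≥ 0`, where `A` is the (possibly unbounded) operator with graph
`G`: `S` is a strongly continuous one-parameter semigroup of bounded operators, and its
infinitesimal generator, domain included, is `-A`. -/
structure IsHeatSemigroup {E : Type*} [NormedAddCommGroup E] [NormedSpace ℂ E]
    (G : Set (E × E)) (S : ℝ≥0 → E →L[ℂ] E) : Prop where
  map_zero : S 0 = ContinuousLinearMap.id ℂ E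
  map_add : ∀ s t, S (s + t) = (S s).comp (S t)
  continuous : ∀ f, Continuous fun t => S t f
  generator : ∀ f g, (f, g) ∈ G ↔
    Tendsto (fun t : ℝ≥0 => ((t : ℝ) : ℂ)⁻¹ • (f - S t f)) (𝓝[>] 0) (𝓝 g)

/-- The bounded operator `B` on `L²(ℝ²)` has integral kernel `k`:
`B f (u) = ∫ k(u, v) f(v) dv` for every `f`, with an absolutely convergent integral. -/
structure HasIntegralKernel (B : L2 →L[ℂ] L2) (k : ℝ × ℝ → ℝ × ℝ → ℂ) : Prop where
  measurable : Measurable (Function.uncurry k)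
  integrable : ∀ f : L2, ∀ᵐ u, Integrable fun v => k u v * f v
  apply_eq : ∀ f : L2, ∀ᵐ u, B f u = ∫ v, k u v * f v

/-! ### The infinitesimal representations and the image of the sublaplacian -/

/-- Partial derivative in the first variable. -/
def partial₁ (f : ℝ × ℝ → ℂ) : ℝ × ℝ → ℂ := fun u => deriv (fun s => f (s, u.2)) u.1

/-- Partial derivative in the second variable. -/
def partial₂ (f : ℝ × ℝ → ℂ) : ℝ × ℝ → ℂ := fun u => deriv (fun s => f (u.1, s)) u.2

/-- The elements `X₁, Y₁, X₂, Y₂` of the canonical basis of the Lie algebra of `N`; they span its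
first layer. -/
inductive Horizontal
  | X₁ | Y₁ | X₂ | Y₂

/-- The infinitesimal representation `dπ_λ`, `λ = (l₁, l₂)`, on the first layer. -/
def dpi (l₁ l₂ : ℝ) : Horizontal → (ℝ × ℝ → ℂ) → (ℝ × ℝ → ℂ)
  | .X₁, h => partial₁ h
  | .Y₁, h => fun u => Complex.I * (l₁ * u.1 - l₂ * u.2) * h u
  | .X₂, h => fun u => Complex.I * l₂ * u.1 * h u
  | .Y₂, h => partial₂ h

/-- The infinitesimal representation `dρ_λ`, `λ = (l₁, l₂)`, on the first layer. -/
def drho (l₁ l₂ : ℝ) : Horizontal → (ℝ × ℝ → ℂ) → (ℝ × ℝ → ℂ)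
  | .X₁, f => fun p => partial₁ f p - Complex.I * (p.2 / 2) * l₁ * f p
  | .Y₁, f => fun p => partial₂ f p + Complex.I * (p.1 / 2) * l₁ * f p
  | .X₂, f => fun p => Complex.I * l₂ * p.1 * f p
  | .Y₂, f => fun p => Complex.I * l₂ * p.2 * f p

/-- The image of the sublaplacian `𝓛 = -(X₁² + Y₁² + X₂² + Y₂²)` under an infinitesimal
representation. -/
def sublaplacian (d : Horizontal → (ℝ × ℝ → ℂ) → (ℝ × ℝ → ℂ)) (f : ℝ × ℝ → ℂ) : ℝ × ℝ → ℂ :=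
  fun u => -(d .X₁ (d .X₁ f) u + d .Y₁ (d .Y₁ f) u + d .X₂ (d .X₂ f) u + d .Y₂ (d .Y₂ f) u)

/-! ### Mehler kernels -/

/-- `F_t(x, y)`. -/
def mehlerExponent (t x y : ℝ) : ℝ :=
  (1 - Real.exp (-4 * t))⁻¹ *
    (1 / 2 * (1 + Real.exp (-4 * t)) * (x ^ 2 + y ^ 2) - 2 * Real.exp (-2 * t) * x * y)

/-- Mehler's kernel `Q_t(x, y)` of `exp (-t (-∂ₓ² + x² - 1))`. -/
def mehlerQ (t x y : ℝ) : ℝ :=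
  Real.pi ^ (-1 / 2 : ℝ) * (1 - Real.exp (-4 * t)) ^ (-1 / 2 : ℝ) *
    Real.exp (-mehlerExponent t x y)

/-- The rescaled Mehler kernel `K_{t,μ}(x, y)` of `exp (-t (-∂ₓ² + μ x²))`, `μ > 0`. -/
def mehlerK (t μ x y : ℝ) : ℝ :=
  μ ^ (1 / 4 : ℝ) * Real.exp (-t * √μ) *
    mehlerQ (t * √μ) (μ ^ (1 / 4 : ℝ) * x) (μ ^ (1 / 4 : ℝ) * y)

/-- `μ_{+,λ}`: the larger eigenvalue of the matrix `M_λ` of the quadratic form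
`(l₁ u₁ - l₂ u₂)² + (l₂ u₁)²`. -/
def muPlus (l₁ l₂ : ℝ) : ℝ := 1 / 2 * (l₁ ^ 2 + 2 * l₂ ^ 2 + |l₁| * √(l₁ ^ 2 + 4 * l₂ ^ 2))

/-- `μ_{-,λ}`: the smaller eigenvalue of `M_λ`. -/
def muMinus (l₁ l₂ : ℝ) : ℝ := 1 / 2 * (l₁ ^ 2 + 2 * l₂ ^ 2 - |l₁| * √(l₁ ^ 2 + 4 * l₂ ^ 2))

/-- The lower entry of the eigenvector `(l₁ l₂, b)` of `M_λ` for `μ_{+,λ}`. -/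
def bPlus (l₁ l₂ : ℝ) : ℝ := (l₁ ^ 2 - |l₁| * √(l₁ ^ 2 + 4 * l₂ ^ 2)) / 2

/-- The lower entry of the eigenvector `(l₁ l₂, b)` of `M_λ` for `μ_{-,λ}`. -/
def bMinus (l₁ l₂ : ℝ) : ℝ := (l₁ ^ 2 + |l₁| * √(l₁ ^ 2 + 4 * l₂ ^ 2)) / 2

open Classical in
/-- The orthogonal matrix `k_λ` with `k_λ⁻¹ M_λ k_λ = diag(μ_{+,λ}, μ_{-,λ})`: its columns are the
normalised eigenvectors. If `l₁ = 0` the matrix `M_λ` is already scalar and `k_λ` is the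
identity. -/
def kMatrix (l₁ l₂ : ℝ) : Matrix (Fin 2) (Fin 2) ℝ :=
  if l₁ = 0 then 1 else
    !![l₁ * l₂ / √((l₁ * l₂) ^ 2 + bPlus l₁ l₂ ^ 2),
        l₁ * l₂ / √((l₁ * l₂) ^ 2 + bMinus l₁ l₂ ^ 2);
      bPlus l₁ l₂ / √((l₁ * l₂) ^ 2 + bPlus l₁ l₂ ^ 2),
        bMinus l₁ l₂ / √((l₁ * l₂) ^ 2 + bMinus l₁ l₂ ^ 2)]

/-- The coordinates `u' = k_λ⁻¹ u = k_λᵀ u`, in which `(l₁ u₁ - l₂ u₂)² + (l₂ u₁)²` equals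
`μ_{+,λ} u'₁² + μ_{-,λ} u'₂²`. -/
def diagCoord (l₁ l₂ : ℝ) (u : ℝ × ℝ) : Fin 2 → ℝ :=
  Matrix.mulVec (kMatrix l₁ l₂).transpose ![u.1, u.2]

/-- `κ_{t,λ}(u, v) = K_{t,μ₊}(u'₁, v'₁) K_{t,μ₋}(u'₂, v'₂)`. -/
def kappa (t l₁ l₂ : ℝ) (u v : ℝ × ℝ) : ℝ :=
  mehlerK t (muPlus l₁ l₂) (diagCoord l₁ l₂ u 0) (diagCoord l₁ l₂ v 0) *
    mehlerK t (muMinus l₁ l₂) (diagCoord l₁ l₂ u 1) (diagCoord l₁ l₂ v 1)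

/-- The integrand, in `w = (y₁, y₂)`, of the kernel `Q_{t,λ}((x₀, y₀), (x, y))`, where
`p = (x₀, y₀)` and `q = (x, y)`. -/
def rhoIntegrand (t l₁ l₂ : ℝ) (p q w : ℝ × ℝ) : ℂ :=
  Complex.exp (Complex.I * l₂ * (w.2 * q.2 - p.2 * w.1)) *
    (kappa t l₁ l₂ (p.1, w.1) (q.1, w.2) : ℂ)

/-- The kernel `Q_{t,λ}((x₀, y₀), (x, y))`, where `p = (x₀, y₀)` and `q = (x, y)`. -/
def rhoKernel (t l₁ l₂ : ℝ) (p q : ℝ × ℝ) : ℂ :=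
  (|l₂| / (2 * Real.pi) : ℝ) *
    Complex.exp (Complex.I * (l₁ / 2) * (p.1 * p.2 - q.1 * q.2)) *
      ∫ w : ℝ × ℝ, rhoIntegrand t l₁ l₂ p q w

/-! ### The intertwiner -/

/-- The integral operator `T` on functions. -/
def intertwiner (l₁ l₂ : ℝ) (h : ℝ × ℝ → ℂ) : ℝ × ℝ → ℂ := fun p =>
  (√(|l₂| / (2 * Real.pi)) : ℝ) * Complex.exp (Complex.I * (l₁ / 2) * p.1 * p.2) *
    ∫ z : ℝ, Complex.exp (-Complex.I * l₂ * p.2 * z) * h (p.1, z)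

/-- The integral operator `T⁻¹` on functions. -/
def intertwinerInv (l₁ l₂ : ℝ) (f : ℝ × ℝ → ℂ) : ℝ × ℝ → ℂ := fun p =>
  (√(|l₂| / (2 * Real.pi)) : ℝ) *
    ∫ y : ℝ, Complex.exp (-Complex.I * (l₁ / 2) * p.1 * y) *
      Complex.exp (Complex.I * l₂ * p.2 * y) * f (p.1, y)

end HeisenbergOscillator

end

/-!
Both operators are sublaplacians `A = -∑ D_X²` of operators `D_X` that are skew-symmetric on the
Schwartz space, so `⟪A φ, φ⟫ = ∑ ‖D_X φ‖² ≥ 0`. For an accretive operator the energy inequality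
`norm_le_norm_zero_of_accretive` makes the semigroup unique (`IsHeatSemigroup.unique`). It also
gives existence without any resolvent theory as soon as enough solutions of the heat equation are
known: if a family of solutions inside the domain is stable under time shifts and its initial values
span a dense subspace, then the initial values extend to a contraction semigroup, and the closure
of `A` is its generator up to sign. For the latter, a vector orthogonal to the range of `1 + A` on
the span has inner products with the solutions that grow like `eᵗ`; being bounded, they vanish
(`IsEvolutionFamily.denseRange_add`, `IsEvolutionFamily.isHeatSemigroup`).

For `dπ_λ(𝓛)` such a family is explicit. In the coordinates `u' = k_λ⁻¹ u` the operator is a sum of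
two one-dimensional harmonic oscillators of frequencies `ω = √μ₊` and `ν = √μ₋`, and the flow
transforms a ground state times a character `e^{i(η u'₁ + ζ u'₂)}`, suitably normalised, into the
state with frequencies `e^{-2ωt} η, e^{-2νt} ζ` times `e^{-(ω+ν)t}`
(`Diagonalization.isEvolutionFamily_dpi`). These coherent states span a dense subspace by
injectivity of the Fourier transform.

The operator `T` is a partial Fourier transform followed by multiplication by a unimodular function,
hence unitary by the Plancherel theorem on vertical lines (`exists_unitary_intertwiner`). It maps
coherent states to exponentials of quadratic polynomials, on which the action of `dρ_λ(𝓛)` is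
computed directly; the images form an evolution family for `dρ_λ(𝓛)`
(`Diagonalization.isEvolutionFamily_drho`). Comparing the two semigroups on the coherent states
gives `e^{-t dρ_λ(𝓛)} = T e^{-t dπ_λ(𝓛)} T⁻¹`.

Since `κ_{t,λ}` is dominated by a Gaussian, its rows are square integrable, so it suffices to check
the first kernel formula on coherent states (`hasIntegralKernel_of_dense`), where it is a Gaussian
integral (`integral_mehlerK_mul`). For the second formula, a row of `Q_{t,λ}` is the complex
conjugate of the image under `T` of a square integrable function (`rhoKernel_eq`), and unitarity of
`T` together with Fubini's theorem reduces the claim to the first formula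
(`hasIntegralKernel_rhoKernel`).
-/

namespace HeisenbergOscillator

/-! ### Heat semigroups of accretive operators -/

section Semigroup

variable {E : Type*} [NormedAddCommGroup E] [InnerProductSpace ℂ E]

/-- Energy inequality: a solution of `w' = -A w` with `A` accretive has non-increasing norm. -/
theorem norm_le_norm_zero_of_accretive {w w' : ℝ → E} {T : ℝ} (hT : 0 ≤ T) (hc : Continuous w)
    (hd : ∀ t, 0 ≤ t → HasDerivWithinAt w (-(w' t)) (Set.Ici t) t)
    (ha : ∀ t, 0 ≤ t → 0 ≤ (inner ℂ (w' t) (w t)).re) : ‖w T‖ ≤ ‖w 0‖ := by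
  have key : ∀ t, 0 ≤ t → HasDerivWithinAt (fun s => (inner ℂ (w s) (w s)).re)
      (-(2 * (inner ℂ (w' t) (w t)).re)) (Set.Ici t) t := by
    intro t ht
    have h := (hd t ht).inner ℂ (hd t ht)
    have h2 := Complex.reCLM.hasFDerivAt.comp_hasDerivWithinAt t h
    refine h2.congr_deriv ?_
    have : (inner ℂ (w t) (w' t)).re = (inner ℂ (w' t) (w t)).re := by
      exact inner_re_symm (𝕜 := ℂ) _ _
    simp [inner_neg_left, inner_neg_right, this]
    ring
  have hle := image_le_of_deriv_right_le_deriv_boundary (a := 0) (b := T)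
    (f := fun s => (inner ℂ (w s) (w s)).re)
    (B := fun _ => (inner ℂ (w 0) (w 0)).re) (B' := fun _ => 0)
    (Complex.continuous_re.comp (hc.inner hc)).continuousOn
    (fun t ht => key t ht.1) le_rfl continuousOn_const
    (fun t _ => hasDerivWithinAt_const _ _ _)
    (fun t ht => by have := ha t ht.1; linarith) ⟨hT, le_rfl⟩
  have hn : ∀ x : E, (inner ℂ x x).re = ‖x‖ ^ 2 := fun x => inner_self_eq_norm_sq (𝕜 := ℂ) x
  simp only [hn] at hle
  exact (sq_le_sq₀ (norm_nonneg _) (norm_nonneg _)).1 hle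

theorem IsHeatSemigroup.map_graph {G : Set (E × E)} {S : ℝ≥0 → E →L[ℂ] E}
    (hS : IsHeatSemigroup G S) {f g : E} (hfg : (f, g) ∈ G) (t : ℝ≥0) : (S t f, S t g) ∈ G := by
  rw [hS.generator] at hfg ⊢
  refine (((S t).continuous.tendsto g).comp hfg).congr fun s => ?_
  have h1 : S t (S s f) = S s (S t f) := by
    have := congrArg (· f) (hS.map_add t s)
    have h' := congrArg (· f) (hS.map_add s t)
    rw [add_comm s t] at h'
    simpa using this.symm.trans h'
  simp [h1]

theorem IsHeatSemigroup.hasDerivWithinAt {G : Set (E × E)} {S : ℝ≥0 → E →L[ℂ] E}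
    (hS : IsHeatSemigroup G S) {f g : E} (hfg : (f, g) ∈ G) {t : ℝ} (ht : 0 ≤ t) :
    HasDerivWithinAt (fun s : ℝ => S s.toNNReal f) (-(S t.toNNReal g)) (Set.Ici t) t := by
  rw [← hasDerivWithinAt_Ioi_iff_Ici, hasDerivWithinAt_iff_tendsto_slope' (by simp)]
  have hm : Tendsto (fun s : ℝ => (s - t).toNNReal) (𝓝[>] t) (𝓝[>] 0) := by
    refine tendsto_nhdsWithin_iff.2 ⟨?_, ?_⟩
    · have : Continuous fun s : ℝ => (s - t).toNNReal := by fun_prop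
      have h := this.tendsto t
      simp only [sub_self, Real.toNNReal_zero] at h
      exact h.mono_left nhdsWithin_le_nhds
    · filter_upwards [self_mem_nhdsWithin] with s hs
      simpa using hs
  have h1 := (((hS.generator _ _).1 (hS.map_graph hfg t.toNNReal)).comp hm).neg
  refine h1.congr' ?_
  filter_upwards [self_mem_nhdsWithin] with s hs
  have hs' : t < s := hs
  have hadd : s.toNNReal = (s - t).toNNReal + t.toNNReal := by
    rw [← Real.toNNReal_add (by linarith) ht]; simp
  have hsub : S s.toNNReal f = S (s - t).toNNReal (S t.toNNReal f) := by
    rw [hadd, hS.map_add]; rfl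
  have hcoe : (((s - t).toNNReal : ℝ) : ℂ)⁻¹ = (((s - t)⁻¹ : ℝ) : ℂ) := by
    rw [Real.coe_toNNReal _ (by linarith)]; push_cast; rfl
  rw [slope_def_module, hsub, Function.comp_apply, hcoe, Complex.coe_smul, ← smul_neg, neg_sub]

/-- An accretive operator with dense domain determines its heat semigroup. -/
theorem IsHeatSemigroup.unique {G : Submodule ℂ (E × E)} {S S' : ℝ≥0 → E →L[ℂ] E}
    (hacc : ∀ p ∈ G, 0 ≤ (inner ℂ p.2 p.1).re) (hdom : Dense (Prod.fst '' (G : Set (E × E))))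
    (hS : IsHeatSemigroup (G : Set (E × E)) S) (hS' : IsHeatSemigroup (G : Set (E × E)) S') :
    S = S' := by
  funext t
  refine ContinuousLinearMap.ext fun f => ?_
  refine congrFun (Continuous.ext_on hdom (S t).continuous (S' t).continuous ?_) f
  rintro _ ⟨⟨f, g⟩, hfg, rfl⟩
  have h := norm_le_norm_zero_of_accretive (w := fun s : ℝ => S s.toNNReal f - S' s.toNNReal f)
    (w' := fun s : ℝ => S s.toNNReal g - S' s.toNNReal g) t.2
    (((hS.continuous f).comp continuous_real_toNNReal).sub
      ((hS'.continuous f).comp continuous_real_toNNReal))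
    (fun s hs => by
      refine ((hS.hasDerivWithinAt hfg hs).sub (hS'.hasDerivWithinAt hfg hs)).congr_deriv ?_
      abel)
    (fun s _ => hacc _ (G.sub_mem (hS.map_graph hfg _) (hS'.map_graph hfg _)))
  simp only [Real.toNNReal_zero, hS.map_zero, hS'.map_zero, sub_self, norm_zero, norm_le_zero_iff,
    NNReal.val_eq_coe, Real.toNNReal_coe] at h
  exact sub_eq_zero.1 h

/-- The resolvent estimate `‖f‖ ≤ ‖f + A f‖` for an accretive operator. -/
theorem norm_fst_le_of_accretive {p : E × E} (h : 0 ≤ (inner ℂ p.2 p.1).re) :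
    ‖p.1‖ ≤ ‖p.1 + p.2‖ := by
  have h1 : ‖p.1‖ ^ 2 ≤ ‖p.1 + p.2‖ * ‖p.1‖ := by
    calc ‖p.1‖ ^ 2 = (inner ℂ p.1 p.1).re := (inner_self_eq_norm_sq (𝕜 := ℂ) _).symm
      _ ≤ (inner ℂ (p.1 + p.2) p.1).re := by rw [inner_add_left, Complex.add_re]; linarith
      _ ≤ ‖p.1 + p.2‖ * ‖p.1‖ := re_inner_le_norm (𝕜 := ℂ) _ _
  by_contra! hlt
  nlinarith [norm_nonneg (p.1 + p.2)]

/-- A family of explicit solutions of the heat equation `u' = -v`, `v = A u`, for the operator `A`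
with graph `G₀`: each `u i` is a curve of elements of the domain, the family of curves is invariant
under time translation up to scalars, and the initial values span a dense subspace. -/
structure IsEvolutionFamily {ι : Type*} (G₀ : Submodule ℂ (E × E)) (u v : ι → ℝ → E) : Prop where
  mem : ∀ i t, (u i t, v i t) ∈ G₀
  deriv : ∀ i t, Tendsto (fun h : ℝ => (h : ℂ)⁻¹ • (u i (t + h) - u i t)) (𝓝[≠] 0) (𝓝 (-v i t))
  shift : ∀ i t, ∃ (c : ℂ) (j : ι), ∀ s, u i (t + s) = c • u j s
  dense : Dense (Submodule.span ℂ (Set.range fun i => u i 0) : Set E)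

namespace IsEvolutionFamily

variable {ι : Type*} {G₀ : Submodule ℂ (E × E)} {u v : ι → ℝ → E}

theorem hasDerivAt (h : IsEvolutionFamily G₀ u v) (i : ι) (t : ℝ) :
    HasDerivAt (u i) (-v i t) t := by
  rw [hasDerivAt_iff_tendsto_slope_zero]
  refine (h.deriv i t).congr fun s => ?_
  rw [← Complex.ofReal_inv, Complex.coe_smul]

/-- The superposition `∑ cᵢ uᵢ(t)` of the given solutions. -/
noncomputable def superpose (u : ι → ℝ → E) (t : ℝ) : (ι →₀ ℂ) →ₗ[ℂ] E :=
  Finsupp.linearCombination ℂ fun i => u i t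

theorem superpose_mem (h : IsEvolutionFamily G₀ u v) (t : ℝ) (c : ι →₀ ℂ) :
    (superpose u t c, superpose v t c) ∈ G₀ := by
  induction c using Finsupp.induction_linear with
  | zero =>
    simp only [map_zero]
    exact G₀.zero_mem
  | add c d hc hd => simpa using G₀.add_mem hc hd
  | single i a => simpa [superpose] using G₀.smul_mem a (h.mem i t)

theorem hasDerivAt_superpose (h : IsEvolutionFamily G₀ u v) (t : ℝ) (c : ι →₀ ℂ) :
    HasDerivAt (fun s => superpose u s c) (-superpose v t c) t := by
  induction c using Finsupp.induction_linear with
  | zero => simpa using hasDerivAt_const t (0 : E)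
  | add c d hc hd =>
    simp only [map_add, neg_add]
    exact hc.add hd
  | single i a => simpa [superpose] using! (h.hasDerivAt i t).const_smul a

theorem denseRange_superpose (h : IsEvolutionFamily G₀ u v) : DenseRange (superpose u 0) := by
  have := h.dense
  rw [← Finsupp.range_linearCombination] at this
  exact this

theorem norm_superpose_le (h : IsEvolutionFamily G₀ u v)
    (hacc : ∀ p ∈ G₀, 0 ≤ (inner ℂ p.2 p.1).re) {t : ℝ} (ht : 0 ≤ t) (c : ι →₀ ℂ) :
    ‖superpose u t c‖ ≤ ‖superpose u 0 c‖ :=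
  norm_le_norm_zero_of_accretive (w := fun s => superpose u s c) (w' := fun s => superpose v s c) ht
    (continuous_iff_continuousAt.2 fun s => (h.hasDerivAt_superpose s c).continuousAt)
    (fun s _ => (h.hasDerivAt_superpose s c).hasDerivWithinAt)
    fun s _ => hacc _ (h.superpose_mem s c)

theorem exists_eq_smul (h : IsEvolutionFamily G₀ u v) (i : ι) (t : ℝ) :
    ∃ (c : ℂ) (j : ι), (∀ s, u i (t + s) = c • u j s) ∧ ∀ s, v i (t + s) = c • v j s := by
  obtain ⟨c, j, hc⟩ := h.shift i t
  refine ⟨c, j, hc, fun s => ?_⟩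
  have h1 : HasDerivAt (fun r => u i (t + r)) (-v i (t + s)) s := by
    simpa using (h.hasDerivAt i (t + s)).comp_const_add t s
  have h2 : HasDerivAt (fun r => u i (t + r)) (c • (-v j s)) s := by
    simp only [hc]
    exact (h.hasDerivAt j s).const_smul c
  simpa using h1.unique h2

/-- `1 + A` has dense range already on the span of the initial values: a vector `w` orthogonal to
it makes `⟪w, uᵢ(t)⟫` a multiple of `exp t`, which is bounded only if it vanishes. -/
theorem denseRange_add (h : IsEvolutionFamily G₀ u v) [CompleteSpace E]
    (hacc : ∀ p ∈ G₀, 0 ≤ (inner ℂ p.2 p.1).re) :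
    DenseRange fun c => superpose u 0 c + superpose v 0 c := by
  have : (LinearMap.range (superpose u 0 + superpose v 0)).topologicalClosure = ⊤ := by
    rw [Submodule.topologicalClosure_eq_top_iff, Submodule.eq_bot_iff]
    intro w hw
    rw [Submodule.mem_orthogonal'] at hw
    have h0 : ∀ i t, inner ℂ w (v i t) = -inner ℂ w (u i t) := by
      intro i t
      obtain ⟨c, j, h1, h2⟩ := h.exists_eq_smul i t
      have h3 := hw _ ⟨Finsupp.single j c, rfl⟩
      have h1 := h1 0
      have h2 := h2 0
      simp only [add_zero] at h1 h2
      simp only [superpose, LinearMap.add_apply, Finsupp.linearCombination_single, ← h1, ← h2,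
        inner_add_right] at h3
      linear_combination h3
    have hi : ∀ i, inner ℂ w (u i 0) = 0 := by
      intro i
      have hd : ∀ t, HasDerivAt (fun s : ℝ => (Real.exp (-s) : ℂ) * inner ℂ w (u i s)) 0 t := by
        intro t
        have e1 : HasDerivAt (fun s : ℝ => (Real.exp (-s) : ℂ)) (-(Real.exp (-t) : ℂ)) t := by
          simpa using ((Real.hasDerivAt_exp (-t)).comp t (hasDerivAt_neg t)).ofReal_comp
        have e2 : HasDerivAt (fun s : ℝ => inner ℂ w (u i s)) (inner ℂ w (-v i t)) t := by
          simpa using (hasDerivAt_const t w).inner ℂ (h.hasDerivAt i t)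
        refine (e1.mul e2).congr_deriv ?_
        rw [inner_neg_right, h0]
        ring
      have hconst : ∀ t : ℝ, (Real.exp (-t) : ℂ) * inner ℂ w (u i t) = inner ℂ w (u i 0) := by
        intro t
        have := is_const_of_deriv_eq_zero (fun t => (hd t).differentiableAt)
          (fun t => (hd t).deriv) t 0
        simpa using this
      have hb : ∀ t : ℝ, 0 ≤ t → ‖inner ℂ w (u i 0)‖ ≤ Real.exp (-t) * (‖w‖ * ‖u i 0‖) := by
        intro t ht
        rw [← hconst t, norm_mul, Complex.norm_real, Real.norm_eq_abs, Real.abs_exp]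
        gcongr
        refine (norm_inner_le_norm _ _).trans ?_
        gcongr
        simpa [superpose] using h.norm_superpose_le hacc ht (Finsupp.single i 1)
      have hlim : Tendsto (fun t : ℝ => Real.exp (-t) * (‖w‖ * ‖u i 0‖)) atTop (𝓝 0) := by
        simpa using Real.tendsto_exp_neg_atTop_nhds_zero.mul_const (‖w‖ * ‖u i 0‖)
      have := ge_of_tendsto hlim ((eventually_ge_atTop 0).mono hb)
      simpa using this
    have hperp : ∀ x, inner ℂ w x = 0 := by
      intro x
      have : (fun x => inner ℂ w x) = fun _ => (0 : ℂ) := by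
        refine Continuous.ext_on h.denseRange_superpose (by fun_prop) (by fun_prop) ?_
        rintro _ ⟨c, rfl⟩
        induction c using Finsupp.induction_linear with
        | zero => simp
        | add c d hc hd => simpa [inner_add_right, hc] using hd
        | single i a => simp [superpose, hi]
      exact congrFun this x
    exact inner_self_eq_zero.1 (hperp w)
  intro x
  have hx : x ∈ (LinearMap.range (superpose u 0 + superpose v 0)).topologicalClosure := by
    rw [this]; trivial
  exact hx

/-- A pair whose difference from every graph element obeys the resolvent estimate
`norm_fst_le_of_accretive` is a limit of graph elements, since `1 + A` has dense range. -/
theorem mem_closure_of_norm_sub_le (h : IsEvolutionFamily G₀ u v) [CompleteSpace E]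
    (hacc : ∀ p ∈ G₀, 0 ≤ (inner ℂ p.2 p.1).re) {p : E × E}
    (hp : ∀ c, ‖p.1 - superpose u 0 c‖ ≤
      ‖(p.1 - superpose u 0 c) + (p.2 - superpose v 0 c)‖) :
    p ∈ closure (Set.range fun c => (superpose u 0 c, superpose v 0 c)) := by
  rw [Metric.mem_closure_iff]
  intro ε hε
  obtain ⟨c, hc⟩ := Metric.denseRange_iff.1 (h.denseRange_add hacc) (p.1 + p.2) (ε / 2)
    (by linarith)
  refine ⟨_, ⟨c, rfl⟩, ?_⟩
  have h1 : ‖(p.1 - superpose u 0 c) + (p.2 - superpose v 0 c)‖ < ε / 2 := by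
    rw [dist_eq_norm] at hc
    rwa [← add_sub_add_comm]
  have h2 := (hp c).trans_lt h1
  have h3 : ‖p.2 - superpose v 0 c‖ < ε := by
    have := norm_sub_le ((p.1 - superpose u 0 c) + (p.2 - superpose v 0 c)) (p.1 - superpose u 0 c)
    rw [add_sub_cancel_left] at this
    linarith
  rw [Prod.dist_eq, max_lt_iff, dist_eq_norm, dist_eq_norm]
  exact ⟨by linarith, h3⟩

variable [CompleteSpace E]

/-- The semigroup extending `uᵢ(0) ↦ uᵢ(t)`. -/
noncomputable def semigroup (u : ι → ℝ → E) (t : ℝ≥0) : E →L[ℂ] E :=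
  (superpose u t).extendOfNorm (superpose u 0)

theorem semigroup_superpose_zero (h : IsEvolutionFamily G₀ u v)
    (hacc : ∀ p ∈ G₀, 0 ≤ (inner ℂ p.2 p.1).re) (t : ℝ≥0) (c : ι →₀ ℂ) :
    semigroup u t (superpose u 0 c) = superpose u t c :=
  LinearMap.extendOfNorm_eq h.denseRange_superpose
    ⟨1, fun x => by simpa using h.norm_superpose_le hacc t.2 x⟩ c

theorem norm_semigroup_le (h : IsEvolutionFamily G₀ u v)
    (hacc : ∀ p ∈ G₀, 0 ≤ (inner ℂ p.2 p.1).re) (t : ℝ≥0) (f : E) :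
    ‖semigroup u t f‖ ≤ ‖f‖ := by
  simpa [semigroup] using LinearMap.norm_extendOfNorm_apply_le h.denseRange_superpose 1
    (fun x => by simpa using h.norm_superpose_le hacc t.2 x) f

theorem semigroup_superpose (h : IsEvolutionFamily G₀ u v)
    (hacc : ∀ p ∈ G₀, 0 ≤ (inner ℂ p.2 p.1).re) (t : ℝ≥0) (s : ℝ) (c : ι →₀ ℂ) :
    semigroup u t (superpose u s c) = superpose u (s + t) c := by
  induction c using Finsupp.induction_linear with
  | zero => simp
  | add c d hc hd => simp [hc, hd]
  | single i a =>
    obtain ⟨b, j, hb⟩ := h.shift i s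
    have h0 := hb 0
    have h1 := h.semigroup_superpose_zero hacc t (Finsupp.single j 1)
    simp only [superpose, Finsupp.linearCombination_single, one_smul, add_zero] at h0 h1 ⊢
    rw [hb, map_smul, h0, map_smul, h1]

/-- The semigroup commutes with `A` on superpositions, by uniqueness of derivatives. -/
theorem semigroup_superpose_deriv (h : IsEvolutionFamily G₀ u v)
    (hacc : ∀ p ∈ G₀, 0 ≤ (inner ℂ p.2 p.1).re) (t : ℝ≥0) (s : ℝ) (c : ι →₀ ℂ) :
    semigroup u t (superpose v s c) = superpose v (s + t) c := by
  have h1 : HasDerivAt (fun r => semigroup u t (superpose u r c))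
      (semigroup u t (-superpose v s c)) s :=
    ((semigroup u t).restrictScalars ℝ).hasFDerivAt.comp_hasDerivAt s (h.hasDerivAt_superpose s c)
  have h2 : HasDerivAt (fun r => semigroup u t (superpose u r c)) (-superpose v (s + t) c) s := by
    simp only [h.semigroup_superpose hacc]
    exact (h.hasDerivAt_superpose (s + t) c).comp_add_const s t
  simpa using h1.unique h2

theorem continuous_semigroup (h : IsEvolutionFamily G₀ u v)
    (hacc : ∀ p ∈ G₀, 0 ≤ (inner ℂ p.2 p.1).re) (f : E) :
    Continuous fun t => semigroup u t f := by
  refine continuous_of_uniform_approx_of_continuous fun U hU => ?_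
  obtain ⟨ε, hε, hU⟩ := Metric.mem_uniformity_dist.1 hU
  obtain ⟨c, hc⟩ := Metric.denseRange_iff.1 h.denseRange_superpose f ε hε
  refine ⟨fun t : ℝ≥0 => superpose u t c, ?_, fun t => hU ?_⟩
  · exact (continuous_iff_continuousAt.2 fun s =>
      (h.hasDerivAt_superpose s c).continuousAt).comp NNReal.continuous_coe
  · beta_reduce
    rw [← h.semigroup_superpose_zero hacc, dist_eq_norm, ← map_sub]
    exact (h.norm_semigroup_le hacc t _).trans_lt (by rwa [← dist_eq_norm])

/-- First-order Taylor estimate for the semigroup, uniform on the closure of the graph. -/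
theorem norm_semigroup_sub_le (h : IsEvolutionFamily G₀ u v)
    (hacc : ∀ p ∈ G₀, 0 ≤ (inner ℂ p.2 p.1).re) {p : E × E}
    (hp : p ∈ closure (Set.range fun c => (superpose u 0 c, superpose v 0 c))) {t : ℝ≥0} {M : ℝ}
    (hM : ∀ s ≤ t, ‖semigroup u s p.2 - p.2‖ ≤ M) :
    ‖semigroup u t p.1 + (t : ℂ) • p.2 - p.1‖ ≤ M * t := by
  obtain ⟨f, g⟩ := p
  -- a closed condition on `q`, with `g` kept fixed, that reduces to the claim at `q = (f, g)`
  have hcl : IsClosed {q : E × E |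
      ‖semigroup u t q.1 + (t : ℂ) • g - q.1‖ ≤ (‖q.2 - g‖ + M) * t} :=
    isClosed_le (by fun_prop) (by fun_prop)
  have := hcl.closure_subset_iff.2 (fun q hq => ?_) hp
  · simpa using this
  obtain ⟨c, rfl⟩ := hq
  have hd : ∀ s : ℝ, HasDerivAt (fun r : ℝ => superpose u r c + r • g) (-superpose v s c + g) s :=
    fun s => by simpa using! (h.hasDerivAt_superpose s c).add ((hasDerivAt_id s).smul_const g)
  have hb := norm_image_sub_le_of_norm_deriv_le_segment' (a := 0) (b := t)
    (C := ‖superpose v 0 c - g‖ + M) (fun s _ => (hd s).hasDerivWithinAt) (fun s hs => ?_) t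
    ⟨t.2, le_rfl⟩
  · have hc := h.semigroup_superpose_zero hacc t c
    simp only [zero_smul, add_zero, sub_zero] at hb
    simp only [Set.mem_ofPred_eq, hc]
    exact_mod_cast hb
  · lift s to ℝ≥0 using hs.1
    have e1 := h.semigroup_superpose_deriv hacc s 0 c
    rw [zero_add] at e1
    rw [← e1]
    calc ‖-semigroup u s (superpose v 0 c) + g‖
        = ‖semigroup u s (superpose v 0 c - g) + (semigroup u s g - g)‖ := by
          rw [← norm_neg, map_sub]; congr 1; abel
      _ ≤ ‖superpose v 0 c - g‖ + M :=
          (norm_add_le _ _).trans (add_le_add (h.norm_semigroup_le hacc s _)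
            (hM s (by exact_mod_cast hs.2.le)))

theorem tendsto_semigroup_of_mem_closure (h : IsEvolutionFamily G₀ u v)
    (hacc : ∀ p ∈ G₀, 0 ≤ (inner ℂ p.2 p.1).re) {p : E × E}
    (hp : p ∈ closure (Set.range fun c => (superpose u 0 c, superpose v 0 c))) :
    Tendsto (fun t : ℝ≥0 => ((t : ℝ) : ℂ)⁻¹ • (p.1 - semigroup u t p.1)) (𝓝[>] 0) (𝓝 p.2) := by
  obtain ⟨f, g⟩ := p
  rw [Metric.tendsto_nhds]
  intro ε hε
  have hz : semigroup u 0 g = g := by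
    have : (semigroup u 0 : E → E) = id := by
      refine Continuous.ext_on h.denseRange_superpose (semigroup u 0).continuous continuous_id ?_
      rintro _ ⟨c, rfl⟩
      simpa using h.semigroup_superpose_zero hacc 0 c
    exact congrFun this g
  have hcont := (h.continuous_semigroup hacc g).tendsto 0
  rw [hz, Metric.tendsto_nhds_nhds] at hcont
  obtain ⟨δ, hδ, hcont⟩ := hcont (ε / 2) (by linarith)
  have hmem : {t : ℝ≥0 | dist t 0 < δ} ∈ 𝓝[>] (0 : ℝ≥0) :=
    mem_nhdsWithin_of_mem_nhds (Metric.ball_mem_nhds _ hδ)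
  filter_upwards [hmem, self_mem_nhdsWithin] with t ht ht0
  have ht0 : (0 : ℝ) < t := by exact_mod_cast ht0
  have hb := h.norm_semigroup_sub_le hacc hp (t := t) (M := ε / 2) fun s hs => by
    rw [← dist_eq_norm]
    refine (hcont ?_).le
    refine lt_of_le_of_lt ?_ ht
    simpa [NNReal.dist_eq] using hs
  have hne : (t : ℂ) ≠ 0 := by exact_mod_cast ht0.ne'
  have e : ((t : ℝ) : ℂ)⁻¹ • (f - semigroup u t f) - g =
      -(((t : ℝ) : ℂ)⁻¹ • (semigroup u t f + (t : ℂ) • g - f)) := by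
    rw [smul_sub, smul_sub, smul_add, smul_smul]
    simp only [inv_mul_cancel₀ hne, one_smul]
    abel
  rw [dist_eq_norm]
  rw [e, norm_neg, norm_smul]
  simp only [norm_inv, Complex.norm_real, Real.norm_eq_abs, abs_of_pos ht0]
  calc (t : ℝ)⁻¹ * ‖semigroup u t f + (t : ℂ) • g - f‖ ≤ (t : ℝ)⁻¹ * (ε / 2 * t) := by gcongr
    _ = ε / 2 := by field_simp
    _ < ε := by linarith

/-- If an accretive operator `A` with graph `G₀` admits a dense family of explicit solutions of
`u' = -A u`, then the closure of `A` generates a heat semigroup, which propagates those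
solutions. -/
theorem isHeatSemigroup (h : IsEvolutionFamily G₀ u v)
    (hacc : ∀ p ∈ G₀, 0 ≤ (inner ℂ p.2 p.1).re) :
    IsHeatSemigroup (G₀.topologicalClosure : Set (E × E)) (semigroup u) := by
  have hsub : closure (Set.range fun c => (superpose u 0 c, superpose v 0 c)) ⊆
      (G₀.topologicalClosure : Set (E × E)) := by
    refine closure_mono ?_
    rintro _ ⟨c, rfl⟩
    exact h.superpose_mem 0 c
  have hacc' : ∀ p ∈ G₀.topologicalClosure, 0 ≤ (inner ℂ p.2 p.1).re := by
    have hcl : IsClosed {p : E × E | 0 ≤ (inner ℂ p.2 p.1).re} :=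
      isClosed_le continuous_const (by fun_prop)
    exact fun p hp => hcl.closure_subset_iff.2 hacc hp
  have hext : ∀ {A B : E →L[ℂ] E}, (∀ c, A (superpose u 0 c) = B (superpose u 0 c)) → A = B := by
    intro A B hAB
    refine ContinuousLinearMap.ext fun f => congrFun
      (Continuous.ext_on h.denseRange_superpose A.continuous B.continuous ?_) f
    rintro _ ⟨c, rfl⟩
    exact hAB c
  refine ⟨hext fun c => ?_, fun s t => hext fun c => ?_, h.continuous_semigroup hacc,
    fun f g => ⟨fun hfg => ?_, fun hfg => hsub ?_⟩⟩
  · simpa using h.semigroup_superpose_zero hacc 0 c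
  · rw [ContinuousLinearMap.comp_apply, h.semigroup_superpose_zero hacc,
      h.semigroup_superpose_zero hacc, h.semigroup_superpose hacc, add_comm, NNReal.coe_add]
  · refine h.tendsto_semigroup_of_mem_closure hacc (p := (f, g))
      (h.mem_closure_of_norm_sub_le hacc fun c => ?_)
    exact norm_fst_le_of_accretive (p := (f - superpose u 0 c, g - superpose v 0 c))
      (hacc' _ (Submodule.sub_mem _ hfg (subset_closure (h.superpose_mem 0 c))))
  · refine h.mem_closure_of_norm_sub_le hacc fun c => ?_
    refine norm_fst_le_of_accretive (p := (f - superpose u 0 c, g - superpose v 0 c)) ?_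
    have ht := hfg.sub (h.tendsto_semigroup_of_mem_closure hacc (subset_closure ⟨c, rfl⟩))
    have hin := (Complex.continuous_re.tendsto _).comp
      (ht.inner (𝕜 := ℂ) (tendsto_const_nhds (x := f - superpose u 0 c)))
    refine ge_of_tendsto' hin fun t => ?_
    -- a contraction `S` satisfies `re ⟪x - S x, x⟫ ≥ 0`
    have e : ((t : ℝ) : ℂ)⁻¹ • (f - semigroup u t f) -
        ((t : ℝ) : ℂ)⁻¹ • (superpose u 0 c - semigroup u t (superpose u 0 c)) =
        ((t : ℝ) : ℂ)⁻¹ • ((f - superpose u 0 c) - semigroup u t (f - superpose u 0 c)) := by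
      rw [map_sub, ← smul_sub]; congr 1; abel
    simp only [Function.comp_apply]
    rw [e, inner_smul_left, inner_sub_left, ← Complex.ofReal_inv, Complex.conj_ofReal,
      Complex.re_ofReal_mul, Complex.sub_re]
    set x := f - superpose u 0 c
    have h1 : (inner ℂ x x).re = ‖x‖ ^ 2 := inner_self_eq_norm_sq (𝕜 := ℂ) x
    have h2 : (inner ℂ (semigroup u t x) x).re ≤ ‖semigroup u t x‖ * ‖x‖ :=
      re_inner_le_norm (𝕜 := ℂ) _ _
    have h3 := h.norm_semigroup_le hacc t x
    have h4 := mul_le_mul_of_nonneg_right h3 (norm_nonneg x)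
    exact mul_nonneg (inv_nonneg.2 t.2) (by nlinarith)

theorem semigroup_apply_zero (h : IsEvolutionFamily G₀ u v)
    (hacc : ∀ p ∈ G₀, 0 ≤ (inner ℂ p.2 p.1).re) (i : ι) (t : ℝ≥0) :
    semigroup u t (u i 0) = u i t := by
  simpa [superpose] using h.semigroup_superpose_zero hacc t (Finsupp.single i 1)

theorem existsUnique_isHeatSemigroup (h : IsEvolutionFamily G₀ u v)
    (hacc : ∀ p ∈ G₀, 0 ≤ (inner ℂ p.2 p.1).re) :
    ∃! S, IsHeatSemigroup (G₀.topologicalClosure : Set (E × E)) S := by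
  refine ⟨semigroup u, h.isHeatSemigroup hacc, fun S hS => ?_⟩
  have hcl : IsClosed {p : E × E | 0 ≤ (inner ℂ p.2 p.1).re} :=
    isClosed_le continuous_const (by fun_prop)
  refine hS.unique (fun p hp => hcl.closure_subset_iff.2 hacc hp)
    (h.denseRange_superpose.mono ?_) (h.isHeatSemigroup hacc)
  rintro _ ⟨c, rfl⟩
  exact ⟨_, subset_closure (h.superpose_mem 0 c), rfl⟩

end IsEvolutionFamily

end Semigroup

/-! ### Sublaplacians on the Schwartz space -/

/-- A family of linear maps `D` of the Schwartz space representing the differential operators `d`,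
each of them skew-symmetric for the `L²` inner product. -/
structure IsSkewRealization (d : Horizontal → (ℝ × ℝ → ℂ) → (ℝ × ℝ → ℂ))
    (D : Horizontal → 𝓢(ℝ × ℝ, ℂ) →ₗ[ℂ] 𝓢(ℝ × ℝ, ℂ)) : Prop where
  coe_apply : ∀ X φ, ⇑(D X φ) = d X φ
  skew : ∀ X (φ ψ : 𝓢(ℝ × ℝ, ℂ)),
    inner ℂ ((D X φ).toLp 2 volume : L2) (ψ.toLp 2) =
      -inner ℂ (φ.toLp 2 volume : L2) ((D X ψ).toLp 2)

/-- The sublaplacian as a linear map of the Schwartz space. -/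
noncomputable def schwartzSublaplacian (D : Horizontal → 𝓢(ℝ × ℝ, ℂ) →ₗ[ℂ] 𝓢(ℝ × ℝ, ℂ)) :
    𝓢(ℝ × ℝ, ℂ) →ₗ[ℂ] 𝓢(ℝ × ℝ, ℂ) :=
  -(D .X₁ ∘ₗ D .X₁ + D .Y₁ ∘ₗ D .Y₁ + D .X₂ ∘ₗ D .X₂ + D .Y₂ ∘ₗ D .Y₂)

/-- The graph in `L²(ℝ²)` of the sublaplacian with domain the Schwartz space. -/
noncomputable def schwartzGraph (D : Horizontal → 𝓢(ℝ × ℝ, ℂ) →ₗ[ℂ] 𝓢(ℝ × ℝ, ℂ)) :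
    Submodule ℂ (L2 × L2) :=
  LinearMap.range (LinearMap.prod (SchwartzMap.toLpCLM ℂ ℂ 2 volume).toLinearMap
    ((SchwartzMap.toLpCLM ℂ ℂ 2 volume).toLinearMap ∘ₗ schwartzSublaplacian D))

namespace IsSkewRealization

variable {d : Horizontal → (ℝ × ℝ → ℂ) → (ℝ × ℝ → ℂ)}
  {D : Horizontal → 𝓢(ℝ × ℝ, ℂ) →ₗ[ℂ] 𝓢(ℝ × ℝ, ℂ)}

theorem coe_schwartzSublaplacian (h : IsSkewRealization d D) (φ : 𝓢(ℝ × ℝ, ℂ)) :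
    ⇑(schwartzSublaplacian D φ) = sublaplacian d φ := by
  ext u
  simp [schwartzSublaplacian, sublaplacian, ← h.coe_apply]

theorem mem_schwartzGraph (h : IsSkewRealization d D) {p : L2 × L2} :
    p ∈ schwartzGraph D ↔ ∃ φ : 𝓢(ℝ × ℝ, ℂ), p.1 =ᵐ[volume] (φ : ℝ × ℝ → ℂ) ∧
      p.2 =ᵐ[volume] sublaplacian d φ := by
  have key : ∀ (f : L2) (φ : 𝓢(ℝ × ℝ, ℂ)), φ.toLp 2 = f ↔ f =ᵐ[volume] (φ : ℝ × ℝ → ℂ) := by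
    intro f φ
    rw [Lp.ext_iff]
    exact ⟨fun e => e.symm.trans (φ.coeFn_toLp 2 volume),
      fun e => (φ.coeFn_toLp 2 volume).trans e.symm⟩
  simp only [schwartzGraph, LinearMap.mem_range, Prod.ext_iff, ← h.coe_schwartzSublaplacian, ← key]
  rfl

theorem closedGraph_eq (h : IsSkewRealization d D) :
    closedGraph (sublaplacian d) = ((schwartzGraph D).topologicalClosure : Set (L2 × L2)) := by
  have : {p : L2 × L2 | ∃ φ : 𝓢(ℝ × ℝ, ℂ), p.1 =ᵐ[volume] (φ : ℝ × ℝ → ℂ) ∧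
      p.2 =ᵐ[volume] sublaplacian d φ} = (schwartzGraph D : Set (L2 × L2)) :=
    Set.ext fun p => h.mem_schwartzGraph.symm
  rw [closedGraph, this, Submodule.topologicalClosure_coe]

/-- The sublaplacian is accretive: `⟪A φ, φ⟫ = ∑ ‖X φ‖²`. -/
theorem accretive (h : IsSkewRealization d D) :
    ∀ p ∈ schwartzGraph D, 0 ≤ (inner ℂ p.2 p.1).re := by
  rintro _ ⟨φ, rfl⟩
  have key : ∀ X, 0 ≤ (-inner ℂ ((D X (D X φ)).toLp 2 volume : L2) (φ.toLp 2)).re := by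
    intro X
    rw [h.skew, neg_neg]
    exact inner_self_nonneg (𝕜 := ℂ)
  have e : (schwartzSublaplacian D φ).toLp 2 volume = -((D .X₁ (D .X₁ φ)).toLp 2 volume +
      (D .Y₁ (D .Y₁ φ)).toLp 2 volume + (D .X₂ (D .X₂ φ)).toLp 2 volume +
      (D .Y₂ (D .Y₂ φ)).toLp 2 volume : L2) := by
    simp only [← SchwartzMap.toLpCLM_apply (𝕜 := ℂ), ← map_add, ← map_neg]
    rfl
  change 0 ≤ (inner ℂ ((schwartzSublaplacian D φ).toLp 2 volume : L2) (φ.toLp 2)).re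
  rw [e, inner_neg_left, inner_add_left, inner_add_left, inner_add_left]
  have h1 := key .X₁
  have h2 := key .Y₁
  have h3 := key .X₂
  have h4 := key .Y₂
  simp only [Complex.neg_re, Complex.add_re] at *
  linarith

end IsSkewRealization

theorem inner_toLp_toLp (φ ψ : 𝓢(ℝ × ℝ, ℂ)) :
    inner ℂ (φ.toLp 2 volume : L2) (ψ.toLp 2) = ∫ u, starRingEnd ℂ (φ u) * ψ u := by
  rw [MeasureTheory.L2.inner_def]
  refine integral_congr_ae ?_
  filter_upwards [φ.coeFn_toLp 2 volume, ψ.coeFn_toLp 2 volume] with u h1 h2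
  rw [h1, h2, RCLike.inner_apply, mul_comm]

/-- Multiplication by `i R`, for a real function `R` of temperate growth. -/
noncomputable def mulI (R : ℝ × ℝ → ℝ) : 𝓢(ℝ × ℝ, ℂ) →ₗ[ℂ] 𝓢(ℝ × ℝ, ℂ) :=
  (SchwartzMap.smulLeftCLM ℂ fun u => Complex.I * (R u : ℂ)).toLinearMap

theorem mulI_apply {R : ℝ × ℝ → ℝ} (hR : R.HasTemperateGrowth) (φ : 𝓢(ℝ × ℝ, ℂ)) (u : ℝ × ℝ) :
    mulI R φ u = Complex.I * R u * φ u := by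
  have : Function.HasTemperateGrowth fun u => Complex.I * (R u : ℂ) :=
    (Function.HasTemperateGrowth.const Complex.I).mul
      (Function.Complex.hasTemperateGrowth_ofReal.comp hR)
  simp [mulI, SchwartzMap.smulLeftCLM_apply_apply this]

theorem inner_mulI {R : ℝ × ℝ → ℝ} (hR : R.HasTemperateGrowth) (φ ψ : 𝓢(ℝ × ℝ, ℂ)) :
    inner ℂ ((mulI R φ).toLp 2 volume : L2) (ψ.toLp 2) =
      -inner ℂ (φ.toLp 2 volume : L2) ((mulI R ψ).toLp 2) := by
  rw [inner_toLp_toLp, inner_toLp_toLp, ← integral_neg]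
  congr 1 with u
  simp only [mulI_apply hR, map_mul, Complex.conj_I, Complex.conj_ofReal]
  ring

/-- The derivative in the direction `e`, as a linear map of the Schwartz space. -/
noncomputable def dirDeriv (e : ℝ × ℝ) : 𝓢(ℝ × ℝ, ℂ) →ₗ[ℂ] 𝓢(ℝ × ℝ, ℂ) :=
  (LineDeriv.lineDerivOpCLM ℂ 𝓢(ℝ × ℝ, ℂ) e).toLinearMap

theorem coe_dirDeriv_one_zero (φ : 𝓢(ℝ × ℝ, ℂ)) : ⇑(dirDeriv (1, 0) φ) = partial₁ φ := by
  ext u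
  have h : HasDerivAt (fun s : ℝ => φ (s, u.2)) (fderiv ℝ φ u (1, 0)) u.1 :=
    (φ.hasFDerivAt (u.1, u.2)).comp_hasDerivAt u.1
      ((hasDerivAt_id u.1).prodMk (hasDerivAt_const u.1 u.2))
  rw [partial₁, h.deriv]
  exact SchwartzMap.lineDerivOp_apply_eq_fderiv _ _ _

theorem coe_dirDeriv_zero_one (φ : 𝓢(ℝ × ℝ, ℂ)) : ⇑(dirDeriv (0, 1) φ) = partial₂ φ := by
  ext u
  have h : HasDerivAt (fun s : ℝ => φ (u.1, s)) (fderiv ℝ φ u (0, 1)) u.2 :=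
    (φ.hasFDerivAt (u.1, u.2)).comp_hasDerivAt u.2
      ((hasDerivAt_const u.2 u.1).prodMk (hasDerivAt_id u.2))
  rw [partial₂, h.deriv]
  exact SchwartzMap.lineDerivOp_apply_eq_fderiv _ _ _

theorem inner_dirDeriv (e : ℝ × ℝ) (φ ψ : 𝓢(ℝ × ℝ, ℂ)) :
    inner ℂ ((dirDeriv e φ).toLp 2 volume : L2) (ψ.toLp 2) =
      -inner ℂ (φ.toLp 2 volume : L2) ((dirDeriv e ψ).toLp 2) := by
  rw [inner_toLp_toLp, inner_toLp_toLp]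
  -- the real bilinear map `(z, w) ↦ conj z * w`
  have h := SchwartzMap.integral_bilinear_lineDerivOp_right_eq_neg_left (μ := volume) φ ψ
    ((ContinuousLinearMap.mul ℝ ℂ).comp (Complex.conjCLE : ℂ →L[ℝ] ℂ)) e
  exact (neg_eq_iff_eq_neg.2 h).symm

theorem inner_add_skew {A B : 𝓢(ℝ × ℝ, ℂ) →ₗ[ℂ] 𝓢(ℝ × ℝ, ℂ)}
    (hA : ∀ φ ψ : 𝓢(ℝ × ℝ, ℂ),
      inner ℂ ((A φ).toLp 2 volume : L2) (ψ.toLp 2) =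
        -inner ℂ (φ.toLp 2 volume : L2) ((A ψ).toLp 2))
    (hB : ∀ φ ψ : 𝓢(ℝ × ℝ, ℂ),
      inner ℂ ((B φ).toLp 2 volume : L2) (ψ.toLp 2) =
        -inner ℂ (φ.toLp 2 volume : L2) ((B ψ).toLp 2))
    (φ ψ : 𝓢(ℝ × ℝ, ℂ)) :
    inner ℂ (((A + B) φ).toLp 2 volume : L2) (ψ.toLp 2) =
      -inner ℂ (φ.toLp 2 volume : L2) (((A + B) ψ).toLp 2) := by
  have e : ∀ χ, ((A + B) χ).toLp 2 volume =
      ((A χ).toLp 2 volume + (B χ).toLp 2 volume : L2) := fun χ => by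
    simp only [← SchwartzMap.toLpCLM_apply (𝕜 := ℂ), ← map_add]
    rfl
  rw [e, e, inner_add_left, inner_add_right, hA, hB]
  ring

theorem hasTemperateGrowth_fst : Function.HasTemperateGrowth fun u : ℝ × ℝ => u.1 :=
  (ContinuousLinearMap.fst ℝ ℝ ℝ).hasTemperateGrowth

theorem hasTemperateGrowth_snd : Function.HasTemperateGrowth fun u : ℝ × ℝ => u.2 :=
  (ContinuousLinearMap.snd ℝ ℝ ℝ).hasTemperateGrowth

theorem hasTemperateGrowth_linear (a b : ℝ) :
    Function.HasTemperateGrowth fun u : ℝ × ℝ => a * u.1 + b * u.2 :=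
  ((Function.HasTemperateGrowth.const a).mul hasTemperateGrowth_fst).add
    ((Function.HasTemperateGrowth.const b).mul hasTemperateGrowth_snd)

/-- The infinitesimal representation `dπ_λ` on the Schwartz space. -/
noncomputable def dpiSchwartz (l₁ l₂ : ℝ) : Horizontal → 𝓢(ℝ × ℝ, ℂ) →ₗ[ℂ] 𝓢(ℝ × ℝ, ℂ)
  | .X₁ => dirDeriv (1, 0)
  | .Y₁ => mulI fun u => l₁ * u.1 + -l₂ * u.2
  | .X₂ => mulI fun u => l₂ * u.1 + 0 * u.2
  | .Y₂ => dirDeriv (0, 1)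

theorem isSkewRealization_dpi (l₁ l₂ : ℝ) :
    IsSkewRealization (dpi l₁ l₂) (dpiSchwartz l₁ l₂) := by
  refine ⟨fun X φ => ?_, fun X => ?_⟩
  · cases X
    · exact coe_dirDeriv_one_zero φ
    · ext u
      simp only [dpiSchwartz, dpi, mulI_apply (hasTemperateGrowth_linear _ _)]
      push_cast
      ring
    · ext u
      simp only [dpiSchwartz, dpi, mulI_apply (hasTemperateGrowth_linear _ _)]
      push_cast
      ring
    · exact coe_dirDeriv_zero_one φ
  · cases X
    · exact inner_dirDeriv _
    · exact inner_mulI (hasTemperateGrowth_linear _ _)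
    · exact inner_mulI (hasTemperateGrowth_linear _ _)
    · exact inner_dirDeriv _

/-- The infinitesimal representation `dρ_λ` on the Schwartz space. -/
noncomputable def drhoSchwartz (l₁ l₂ : ℝ) : Horizontal → 𝓢(ℝ × ℝ, ℂ) →ₗ[ℂ] 𝓢(ℝ × ℝ, ℂ)
  | .X₁ => dirDeriv (1, 0) + mulI fun u => 0 * u.1 + -(l₁ / 2) * u.2
  | .Y₁ => dirDeriv (0, 1) + mulI fun u => l₁ / 2 * u.1 + 0 * u.2
  | .X₂ => mulI fun u => l₂ * u.1 + 0 * u.2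
  | .Y₂ => mulI fun u => 0 * u.1 + l₂ * u.2

theorem isSkewRealization_drho (l₁ l₂ : ℝ) :
    IsSkewRealization (drho l₁ l₂) (drhoSchwartz l₁ l₂) := by
  refine ⟨fun X φ => ?_, fun X => ?_⟩
  · cases X <;> ext u <;>
    simp only [drhoSchwartz, drho, LinearMap.add_apply, add_apply,
      coe_dirDeriv_one_zero, coe_dirDeriv_zero_one,
      mulI_apply (hasTemperateGrowth_linear _ _)] <;>
    push_cast <;> ring
  · cases X
    · exact inner_add_skew (inner_dirDeriv _) (inner_mulI (hasTemperateGrowth_linear _ _))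
    · exact inner_add_skew (inner_dirDeriv _) (inner_mulI (hasTemperateGrowth_linear _ _))
    · exact inner_mulI (hasTemperateGrowth_linear _ _)
    · exact inner_mulI (hasTemperateGrowth_linear _ _)

/-! ### Gaussians as Schwartz functions -/

theorem hasTemperateGrowth_cexp_I : Function.HasTemperateGrowth fun s : ℝ =>
    Complex.exp (Complex.I * s) := by
  refine ⟨(contDiff_const.mul Complex.ofRealCLM.contDiff).cexp, fun n => ⟨0, 1, fun x => ?_⟩⟩
  have h : ∀ n, iteratedDeriv n (fun s : ℝ => Complex.exp (Complex.I * s)) =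
      fun s : ℝ => Complex.I ^ n * Complex.exp (Complex.I * s) := by
    intro n
    induction n with
    | zero => simp
    | succ n ih =>
      rw [iteratedDeriv_succ, ih]
      ext s
      have h1 : HasDerivAt (fun s : ℝ => Complex.I * (s : ℂ)) Complex.I s := by
        simpa using (Complex.ofRealCLM.hasDerivAt (x := s)).const_mul Complex.I
      rw [(h1.cexp.const_mul (Complex.I ^ n)).deriv]
      ring
  rw [norm_iteratedFDeriv_eq_norm_iteratedDeriv, h, norm_mul, norm_pow, Complex.norm_I, mul_comm
    Complex.I, Complex.norm_exp_ofReal_mul_I]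
  simp

theorem exists_bound_polynomial_mul_gaussian (p : Polynomial ℝ) :
    ∃ C, ∀ x : ℝ, |p.eval x * Real.exp (-(x ^ 2 / 2))| ≤ C := by
  have hx : ∀ n : ℕ, ∃ C, ∀ x : ℝ, |x ^ n * Real.exp (-(x ^ 2 / 2))| ≤ C := by
    intro n
    refine ⟨n.factorial * Real.exp (1 / 2), fun x => ?_⟩
    rw [abs_mul, Real.abs_exp, abs_pow]
    have h1 : |x| ^ n ≤ n.factorial * Real.exp |x| := by
      -- one term of the exponential series
      have := Real.pow_div_factorial_le_exp |x| (abs_nonneg x) n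
      rwa [div_le_iff₀' (by positivity)] at this
    have h2 : Real.exp |x| * Real.exp (-(x ^ 2 / 2)) ≤ Real.exp (1 / 2) := by
      rw [← Real.exp_add, Real.exp_le_exp]
      nlinarith [sq_nonneg (|x| - 1), sq_abs x]
    calc |x| ^ n * Real.exp (-(x ^ 2 / 2))
        ≤ n.factorial * Real.exp |x| * Real.exp (-(x ^ 2 / 2)) := by gcongr
      _ ≤ n.factorial * Real.exp (1 / 2) := by rw [mul_assoc]; gcongr
  induction p using Polynomial.induction_on' with
  | add p q hp hq =>
    obtain ⟨C, hC⟩ := hp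
    obtain ⟨C', hC'⟩ := hq
    refine ⟨C + C', fun x => ?_⟩
    rw [Polynomial.eval_add, add_mul]
    exact (abs_add_le _ _).trans (add_le_add (hC x) (hC' x))
  | monomial n a =>
    obtain ⟨C, hC⟩ := hx n
    refine ⟨|a| * C, fun x => ?_⟩
    rw [Polynomial.eval_monomial, mul_assoc, abs_mul]
    exact mul_le_mul_of_nonneg_left (hC x) (abs_nonneg a)

/-- The Gaussian `exp (-s² / 2)` on the line. -/
noncomputable def gaussianLine : 𝓢(ℝ, ℝ) where
  toFun s := Real.exp (-(s ^ 2 / 2))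
  smooth' := by fun_prop
  decay' k n := by
    obtain ⟨C, hC⟩ := exists_bound_polynomial_mul_gaussian
      (Polynomial.X ^ k * (Polynomial.hermite n).map (algebraMap ℤ ℝ))
    refine ⟨C, fun x => ?_⟩
    rw [norm_iteratedFDeriv_eq_norm_iteratedDeriv, iteratedDeriv_eq_iterate,
      Polynomial.deriv_gaussian_eq_hermite_mul_gaussian]
    refine le_trans (le_of_eq ?_) (hC x)
    simp [abs_mul, Polynomial.aeval_def, Polynomial.eval_map]
    ring

/-- Gaussian wave packets are Schwartz functions. The radial Gaussian arises by composing the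
one-dimensional one with `√(1 + ‖z‖²)`, and the general one from it by an affine substitution and
multiplication by a unimodular function. -/
theorem exists_schwartz_gaussian {a b c d : ℝ} (hdet : a * d - b * c ≠ 0) (e f : ℝ)
    {R : ℝ × ℝ → ℝ} (hR : R.HasTemperateGrowth) :
    ∃ φ : 𝓢(ℝ × ℝ, ℂ), ∀ u : ℝ × ℝ, φ u =
      Complex.exp (-(((a * u.1 + b * u.2 - e) ^ 2 + (c * u.1 + d * u.2 - f) ^ 2) / 2 : ℝ) +
        Complex.I * R u) := by
  have hJ : Function.HasTemperateGrowth fun z : ℂ => (1 + ‖z‖ ^ 2) ^ (1 / 2 : ℝ) :=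
    Function.hasTemperateGrowth_one_add_norm_sq_rpow ℂ (1 / 2)
  have hJ' : ∃ (k : ℕ) (C : ℝ), ∀ z : ℂ, ‖z‖ ≤ C * (1 + ‖(1 + ‖z‖ ^ 2) ^ (1 / 2 : ℝ)‖) ^ k := by
    refine ⟨1, 1, fun z => ?_⟩
    rw [← Real.sqrt_eq_rpow, Real.norm_of_nonneg (Real.sqrt_nonneg _), one_mul, pow_one]
    have : ‖z‖ ≤ √(1 + ‖z‖ ^ 2) := Real.le_sqrt_of_sq_le (by linarith)
    linarith
  let L : (ℝ × ℝ) ≃L[ℝ] ℂ := ({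
    toFun := fun u => ⟨a * u.1 + b * u.2, c * u.1 + d * u.2⟩
    map_add' := fun u v => by apply Complex.ext <;> simp <;> ring
    map_smul' := fun r u => by apply Complex.ext <;> simp <;> ring
    invFun := fun z => ((d * z.re - b * z.im) / (a * d - b * c),
      (a * z.im - c * z.re) / (a * d - b * c))
    left_inv := fun u => Prod.ext ((div_eq_iff hdet).2 (by ring)) ((div_eq_iff hdet).2 (by ring))
    right_inv := fun z => by
      apply Complex.ext <;> dsimp only <;>
        rw [mul_div_assoc', mul_div_assoc', ← add_div, div_eq_iff hdet] <;> ring } :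
    (ℝ × ℝ) ≃ₗ[ℝ] ℂ).toContinuousLinearEquiv
  have hI : Function.HasTemperateGrowth fun u => Complex.exp (Complex.I * (R u : ℂ)) :=
    hasTemperateGrowth_cexp_I.comp hR
  let φ₀ : 𝓢(ℂ, ℝ) := SchwartzMap.compCLM ℝ hJ hJ' gaussianLine
  let φ₁ : 𝓢(ℝ × ℝ, ℝ) := SchwartzMap.compCLMOfContinuousLinearEquiv ℝ L
    (SchwartzMap.compSubConstCLM ℝ (⟨e, f⟩ : ℂ) φ₀)
  let φ₂ : 𝓢(ℝ × ℝ, ℂ) := SchwartzMap.smulLeftCLM ℂ (fun u => Complex.exp (Complex.I * (R u : ℂ)))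
    (SchwartzMap.postcompCLM Complex.ofRealCLM φ₁)
  refine ⟨(Real.exp (1 / 2) : ℂ) • φ₂, fun u => ?_⟩
  have h1 : φ₁ u = Real.exp (-((1 + ((a * u.1 + b * u.2 - e) ^ 2 +
      (c * u.1 + d * u.2 - f) ^ 2)) / 2)) := by
    have e1 : φ₁ u = Real.exp (-(((1 + ‖L u - ⟨e, f⟩‖ ^ 2) ^ (1 / 2 : ℝ)) ^ 2 / 2)) := rfl
    have e2 : ‖L u - ⟨e, f⟩‖ ^ 2 = (a * u.1 + b * u.2 - e) ^ 2 + (c * u.1 + d * u.2 - f) ^ 2 := by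
      rw [← Complex.normSq_eq_norm_sq, Complex.normSq_apply]
      simp only [Complex.sub_re, Complex.sub_im, sq]
      rfl
    rw [e1, ← Real.sqrt_eq_rpow, Real.sq_sqrt (by positivity), e2]
  have h2 : φ₂ u = Complex.exp (Complex.I * R u) * (φ₁ u : ℂ) :=
    SchwartzMap.smulLeftCLM_apply_apply hI _ _
  rw [smul_apply, h2, h1, smul_eq_mul]
  push_cast
  rw [← Complex.exp_add, ← Complex.exp_add]
  congr 1
  ring

/-! ### The unitary intertwiner -/

/-- The restriction of a Schwartz function to the vertical line over `x`. -/
noncomputable def slice (h : 𝓢(ℝ × ℝ, ℂ)) (x : ℝ) : 𝓢(ℝ, ℂ) :=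
  SchwartzMap.compCLM ℂ (g := fun z : ℝ => (x, z))
    (by
      have := (Function.HasTemperateGrowth.const ((x, 0) : ℝ × ℝ)).add
        (ContinuousLinearMap.inr ℝ ℝ ℝ).hasTemperateGrowth
      convert this using 1
      ext z <;> simp)
    ⟨1, 1, fun z => by
      have : ‖z‖ ≤ ‖(x, z)‖ := le_max_right _ _
      rw [one_mul, pow_one]; linarith⟩ h

/-- The unitary Fourier transform in the second variable, with frequencies scaled by `l`. -/
noncomputable def partialFourier (l : ℝ) (h : ℝ × ℝ → ℂ) : ℝ × ℝ → ℂ := fun p =>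
  (√(|l| / (2 * Real.pi)) : ℝ) * ∫ z : ℝ, Complex.exp (-Complex.I * l * p.2 * z) * h (p.1, z)

/-- Plancherel's theorem for the Fourier transform with scaled frequencies. -/
theorem integral_norm_sq_fourier_scaled {l : ℝ} (hl : l ≠ 0) (φ : 𝓢(ℝ, ℂ)) :
    Integrable (fun y : ℝ => ‖(√(|l| / (2 * Real.pi)) : ℝ) *
      ∫ z : ℝ, Complex.exp (-Complex.I * l * y * z) * φ z‖ ^ 2) ∧
    ∫ y : ℝ, ‖(√(|l| / (2 * Real.pi)) : ℝ) *
      ∫ z : ℝ, Complex.exp (-Complex.I * l * y * z) * φ z‖ ^ 2 = ∫ z, ‖φ z‖ ^ 2 := by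
  have hpi : (0 : ℝ) < 2 * Real.pi := by positivity
  have hF : ∀ y : ℝ, ‖(√(|l| / (2 * Real.pi)) : ℝ) *
      ∫ z : ℝ, Complex.exp (-Complex.I * l * y * z) * φ z‖ ^ 2 =
      |l| / (2 * Real.pi) *
        ‖(FourierTransform.fourier φ : 𝓢(ℝ, ℂ)) (l / (2 * Real.pi) * y)‖ ^ 2 := by
    intro y
    rw [norm_mul, mul_pow, Complex.norm_real, Real.norm_eq_abs, sq_abs,
      Real.sq_sqrt (by positivity), SchwartzMap.fourier_coe, Real.fourier_eq']
    congr 3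
    refine integral_congr_ae (Eventually.of_forall fun z => ?_)
    simp only [smul_eq_mul]
    congr 2
    simp
    field_simp
  have hi : Integrable fun y => ‖(FourierTransform.fourier φ : 𝓢(ℝ, ℂ)) y‖ ^ 2 :=
    ((FourierTransform.fourier φ : 𝓢(ℝ, ℂ)).memLp 2 volume).integrable_norm_pow (by norm_num)
  have hne : l / (2 * Real.pi) ≠ 0 := div_ne_zero hl hpi.ne'
  simp only [hF]
  refine ⟨(hi.comp_mul_left' hne).const_mul _, ?_⟩
  rw [integral_const_mul, Measure.integral_comp_mul_left
    (fun y => ‖(FourierTransform.fourier φ : 𝓢(ℝ, ℂ)) y‖ ^ 2), SchwartzMap.integral_norm_sq_fourier,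
    abs_inv, abs_div, abs_of_pos hpi, smul_eq_mul, ← mul_assoc, mul_inv_cancel₀, one_mul]
  exact div_ne_zero (abs_ne_zero.2 hl) hpi.ne'

theorem measurable_partialFourier (l : ℝ) {h : ℝ × ℝ → ℂ} (hm : Measurable h) :
    StronglyMeasurable (partialFourier l h) := by
  refine StronglyMeasurable.const_mul ?_ _
  refine StronglyMeasurable.integral_prod_right
    (f := fun (p : ℝ × ℝ) (z : ℝ) => Complex.exp (-Complex.I * l * p.2 * z) * h (p.1, z)) ?_
  refine (Measurable.mul ?_ ?_).stronglyMeasurable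
  · exact Continuous.measurable (by fun_prop)
  · exact hm.comp (by fun_prop)

/-- Plancherel on each vertical line shows that the partial Fourier transform preserves the
`L²` norm of Schwartz functions. -/
theorem eLpNorm_partialFourier {l : ℝ} (hl : l ≠ 0) (h : 𝓢(ℝ × ℝ, ℂ)) :
    eLpNorm (partialFourier l h) 2 = eLpNorm h 2 := by
  rw [eLpNorm_eq_lintegral_rpow_enorm_toReal (by norm_num) (by norm_num),
    eLpNorm_eq_lintegral_rpow_enorm_toReal (by norm_num) (by norm_num)]
  congr 1
  have hm := (measurable_partialFourier l h.continuous.measurable).measurable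
  have conv : ∀ z : ℂ, ‖z‖ₑ ^ ENNReal.toReal 2 = ENNReal.ofReal (‖z‖ ^ 2) := by
    intro z
    rw [ENNReal.toReal_ofNat, ENNReal.rpow_ofNat, ← ofReal_norm, ENNReal.ofReal_pow (norm_nonneg _)]
  rw [Measure.volume_eq_prod, lintegral_prod _ (by fun_prop),
    lintegral_prod _ (by have := h.continuous.measurable; fun_prop)]
  refine lintegral_congr fun x => ?_
  obtain ⟨h1, h2⟩ := integral_norm_sq_fourier_scaled hl (slice h x)
  simp only [conv]
  have h3 : Integrable fun z => ‖slice h x z‖ ^ 2 :=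
    ((slice h x).memLp 2 volume).integrable_norm_pow (by norm_num)
  have e1 := ofReal_integral_eq_lintegral_ofReal h1 (Eventually.of_forall fun y => by positivity)
  have e2 := ofReal_integral_eq_lintegral_ofReal h3 (Eventually.of_forall fun y => by positivity)
  exact e1.symm.trans ((congrArg ENNReal.ofReal h2).trans e2)

theorem intertwiner_eq (l₁ l₂ : ℝ) (h : ℝ × ℝ → ℂ) (p : ℝ × ℝ) :
    intertwiner l₁ l₂ h p =
      Complex.exp (Complex.I * (l₁ / 2 * p.1 * p.2 : ℝ)) * partialFourier l₂ h p := by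
  simp only [intertwiner, partialFourier]
  push_cast
  ring_nf

theorem norm_cexp_I_mul (x : ℝ) : ‖Complex.exp (Complex.I * x)‖ = 1 := by
  rw [mul_comm, Complex.norm_exp_ofReal_mul_I]

theorem norm_intertwiner (l₁ l₂ : ℝ) (h : ℝ × ℝ → ℂ) (p : ℝ × ℝ) :
    ‖intertwiner l₁ l₂ h p‖ = ‖partialFourier l₂ h p‖ := by
  rw [intertwiner_eq, norm_mul, norm_cexp_I_mul, one_mul]

theorem hasTemperateGrowth_phase (l : ℝ) :
    Function.HasTemperateGrowth fun p : ℝ × ℝ => Complex.exp (Complex.I * (l * p.1 * p.2 : ℝ)) :=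
  hasTemperateGrowth_cexp_I.comp
    (((Function.HasTemperateGrowth.const l).mul hasTemperateGrowth_fst).mul hasTemperateGrowth_snd)

/-- Multiplication of Schwartz functions by the unimodular function `exp (i l x y)`. -/
noncomputable def phase (l : ℝ) : 𝓢(ℝ × ℝ, ℂ) →L[ℂ] 𝓢(ℝ × ℝ, ℂ) :=
  SchwartzMap.smulLeftCLM ℂ fun p : ℝ × ℝ => Complex.exp (Complex.I * (l * p.1 * p.2 : ℝ))

theorem phase_apply (l : ℝ) (f : 𝓢(ℝ × ℝ, ℂ)) (p : ℝ × ℝ) :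
    phase l f p = Complex.exp (Complex.I * (l * p.1 * p.2 : ℝ)) * f p := by
  rw [phase, SchwartzMap.smulLeftCLM_apply_apply (hasTemperateGrowth_phase l), smul_eq_mul]

theorem intertwinerInv_eq (l₁ l₂ : ℝ) (f : 𝓢(ℝ × ℝ, ℂ)) :
    intertwinerInv l₁ l₂ f = partialFourier (-l₂) (phase (-(l₁ / 2)) f) := by
  ext p
  simp only [intertwinerInv, partialFourier, phase_apply, abs_neg]
  congr 2 with y
  rw [← mul_assoc, mul_comm (Complex.exp _) (Complex.exp _)]
  congr 3 <;> push_cast <;> ring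

theorem stronglyMeasurable_intertwiner (l₁ l₂ : ℝ) {h : ℝ × ℝ → ℂ} (hm : Measurable h) :
    StronglyMeasurable (intertwiner l₁ l₂ h) := by
  rw [funext (intertwiner_eq l₁ l₂ h)]
  exact (Continuous.stronglyMeasurable (by fun_prop)).mul (measurable_partialFourier l₂ hm)

theorem stronglyMeasurable_intertwinerInv (l₁ l₂ : ℝ) (f : 𝓢(ℝ × ℝ, ℂ)) :
    StronglyMeasurable (intertwinerInv l₁ l₂ f) := by
  rw [intertwinerInv_eq]
  exact measurable_partialFourier _ (phase _ f).continuous.measurable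

theorem eLpNorm_intertwiner {l₁ l₂ : ℝ} (hl₂ : l₂ ≠ 0) (h : 𝓢(ℝ × ℝ, ℂ)) :
    eLpNorm (intertwiner l₁ l₂ h) 2 = eLpNorm h 2 :=
  (eLpNorm_congr_norm_ae (Eventually.of_forall (norm_intertwiner l₁ l₂ h))).trans
    (eLpNorm_partialFourier hl₂ h)

theorem eLpNorm_intertwinerInv {l₁ l₂ : ℝ} (hl₂ : l₂ ≠ 0) (f : 𝓢(ℝ × ℝ, ℂ)) :
    eLpNorm (intertwinerInv l₁ l₂ f) 2 = eLpNorm f 2 := by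
  rw [intertwinerInv_eq, eLpNorm_partialFourier (neg_ne_zero.2 hl₂)]
  refine eLpNorm_congr_norm_ae (Eventually.of_forall fun p => ?_)
  rw [phase_apply, norm_mul, norm_cexp_I_mul, one_mul]

theorem memLp_intertwiner {l₁ l₂ : ℝ} (hl₂ : l₂ ≠ 0) (h : 𝓢(ℝ × ℝ, ℂ)) :
    MemLp (intertwiner l₁ l₂ h) 2 :=
  ⟨(stronglyMeasurable_intertwiner l₁ l₂ h.continuous.measurable).aestronglyMeasurable, by
    rw [eLpNorm_intertwiner hl₂]; exact (h.memLp 2 volume).2⟩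

theorem memLp_intertwinerInv {l₁ l₂ : ℝ} (hl₂ : l₂ ≠ 0) (f : 𝓢(ℝ × ℝ, ℂ)) :
    MemLp (intertwinerInv l₁ l₂ f) 2 :=
  ⟨(stronglyMeasurable_intertwinerInv l₁ l₂ f).aestronglyMeasurable, by
    rw [eLpNorm_intertwinerInv hl₂]; exact (f.memLp 2 volume).2⟩

/-- Uniform integrable decay in the second variable, the one integrated over in `T⁻¹`. -/
theorem exists_bound_inv_one_add_sq (f : 𝓢(ℝ × ℝ, ℂ)) :
    ∃ C, 0 ≤ C ∧ ∀ x y, ‖f (x, y)‖ ≤ C * (1 + y ^ 2)⁻¹ := by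
  obtain ⟨C₀, hC₀⟩ := f.decay 0 0
  obtain ⟨C₂, hC₂⟩ := f.decay 2 0
  refine ⟨C₀ + C₂, add_nonneg hC₀.1.le hC₂.1.le, fun x y => ?_⟩
  have h0 := hC₀.2 (x, y)
  have h2 := hC₂.2 (x, y)
  rw [norm_iteratedFDeriv_zero] at h0 h2
  have h3 : y ^ 2 ≤ ‖(x, y)‖ ^ 2 := by
    rw [← sq_abs y]
    exact pow_le_pow_left₀ (abs_nonneg y) (le_max_right _ _) 2
  rw [← div_eq_mul_inv, le_div_iff₀ (by positivity)]
  nlinarith [mul_le_mul_of_nonneg_right h3 (norm_nonneg (f (x, y)))]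

theorem integrable_partialFourier_integrand {l : ℝ} (p : ℝ × ℝ) {h : ℝ × ℝ → ℂ}
    (hh : Integrable fun z : ℝ => h (p.1, z)) :
    Integrable fun z : ℝ => Complex.exp (-Complex.I * l * p.2 * z) * h (p.1, z) := by
  refine hh.bdd_mul (c := 1) (Continuous.aestronglyMeasurable (by fun_prop))
    (Eventually.of_forall fun z => ?_)
  have : -Complex.I * l * p.2 * z = Complex.I * (-l * p.2 * z : ℝ) := by push_cast; ring
  rw [this, norm_cexp_I_mul]

theorem norm_partialFourier_le (l : ℝ) (h : ℝ × ℝ → ℂ) (p : ℝ × ℝ) :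
    ‖partialFourier l h p‖ ≤ √(|l| / (2 * Real.pi)) * ∫ z : ℝ, ‖h (p.1, z)‖ := by
  rw [partialFourier, norm_mul, Complex.norm_real, Real.norm_of_nonneg (Real.sqrt_nonneg _)]
  refine mul_le_mul_of_nonneg_left ((norm_integral_le_integral_norm _).trans (le_of_eq ?_))
    (Real.sqrt_nonneg _)
  congr 1 with z
  have : -Complex.I * l * p.2 * z = Complex.I * (-l * p.2 * z : ℝ) := by push_cast; ring
  rw [norm_mul, this, norm_cexp_I_mul, one_mul]

theorem integrable_intertwiner_mul {l₁ l₂ : ℝ} {h : ℝ × ℝ → ℂ} (hm : Measurable h)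
    (hi : Integrable h) {f : ℝ × ℝ → ℂ} (hf : AEStronglyMeasurable f) {C : ℝ}
    (hfb : ∀ x y, ‖f (x, y)‖ ≤ C * (1 + y ^ 2)⁻¹) :
    Integrable fun p => intertwiner l₁ l₂ h p * f p := by
  have hb : Integrable fun p : ℝ × ℝ =>
      (√(|l₂| / (2 * Real.pi)) * ∫ z : ℝ, ‖h (p.1, z)‖) * (C * (1 + p.2 ^ 2)⁻¹) :=
    (hi.integral_norm_prod_left.const_mul _).mul_prod (integrable_inv_one_add_sq.const_mul C)
  refine hb.mono' ((stronglyMeasurable_intertwiner l₁ l₂ hm).aestronglyMeasurable.mul hf)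
    (Eventually.of_forall fun p => ?_)
  rw [norm_mul, norm_intertwiner]
  refine mul_le_mul (norm_partialFourier_le _ _ _) (hfb _ _) (norm_nonneg _) ?_
  exact mul_nonneg (Real.sqrt_nonneg _) (integral_nonneg fun _ => norm_nonneg _)

/-- The integral operators `T` and `T⁻¹` are adjoint to each other. -/
theorem integral_conj_intertwiner_mul {l₁ l₂ : ℝ} {h : ℝ × ℝ → ℂ} (hm : Measurable h)
    (hi : Integrable h) (f : 𝓢(ℝ × ℝ, ℂ)) :
    ∫ p, starRingEnd ℂ (intertwiner l₁ l₂ h p) * f p =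
      ∫ p, starRingEnd ℂ (h p) * intertwinerInv l₁ l₂ f p := by
  obtain ⟨C, hC0, hC⟩ := exists_bound_inv_one_add_sq f
  have hA : Integrable fun p => starRingEnd ℂ (intertwiner l₁ l₂ h p) * f p := by
    have h1 := integrable_intertwiner_mul (l₁ := l₁) (l₂ := l₂) hm hi
      (f := fun p => starRingEnd ℂ (f p)) (C := C)
      (Complex.continuous_conj.comp f.continuous).aestronglyMeasurable
      (fun x y => by rw [RCLike.norm_conj]; exact hC x y)
    have h2 := Complex.conjCLE.toContinuousLinearMap.integrable_comp h1
    refine h2.congr (Eventually.of_forall fun p => ?_)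
    simp
  have hB : Integrable fun p => starRingEnd ℂ (h p) * intertwinerInv l₁ l₂ f p := by
    have hint := hi.norm.mul_const
      (√(|-l₂| / (2 * Real.pi)) * ∫ z : ℝ, C * (1 + z ^ 2)⁻¹)
    refine hint.mono' ((hm.aestronglyMeasurable.star).mul
      (stronglyMeasurable_intertwinerInv l₁ l₂ f).aestronglyMeasurable)
      (Eventually.of_forall fun p => ?_)
    rw [norm_mul, RCLike.norm_conj, intertwinerInv_eq]
    refine mul_le_mul_of_nonneg_left ((norm_partialFourier_le _ _ _).trans ?_) (norm_nonneg _)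
    refine mul_le_mul_of_nonneg_left ?_ (Real.sqrt_nonneg _)
    refine integral_mono ((slice (phase (-(l₁ / 2)) f) p.1).integrable (μ := volume)).norm
      (integrable_inv_one_add_sq.const_mul C) fun z => ?_
    rw [phase_apply, norm_mul, norm_cexp_I_mul, one_mul]
    exact hC _ _
  have hsec : ∀ᵐ x : ℝ, Integrable fun z : ℝ => h (x, z) := by
    rw [Measure.volume_eq_prod] at hi
    exact hi.prod_right_ae
  have hA' := integral_prod _ hA
  have hB' := integral_prod _ hB
  rw [← Measure.volume_eq_prod] at hA' hB'
  rw [hA', hB']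
  refine integral_congr_ae (hsec.mono fun x hx => ?_)
  set c : ℂ := ((√(|l₂| / (2 * Real.pi)) : ℝ) : ℂ)
  have hc : starRingEnd ℂ c = c := Complex.conj_ofReal _
  -- the common integrand of both sides on the line over `x`
  let Φ : ℝ → ℝ → ℂ := fun y z => c * (Complex.exp (Complex.I * (-(l₁ / 2) * x * y : ℝ)) *
    Complex.exp (Complex.I * (l₂ * z * y : ℝ))) * (starRingEnd ℂ (h (x, z)) * f (x, y))
  have e1 : ∀ y, starRingEnd ℂ (intertwiner l₁ l₂ h (x, y)) * f (x, y) = ∫ z, Φ y z := by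
    intro y
    rw [intertwiner, map_mul, map_mul, hc, ← integral_conj, mul_assoc, mul_assoc,
      mul_comm _ (f (x, y)), ← integral_const_mul, ← integral_const_mul, ← integral_const_mul]
    congr 1 with z
    simp only [Φ, ← Complex.exp_conj, map_mul, map_neg, map_div₀, Complex.conj_I,
      Complex.conj_ofReal, map_ofNat]
    push_cast
    ring_nf
  have e2 : ∀ z, starRingEnd ℂ (h (x, z)) * intertwinerInv l₁ l₂ f (x, z) = ∫ y, Φ y z := by
    intro z
    rw [intertwinerInv]
    change _ * (c * _) = _
    rw [← integral_const_mul, ← integral_const_mul]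
    congr 1 with y
    simp only [Φ]
    push_cast
    ring_nf
  simp only [e1, e2]
  refine integral_integral_swap ?_
  have hprod : Integrable (fun q : ℝ × ℝ => f (x, q.1) * starRingEnd ℂ (h (x, q.2)))
      (volume.prod volume) :=
    Integrable.mul_prod ((slice f x).integrable (μ := volume))
      (Complex.conjCLE.toContinuousLinearMap.integrable_comp hx)
  have hb := hprod.bdd_mul (c := ‖c‖) (f := fun q : ℝ × ℝ =>
    c * (Complex.exp (Complex.I * (-(l₁ / 2) * x * q.1 : ℝ)) *
    Complex.exp (Complex.I * (l₂ * q.2 * q.1 : ℝ))))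
    (Continuous.aestronglyMeasurable (by fun_prop)) (Eventually.of_forall fun q => by
      rw [norm_mul, norm_mul, norm_cexp_I_mul, norm_cexp_I_mul, one_mul, mul_one])
  refine hb.congr (Eventually.of_forall fun q => ?_)
  simp only [Function.uncurry, Φ]
  ring

/-- Two norm-preserving maps defined on a dense subspace and adjoint to each other extend to a
unitary operator and its inverse. -/
theorem exists_unitary_of_adjoint {V H : Type*} [AddCommGroup V] [Module ℂ V]
    [NormedAddCommGroup H] [InnerProductSpace ℂ H] [CompleteSpace H] (e A B : V →ₗ[ℂ] H)
    (he : DenseRange e) (hA : ∀ x, ‖A x‖ = ‖e x‖) (hB : ∀ x, ‖B x‖ = ‖e x‖)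
    (hAB : ∀ x y, inner ℂ (A x) (e y) = inner ℂ (e x) (B y)) :
    ∃ T : H ≃ₗᵢ[ℂ] H, (∀ x, T (e x) = A x) ∧ ∀ x, T.symm (e x) = B x := by
  have ext : ∀ (C : V →ₗ[ℂ] H), (∀ x, ‖C x‖ = ‖e x‖) →
      ∃ C' : H →L[ℂ] H, (∀ x, C' (e x) = C x) ∧ ∀ f, ‖C' f‖ = ‖f‖ := by
    intro C hC
    have h1 : ∀ x, C.extendOfNorm e (e x) = C x :=
      LinearMap.extendOfNorm_eq he ⟨1, fun x => by rw [hC, one_mul]⟩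
    refine ⟨C.extendOfNorm e, h1, fun f => ?_⟩
    refine he.induction_on (p := fun f => ‖C.extendOfNorm e f‖ = ‖f‖) f
      (isClosed_eq (by fun_prop) (by fun_prop)) fun x => ?_
    rw [h1, hC]
  obtain ⟨A', hA1, hA2⟩ := ext A hA
  obtain ⟨B', hB1, hB2⟩ := ext B hB
  have hadj : ∀ f g, inner ℂ (A' f) g = inner ℂ f (B' g) := by
    intro f g
    refine he.induction_on₂ (p := fun f g => inner ℂ (A' f) g = inner ℂ f (B' g))
      (isClosed_eq (by fun_prop) (by fun_prop)) (fun x y => ?_) f g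
    rw [hA1, hB1, hAB]
  have hA3 : ∀ f g, inner ℂ (A' f) (A' g) = inner ℂ f g :=
    (LinearMap.norm_map_iff_inner_map_map A').1 hA2
  have hB3 : ∀ f g, inner ℂ (B' f) (B' g) = inner ℂ f g :=
    (LinearMap.norm_map_iff_inner_map_map B').1 hB2
  have hAB' : ∀ f, A' (B' f) = f := fun f =>
    ext_inner_right ℂ fun g => by rw [hadj, hB3]
  have hBA' : ∀ f, B' (A' f) = f := fun f =>
    ext_inner_left ℂ fun g => by rw [← hadj, hA3]
  let U : H ≃ₗ[ℂ] H := { A'.toLinearMap with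
    invFun := B'
    left_inv := hBA'
    right_inv := hAB' }
  exact ⟨⟨U, hA2⟩, hA1, hB1⟩

theorem inner_toLp_eq_integral {f g : ℝ × ℝ → ℂ} (hf : MemLp f 2) (hg : MemLp g 2) :
    inner ℂ (hf.toLp f : L2) (hg.toLp g) = ∫ p, starRingEnd ℂ (f p) * g p := by
  rw [MeasureTheory.L2.inner_def]
  refine integral_congr_ae ?_
  filter_upwards [hf.coeFn_toLp, hg.coeFn_toLp] with u h1 h2
  rw [h1, h2, RCLike.inner_apply, mul_comm]

theorem partialFourier_add (l : ℝ) (h k : 𝓢(ℝ × ℝ, ℂ)) (p : ℝ × ℝ) :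
    partialFourier l (h + k : 𝓢(ℝ × ℝ, ℂ)) p = partialFourier l h p + partialFourier l k p := by
  simp only [partialFourier, add_apply, mul_add]
  rw [integral_add (integrable_partialFourier_integrand p (h := h) (slice h p.1).integrable)
    (integrable_partialFourier_integrand p (h := k) (slice k p.1).integrable), mul_add]

theorem partialFourier_smul (l : ℝ) (r : ℂ) (h : ℝ × ℝ → ℂ) (p : ℝ × ℝ) :
    partialFourier l (fun q => r * h q) p = r * partialFourier l h p := by
  simp only [partialFourier]
  rw [mul_left_comm, ← integral_const_mul r]
  congr 1
  refine integral_congr_ae (Eventually.of_forall fun z => ?_)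
  ring

/-- The unitary operator `T`. -/
theorem exists_unitary_intertwiner (l₁ : ℝ) {l₂ : ℝ} (hl₂ : l₂ ≠ 0) :
    ∃ T : L2 ≃ₗᵢ[ℂ] L2,
      (∀ h : 𝓢(ℝ × ℝ, ℂ), T (h.toLp 2 volume) = (memLp_intertwiner (l₁ := l₁) hl₂ h).toLp _) ∧
      ∀ f : 𝓢(ℝ × ℝ, ℂ), T.symm (f.toLp 2 volume) =
        (memLp_intertwinerInv (l₁ := l₁) hl₂ f).toLp _ := by
  let A : 𝓢(ℝ × ℝ, ℂ) →ₗ[ℂ] L2 :=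
    { toFun := fun h => (memLp_intertwiner (l₁ := l₁) hl₂ h).toLp _
      map_add' := fun h k => by
        rw [← MemLp.toLp_add]
        congr 1
        ext p
        rw [Pi.add_apply, intertwiner_eq, intertwiner_eq, intertwiner_eq,
          partialFourier_add, mul_add]
      map_smul' := fun r h => by
        rw [RingHom.id_apply, ← MemLp.toLp_const_smul]
        congr 1
        ext p
        rw [Pi.smul_apply, intertwiner_eq, intertwiner_eq, smul_eq_mul, mul_left_comm r,
          ← partialFourier_smul l₂ r]
        rfl }
  let B : 𝓢(ℝ × ℝ, ℂ) →ₗ[ℂ] L2 :=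
    { toFun := fun f => (memLp_intertwinerInv (l₁ := l₁) hl₂ f).toLp _
      map_add' := fun h k => by
        rw [← MemLp.toLp_add]
        congr 1
        ext p
        rw [Pi.add_apply, intertwinerInv_eq, intertwinerInv_eq, intertwinerInv_eq, map_add,
          partialFourier_add]
      map_smul' := fun r h => by
        rw [RingHom.id_apply, ← MemLp.toLp_const_smul]
        congr 1
        ext p
        rw [Pi.smul_apply, intertwinerInv_eq, intertwinerInv_eq, map_smul, smul_eq_mul,
          ← partialFourier_smul]
        rfl }
  refine exists_unitary_of_adjoint (SchwartzMap.toLpCLM ℂ ℂ 2 volume).toLinearMap A B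
    (SchwartzMap.denseRange_toLpCLM (by norm_num)) (fun h => ?_) (fun f => ?_) fun h f => ?_
  · refine (Lp.norm_toLp _ (memLp_intertwiner (l₁ := l₁) hl₂ h)).trans
      ((congrArg ENNReal.toReal (eLpNorm_intertwiner hl₂ h)).trans ?_)
    exact (SchwartzMap.norm_toLp (f := h)).symm
  · refine (Lp.norm_toLp _ (memLp_intertwinerInv (l₁ := l₁) hl₂ f)).trans
      ((congrArg ENNReal.toReal (eLpNorm_intertwinerInv hl₂ f)).trans ?_)
    exact (SchwartzMap.norm_toLp (f := f)).symm
  · exact (inner_toLp_eq_integral (memLp_intertwiner (l₁ := l₁) hl₂ h) (f.memLp 2 volume)).trans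
      ((integral_conj_intertwiner_mul h.continuous.measurable h.integrable f).trans
      (inner_toLp_eq_integral (h.memLp 2 volume) (memLp_intertwinerInv (l₁ := l₁) hl₂ f)).symm)

theorem locallyIntegrable_intertwiner (l₁ l₂ : ℝ) {h : ℝ × ℝ → ℂ} (hm : Measurable h)
    (hi : Integrable h) : LocallyIntegrable (intertwiner l₁ l₂ h) := by
  have h1 := integrable_intertwiner_mul (l₁ := l₁) (l₂ := l₂) hm hi
    (f := fun p : ℝ × ℝ => ((1 + p.2 ^ 2 : ℝ) : ℂ)⁻¹) (C := 1)
    (Measurable.aestronglyMeasurable (by fun_prop)) (fun x y => by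
      rw [← Complex.ofReal_inv, Complex.norm_real, Real.norm_of_nonneg (by positivity), one_mul])
  have h2 := h1.locallyIntegrable.mul_continuous
    (g := fun p : ℝ × ℝ => ((1 + p.2 ^ 2 : ℝ) : ℂ)) (by fun_prop)
  refine h2.congr (Eventually.of_forall fun p => ?_)
  have : ((1 + p.2 ^ 2 : ℝ) : ℂ) ≠ 0 := by
    rw [Complex.ofReal_ne_zero]; positivity
  field_simp

/-- The integral formula for `T` holds on `L¹ ∩ L²`, because it can be tested against smooth
functions using the adjoint operator. -/
theorem unitary_apply_eq_intertwiner {l₁ l₂ : ℝ} (hl₂ : l₂ ≠ 0) {T : L2 ≃ₗᵢ[ℂ] L2}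
    (hT : ∀ f : 𝓢(ℝ × ℝ, ℂ), T.symm (f.toLp 2 volume) =
      (memLp_intertwinerInv (l₁ := l₁) hl₂ f).toLp _)
    {h : ℝ × ℝ → ℂ} (hm : Measurable h) (hi : Integrable h) (h2 : MemLp h 2) :
    T (h2.toLp h) =ᵐ[volume] intertwiner l₁ l₂ h := by
  refine ae_eq_of_integral_contDiff_smul_eq
    ((Lp.memLp (T (h2.toLp h))).locallyIntegrable (by norm_num))
    (locallyIntegrable_intertwiner l₁ l₂ hm hi) fun g hg hgc => ?_
  let φ : 𝓢(ℝ × ℝ, ℂ) := HasCompactSupport.toSchwartzMap (f := fun p => (g p : ℂ))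
    (hgc.comp_left Complex.ofReal_zero) (Complex.ofRealCLM.contDiff.comp hg)
  have hφ : ∀ p, φ p = g p := fun p => rfl
  have e1 : inner ℂ (T (h2.toLp h)) (φ.toLp 2 volume) =
      ∫ p, starRingEnd ℂ (T (h2.toLp h) p) * φ p := by
    rw [MeasureTheory.L2.inner_def]
    refine integral_congr_ae ?_
    filter_upwards [φ.coeFn_toLp 2 volume] with u h1
    rw [h1, RCLike.inner_apply, mul_comm]
  have e2 : inner ℂ (T (h2.toLp h)) (φ.toLp 2 volume) =
      ∫ p, starRingEnd ℂ (intertwiner l₁ l₂ h p) * φ p := by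
    rw [integral_conj_intertwiner_mul hm hi, ← inner_toLp_eq_integral h2
      (memLp_intertwinerInv (l₁ := l₁) hl₂ φ), ← hT, ← T.inner_map_map (h2.toLp h),
      T.apply_symm_apply]
  have e3 := congrArg (starRingEnd ℂ) (e1.symm.trans e2)
  rw [← integral_conj, ← integral_conj] at e3
  simpa [hφ, mul_comm] using e3

/-! ### Diagonalisation of the potential -/

/-- Orthonormal coordinates `u'₁ = a u₁ + b u₂`, `u'₂ = c u₁ + d u₂` diagonalising the potential:
`(l₁ u₁ - l₂ u₂)² + (l₂ u₁)² = ω² u'₁² + ν² u'₂²`. The last three fields compare coefficients. -/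
structure Diagonalization (l₁ l₂ : ℝ) where
  (a b c d ω ν : ℝ)
  ω_pos : 0 < ω
  ν_pos : 0 < ν
  norm_fst : a ^ 2 + b ^ 2 = 1
  norm_snd : c ^ 2 + d ^ 2 = 1
  orth : a * c + b * d = 0
  form_fst : ω ^ 2 * a ^ 2 + ν ^ 2 * c ^ 2 = l₁ ^ 2 + l₂ ^ 2
  form_mixed : ω ^ 2 * (a * b) + ν ^ 2 * (c * d) = -(l₁ * l₂)
  form_snd : ω ^ 2 * b ^ 2 + ν ^ 2 * d ^ 2 = l₂ ^ 2

/-- A square matrix with orthonormal columns has orthonormal rows. -/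
theorem orthonormal_rows {a b c d : ℝ} (h1 : a ^ 2 + b ^ 2 = 1) (h2 : c ^ 2 + d ^ 2 = 1)
    (h3 : a * c + b * d = 0) :
    a ^ 2 + c ^ 2 = 1 ∧ b ^ 2 + d ^ 2 = 1 ∧ a * b + c * d = 0 ∧ (a * d - b * c) ^ 2 = 1 := by
  have hD : (a * d - b * c) ^ 2 = 1 := by
    linear_combination (c ^ 2 + d ^ 2) * h1 + h2 - (a * c + b * d) * h3
  have hd : d = (a * d - b * c) * a := by linear_combination -d * h1 + b * h3
  have hc : c = -((a * d - b * c) * b) := by linear_combination -c * h1 + a * h3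
  refine ⟨?_, ?_, ?_, hD⟩
  · linear_combination h1 + b ^ 2 * hD + (c - (a * d - b * c) * b) * hc
  · linear_combination h1 + a ^ 2 * hD + (d + (a * d - b * c) * a) * hd
  · linear_combination -a * b * hD + d * hc - (a * d - b * c) * b * hd

/-- The coefficients of the potential are recovered from the eigenvector equations. -/
theorem form_of_eigenvectors {a b c d μ ν l₁ l₂ : ℝ} (h1 : a ^ 2 + b ^ 2 = 1)
    (h2 : c ^ 2 + d ^ 2 = 1) (h3 : a * c + b * d = 0)
    (e1 : (l₁ ^ 2 + l₂ ^ 2) * a - l₁ * l₂ * b = μ * a) (e2 : -(l₁ * l₂ * a) + l₂ ^ 2 * b = μ * b)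
    (e3 : (l₁ ^ 2 + l₂ ^ 2) * c - l₁ * l₂ * d = ν * c)
    (e4 : -(l₁ * l₂ * c) + l₂ ^ 2 * d = ν * d) :
    μ * a ^ 2 + ν * c ^ 2 = l₁ ^ 2 + l₂ ^ 2 ∧ μ * (a * b) + ν * (c * d) = -(l₁ * l₂) ∧
      μ * b ^ 2 + ν * d ^ 2 = l₂ ^ 2 := by
  obtain ⟨r1, r2, r3, -⟩ := orthonormal_rows h1 h2 h3
  refine ⟨?_, ?_, ?_⟩
  · linear_combination -a * e1 - c * e3 + (l₁ ^ 2 + l₂ ^ 2) * r1 - l₁ * l₂ * r3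
  · linear_combination -b * e1 - d * e3 + (l₁ ^ 2 + l₂ ^ 2) * r3 - l₁ * l₂ * r2
  · linear_combination -b * e2 - d * e4 - l₁ * l₂ * r3 + l₂ ^ 2 * r2

theorem muPlus_mul_muMinus (l₁ l₂ : ℝ) : muPlus l₁ l₂ * muMinus l₁ l₂ = (l₂ ^ 2) ^ 2 := by
  have hs : √(l₁ ^ 2 + 4 * l₂ ^ 2) ^ 2 = l₁ ^ 2 + 4 * l₂ ^ 2 := Real.sq_sqrt (by positivity)
  rw [muPlus, muMinus]
  linear_combination (-1 / 4) * |l₁| ^ 2 * hs - (1 / 4) * (l₁ ^ 2 + 4 * l₂ ^ 2) * sq_abs l₁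

theorem muPlus_pos (l₁ : ℝ) {l₂ : ℝ} (hl₂ : l₂ ≠ 0) : 0 < muPlus l₁ l₂ := by
  rw [muPlus]; positivity

theorem muMinus_pos (l₁ : ℝ) {l₂ : ℝ} (hl₂ : l₂ ≠ 0) : 0 < muMinus l₁ l₂ := by
  refine (mul_pos_iff_of_pos_left (muPlus_pos l₁ hl₂)).1 ?_
  rw [muPlus_mul_muMinus]; positivity

/-- The diagonalisation given by the matrix `k_λ`. -/
theorem exists_diagonalization (l₁ : ℝ) {l₂ : ℝ} (hl₂ : l₂ ≠ 0) :
    ∃ D : Diagonalization l₁ l₂, muPlus l₁ l₂ = D.ω ^ 2 ∧ muMinus l₁ l₂ = D.ν ^ 2 ∧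
      ∀ u, diagCoord l₁ l₂ u 0 = D.a * u.1 + D.b * u.2 ∧
        diagCoord l₁ l₂ u 1 = D.c * u.1 + D.d * u.2 := by
  have hp := muPlus_pos l₁ hl₂
  have hm := muMinus_pos l₁ hl₂
  have hsp : √(muPlus l₁ l₂) ^ 2 = muPlus l₁ l₂ := Real.sq_sqrt hp.le
  have hsm : √(muMinus l₁ l₂) ^ 2 = muMinus l₁ l₂ := Real.sq_sqrt hm.le
  have hs : √(l₁ ^ 2 + 4 * l₂ ^ 2) ^ 2 = l₁ ^ 2 + 4 * l₂ ^ 2 := Real.sq_sqrt (by positivity)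
  have ha := sq_abs l₁
  let k := kMatrix l₁ l₂
  have hk : ∀ u, diagCoord l₁ l₂ u 0 = k 0 0 * u.1 + k 1 0 * u.2 ∧
      diagCoord l₁ l₂ u 1 = k 0 1 * u.1 + k 1 1 * u.2 := by
    intro u
    simp [diagCoord, Matrix.mulVec, dotProduct, Fin.sum_univ_two, k]
  suffices h : (k 0 0 ^ 2 + k 1 0 ^ 2 = 1 ∧ k 0 1 ^ 2 + k 1 1 ^ 2 = 1 ∧
      k 0 0 * k 0 1 + k 1 0 * k 1 1 = 0) ∧
      ((l₁ ^ 2 + l₂ ^ 2) * k 0 0 - l₁ * l₂ * k 1 0 = muPlus l₁ l₂ * k 0 0 ∧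
      -(l₁ * l₂ * k 0 0) + l₂ ^ 2 * k 1 0 = muPlus l₁ l₂ * k 1 0) ∧
      ((l₁ ^ 2 + l₂ ^ 2) * k 0 1 - l₁ * l₂ * k 1 1 = muMinus l₁ l₂ * k 0 1 ∧
      -(l₁ * l₂ * k 0 1) + l₂ ^ 2 * k 1 1 = muMinus l₁ l₂ * k 1 1) by
    obtain ⟨⟨h1, h2, h3⟩, ⟨e1, e2⟩, e3, e4⟩ := h
    obtain ⟨f1, f2, f3⟩ := form_of_eigenvectors h1 h2 h3 e1 e2 e3 e4
    rw [← hsp, ← hsm] at f1 f2 f3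
    exact ⟨⟨_, _, _, _, _, _, Real.sqrt_pos.2 hp, Real.sqrt_pos.2 hm, h1, h2, h3, f1, f2, f3⟩,
      hsp.symm, hsm.symm, hk⟩
  by_cases h0 : l₁ = 0
  · subst h0
    simp [k, kMatrix, muPlus, muMinus]
  · have hNp : 0 < (l₁ * l₂) ^ 2 + bPlus l₁ l₂ ^ 2 := by positivity
    have hNm : 0 < (l₁ * l₂) ^ 2 + bMinus l₁ l₂ ^ 2 := by positivity
    have hb : bPlus l₁ l₂ * bMinus l₁ l₂ = -(l₁ * l₂) ^ 2 := by
      rw [bPlus, bMinus]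
      linear_combination (-1 / 4) * |l₁| ^ 2 * hs - (1 / 4) * (l₁ ^ 2 + 4 * l₂ ^ 2) * ha
    -- the eigenvector equations for the unnormalised columns
    have q1 : (l₁ ^ 2 + l₂ ^ 2) * (l₁ * l₂) - l₁ * l₂ * bPlus l₁ l₂ =
        muPlus l₁ l₂ * (l₁ * l₂) := by
      rw [bPlus, muPlus]; ring
    have q2 : -(l₁ * l₂ * (l₁ * l₂)) + l₂ ^ 2 * bPlus l₁ l₂ = muPlus l₁ l₂ * bPlus l₁ l₂ := by
      rw [bPlus, muPlus]
      linear_combination (1 / 4) * |l₁| ^ 2 * hs + (1 / 4) * (l₁ ^ 2 + 4 * l₂ ^ 2) * ha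
    have q3 : (l₁ ^ 2 + l₂ ^ 2) * (l₁ * l₂) - l₁ * l₂ * bMinus l₁ l₂ =
        muMinus l₁ l₂ * (l₁ * l₂) := by
      rw [bMinus, muMinus]; ring
    have q4 : -(l₁ * l₂ * (l₁ * l₂)) + l₂ ^ 2 * bMinus l₁ l₂ = muMinus l₁ l₂ * bMinus l₁ l₂ := by
      rw [bMinus, muMinus]
      linear_combination (1 / 4) * |l₁| ^ 2 * hs + (1 / 4) * (l₁ ^ 2 + 4 * l₂ ^ 2) * ha
    simp only [k, kMatrix, h0, if_false, Matrix.of_apply, Matrix.cons_val_zero,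
      Matrix.cons_val_one, Matrix.cons_val', Matrix.cons_val_fin_one]
    have sp := Real.sq_sqrt hNp.le
    have sm := Real.sq_sqrt hNm.le
    have sp0 := (Real.sqrt_pos.2 hNp).ne'
    have sm0 := (Real.sqrt_pos.2 hNm).ne'
    set Np := √((l₁ * l₂) ^ 2 + bPlus l₁ l₂ ^ 2)
    set Nm := √((l₁ * l₂) ^ 2 + bMinus l₁ l₂ ^ 2)
    refine ⟨⟨?_, ?_, ?_⟩, ⟨?_, ?_⟩, ?_, ?_⟩
    · rw [div_pow, div_pow, ← add_div, sp, div_self hNp.ne']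
    · rw [div_pow, div_pow, ← add_div, sm, div_self hNm.ne']
    · rw [div_mul_div_comm, div_mul_div_comm, ← add_div, hb]
      simp [sq]
    · linear_combination q1 / Np
    · linear_combination q2 / Np
    · linear_combination q3 / Nm
    · linear_combination q4 / Nm

namespace Diagonalization

variable {l₁ l₂ : ℝ} (D : Diagonalization l₁ l₂)

/-- The `(1,1)` entry of the square root of the matrix of the potential. -/
def p : ℝ := D.ω * D.a ^ 2 + D.ν * D.c ^ 2

/-- The off-diagonal entry of the square root of the matrix of the potential. -/
def q : ℝ := D.ω * (D.a * D.b) + D.ν * (D.c * D.d)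

/-- The `(2,2)` entry of the square root of the matrix of the potential. -/
def r : ℝ := D.ω * D.b ^ 2 + D.ν * D.d ^ 2

theorem rows : D.a ^ 2 + D.c ^ 2 = 1 ∧ D.b ^ 2 + D.d ^ 2 = 1 ∧ D.a * D.b + D.c * D.d = 0 ∧
    (D.a * D.d - D.b * D.c) ^ 2 = 1 :=
  orthonormal_rows D.norm_fst D.norm_snd D.orth

theorem det_ne_zero : D.a * D.d - D.b * D.c ≠ 0 := fun h => by
  have := D.rows.2.2.2
  rw [h] at this
  norm_num at this

theorem p_sq_add_q_sq : D.p ^ 2 + D.q ^ 2 = l₁ ^ 2 + l₂ ^ 2 := by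
  rw [p, q]
  linear_combination D.form_fst + D.ω ^ 2 * D.a ^ 2 * D.norm_fst + D.ν ^ 2 * D.c ^ 2 * D.norm_snd +
    2 * D.ω * D.ν * D.a * D.c * D.orth

theorem q_mul_p_add_r : D.q * (D.p + D.r) = -(l₁ * l₂) := by
  rw [p, q, r]
  linear_combination D.form_mixed + D.ω ^ 2 * (D.a * D.b) * D.norm_fst +
    D.ν ^ 2 * (D.c * D.d) * D.norm_snd + D.ω * D.ν * (D.a * D.d + D.b * D.c) * D.orth

theorem q_sq_add_r_sq : D.q ^ 2 + D.r ^ 2 = l₂ ^ 2 := by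
  rw [r, q]
  linear_combination D.form_snd + D.ω ^ 2 * D.b ^ 2 * D.norm_fst + D.ν ^ 2 * D.d ^ 2 * D.norm_snd +
    2 * D.ω * D.ν * D.b * D.d * D.orth

theorem p_add_r : D.p + D.r = D.ω + D.ν := by
  rw [p, r]
  linear_combination D.ω * D.norm_fst + D.ν * D.norm_snd

theorem det_sqrt : D.p * D.r - D.q ^ 2 = D.ω * D.ν := by
  rw [p, q, r]
  linear_combination D.ω * D.ν * D.rows.2.2.2

theorem r_pos : 0 < D.r := by
  have h := D.rows.2.1
  have hω := D.ω_pos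
  have hν := D.ν_pos
  rw [r]
  rcases eq_or_ne D.b 0 with hb | hb
  · have hd : D.d ≠ 0 := fun hd => by rw [hb, hd] at h; norm_num at h
    positivity
  · positivity

end Diagonalization

/-! ### Sublaplacians of exponentials of quadratic polynomials -/

/-- The exponential of the polynomial `A x² + B x y + C y² + E x + F y + G`. -/
noncomputable def quadExp (A B C E F G : ℂ) (u : ℝ × ℝ) : ℂ :=
  Complex.exp (A * u.1 ^ 2 + B * u.1 * u.2 + C * u.2 ^ 2 + E * u.1 + F * u.2 + G)

section QuadExp

variable (A B C E F G α β γ : ℂ)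

theorem partial₁_mul_quadExp :
    partial₁ (fun u => (α + β * u.1 + γ * u.2) * quadExp A B C E F G u) = fun u =>
      (β + (α + β * u.1 + γ * u.2) * (2 * A * u.1 + B * u.2 + E)) * quadExp A B C E F G u := by
  ext u
  have hx : HasDerivAt (fun s : ℝ => (s : ℂ)) 1 u.1 := Complex.ofRealCLM.hasDerivAt
  have h1 : HasDerivAt (fun s : ℝ => α + β * (s : ℂ) + γ * u.2) β u.1 := by
    simpa using ((hx.const_mul β).const_add α).add_const (γ * (u.2 : ℂ))
  have h2 : HasDerivAt (fun s : ℝ => A * (s : ℂ) ^ 2 + B * s * u.2 + C * u.2 ^ 2 + E * s + F * u.2 +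
      G) (2 * A * u.1 + B * u.2 + E) u.1 := by
    refine (((((((hx.pow 2).const_mul A).add ((hx.const_mul B).mul_const (u.2 : ℂ))).add_const
      (C * (u.2 : ℂ) ^ 2)).add (hx.const_mul E)).add_const (F * (u.2 : ℂ))).add_const
        G).congr_deriv ?_
    simp
    ring
  refine ((h1.mul h2.cexp).congr_deriv ?_).deriv
  simp only [quadExp]
  ring

theorem partial₂_mul_quadExp :
    partial₂ (fun u => (α + β * u.1 + γ * u.2) * quadExp A B C E F G u) = fun u =>
      (γ + (α + β * u.1 + γ * u.2) * (B * u.1 + 2 * C * u.2 + F)) * quadExp A B C E F G u := by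
  ext u
  have hx : HasDerivAt (fun s : ℝ => (s : ℂ)) 1 u.2 := Complex.ofRealCLM.hasDerivAt
  have h1 : HasDerivAt (fun s : ℝ => α + β * u.1 + γ * (s : ℂ)) γ u.2 := by
    simpa using (hx.const_mul γ).const_add (α + β * (u.1 : ℂ))
  have h2 : HasDerivAt (fun s : ℝ => A * (u.1 : ℂ) ^ 2 + B * u.1 * s + C * s ^ 2 + E * u.1 + F * s +
      G) (B * u.1 + 2 * C * u.2 + F) u.2 := by
    refine ((((((hx.const_mul (B * (u.1 : ℂ))).const_add (A * (u.1 : ℂ) ^ 2)).add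
      ((hx.pow 2).const_mul C)).add_const (E * (u.1 : ℂ))).add (hx.const_mul F)).add_const
        G).congr_deriv ?_
    simp
    ring
  refine ((h1.mul h2.cexp).congr_deriv ?_).deriv
  simp only [quadExp]
  ring

theorem partial₁_quadExp :
    partial₁ (quadExp A B C E F G) = fun u =>
      (E + 2 * A * u.1 + B * u.2) * quadExp A B C E F G u := by
  have h := partial₁_mul_quadExp A B C E F G 1 0 0
  simp only [zero_mul, add_zero, one_mul] at h
  rw [h]
  ext u
  ring

theorem partial₂_quadExp :
    partial₂ (quadExp A B C E F G) = fun u =>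
      (F + B * u.1 + 2 * C * u.2) * quadExp A B C E F G u := by
  have h := partial₂_mul_quadExp A B C E F G 1 0 0
  simp only [zero_mul, add_zero, one_mul] at h
  rw [h]
  ext u
  ring

theorem sublaplacian_dpi_quadExp (l₁ l₂ : ℝ) (u : ℝ × ℝ) :
    sublaplacian (dpi l₁ l₂) (quadExp A B C E F G) u =
      (-(2 * A + (E + 2 * A * u.1 + B * u.2) ^ 2) - (2 * C + (F + B * u.1 + 2 * C * u.2) ^ 2) +
        (l₁ * u.1 - l₂ * u.2) ^ 2 + (l₂ * u.1) ^ 2) * quadExp A B C E F G u := by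
  simp only [sublaplacian, dpi]
  rw [partial₁_quadExp, partial₁_mul_quadExp, partial₂_quadExp, partial₂_mul_quadExp]
  linear_combination (-(l₁ * u.1 - l₂ * u.2) ^ 2 - (l₂ * u.1 : ℂ) ^ 2) *
    quadExp A B C E F G u * Complex.I_sq

theorem sublaplacian_drho_quadExp (l₁ l₂ : ℝ) (u : ℝ × ℝ) :
    sublaplacian (drho l₁ l₂) (quadExp A B C E F G) u =
      (-(2 * A + (E + 2 * A * u.1 + (B - Complex.I * (l₁ / 2)) * u.2) ^ 2) -
        (2 * C + (F + (B + Complex.I * (l₁ / 2)) * u.1 + 2 * C * u.2) ^ 2) +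
        l₂ ^ 2 * (u.1 ^ 2 + u.2 ^ 2)) * quadExp A B C E F G u := by
  have e1 : drho l₁ l₂ .X₁ (quadExp A B C E F G) = fun u =>
      (E + 2 * A * u.1 + (B - Complex.I * (l₁ / 2)) * u.2) * quadExp A B C E F G u := by
    ext u
    simp only [drho, partial₁_quadExp]
    ring
  have e2 : drho l₁ l₂ .Y₁ (quadExp A B C E F G) = fun u =>
      (F + (B + Complex.I * (l₁ / 2)) * u.1 + 2 * C * u.2) * quadExp A B C E F G u := by
    ext u
    simp only [drho, partial₂_quadExp]
    ring
  rw [sublaplacian, e1, e2]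
  simp only [drho]
  rw [partial₁_mul_quadExp, partial₂_mul_quadExp]
  linear_combination (-(l₂ : ℂ) ^ 2 * (u.1 ^ 2 + u.2 ^ 2)) * quadExp A B C E F G u * Complex.I_sq

end QuadExp

/-! ### Coherent states -/

namespace Diagonalization

variable {l₁ l₂ : ℝ} (D : Diagonalization l₁ l₂) (η ζ : ℝ)

/-- The additive constant in the exponent of a coherent state. -/
noncomputable def norming : ℝ := η ^ 2 / (4 * D.ω) + ζ ^ 2 / (4 * D.ν)

/-- The coherent state with frequencies `η, ζ` in the coordinates `u'₁, u'₂`: the ground state of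
the oscillator times a character, normalised so that the heat semigroup only rescales the
frequencies and multiplies by the factor belonging to the ground state energy. -/
noncomputable def state : ℝ × ℝ → ℂ :=
  quadExp (-(D.p / 2)) (-D.q) (-(D.r / 2)) (Complex.I * (η * D.a + ζ * D.c))
    (Complex.I * (η * D.b + ζ * D.d)) (D.norming η ζ)

theorem state_eq (u : ℝ × ℝ) : D.state η ζ u =
    Complex.exp
      (-((D.ω * (D.a * u.1 + D.b * u.2) ^ 2 + D.ν * (D.c * u.1 + D.d * u.2) ^ 2) / 2 : ℝ) +
      Complex.I * (η * (D.a * u.1 + D.b * u.2) + ζ * (D.c * u.1 + D.d * u.2) : ℝ) +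
      D.norming η ζ) := by
  simp only [state, quadExp, p, q, r]
  push_cast
  ring_nf

/-- The function by which the sublaplacian multiplies a coherent state, as a polynomial in complex
arguments. -/
noncomputable def symbol (x w : ℂ) : ℂ :=
  D.ω + D.ν + η ^ 2 + ζ ^ 2 + 2 * Complex.I * (D.ω * η * (D.a * x + D.b * w) +
    D.ν * ζ * (D.c * x + D.d * w))

theorem symbol_ofReal (u : ℝ × ℝ) : D.symbol η ζ u.1 u.2 = (D.ω + D.ν + η ^ 2 + ζ ^ 2 : ℝ) +
    2 * Complex.I * (D.ω * η * (D.a * u.1 + D.b * u.2) +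
      D.ν * ζ * (D.c * u.1 + D.d * u.2) : ℝ) := by
  simp only [symbol]
  push_cast
  ring

/-- The polynomial identity behind the action of the sublaplacian on coherent states. It holds
because the matrix `(p q; q r)` is the square root of the matrix of the potential. -/
theorem symbol_eq (x w : ℂ) :
    D.p - (Complex.I * (η * D.a + ζ * D.c) - D.p * x - D.q * w) ^ 2 + D.r -
      (Complex.I * (η * D.b + ζ * D.d) - D.q * x - D.r * w) ^ 2 + (l₁ * x - l₂ * w) ^ 2 +
      (l₂ * x) ^ 2 = D.symbol η ζ x w := by
  have h1 : ((D.p : ℂ) ^ 2 + (D.q : ℂ) ^ 2) = l₁ ^ 2 + l₂ ^ 2 := by exact_mod_cast D.p_sq_add_q_sq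
  have h2 : (D.q : ℂ) * (D.p + D.r) = -(l₁ * l₂) := by exact_mod_cast D.q_mul_p_add_r
  have h3 : ((D.q : ℂ) ^ 2 + (D.r : ℂ) ^ 2) = l₂ ^ 2 := by exact_mod_cast D.q_sq_add_r_sq
  have h4 : (D.p : ℂ) + D.r = D.ω + D.ν := by exact_mod_cast D.p_add_r
  have h5 : ((η : ℂ) * D.a + ζ * D.c) ^ 2 + (η * D.b + ζ * D.d) ^ 2 = η ^ 2 + ζ ^ 2 := by
    have : (η * D.a + ζ * D.c) ^ 2 + (η * D.b + ζ * D.d) ^ 2 = η ^ 2 + ζ ^ 2 := by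
      linear_combination η ^ 2 * D.norm_fst + ζ ^ 2 * D.norm_snd + 2 * η * ζ * D.orth
    exact_mod_cast this
  have h6 : (D.p : ℂ) * (η * D.a + ζ * D.c) + D.q * (η * D.b + ζ * D.d) =
      D.ω * η * D.a + D.ν * ζ * D.c := by
    have : D.p * (η * D.a + ζ * D.c) + D.q * (η * D.b + ζ * D.d) =
        D.ω * η * D.a + D.ν * ζ * D.c := by
      rw [p, q]
      linear_combination D.ω * η * D.a * D.norm_fst + D.ν * ζ * D.c * D.norm_snd +
        (D.ω * ζ * D.a + D.ν * η * D.c) * D.orth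
    exact_mod_cast this
  have h7 : (D.q : ℂ) * (η * D.a + ζ * D.c) + D.r * (η * D.b + ζ * D.d) =
      D.ω * η * D.b + D.ν * ζ * D.d := by
    have : D.q * (η * D.a + ζ * D.c) + D.r * (η * D.b + ζ * D.d) =
        D.ω * η * D.b + D.ν * ζ * D.d := by
      rw [r, q]
      linear_combination D.ω * η * D.b * D.norm_fst + D.ν * ζ * D.d * D.norm_snd +
        (D.ω * ζ * D.b + D.ν * η * D.d) * D.orth
    exact_mod_cast this
  simp only [symbol]
  linear_combination h4 + h5 - x ^ 2 * h1 - 2 * x * w * h2 - w ^ 2 * h3 +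
    2 * Complex.I * x * h6 + 2 * Complex.I * w * h7 -
    (((η : ℂ) * D.a + ζ * D.c) ^ 2 + (η * D.b + ζ * D.d) ^ 2) * Complex.I_sq

theorem sublaplacian_dpi_state :
    sublaplacian (dpi l₁ l₂) (D.state η ζ) =
      fun u => D.symbol η ζ u.1 u.2 * D.state η ζ u := by
  ext u
  rw [state, sublaplacian_dpi_quadExp, ← symbol_eq]
  ring

end Diagonalization

/-! ### Completeness and evolution of the coherent states -/

/-- An integrable function on the plane orthogonal to all characters vanishes almost everywhere. -/
theorem ae_eq_zero_of_integral_mul_character {g : ℝ × ℝ → ℂ} (hg : Integrable g)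
    (h : ∀ θ₁ θ₂ : ℝ, ∫ u, g u * Complex.exp (Complex.I * (θ₁ * u.1 + θ₂ * u.2 : ℝ)) = 0) :
    g =ᵐ[volume] 0 := by
  refine ae_eq_zero_of_integral_contDiff_smul_eq_zero hg.locallyIntegrable fun φ hφ hφc => ?_
  let φ₁ : 𝓢(ℝ × ℝ, ℂ) := HasCompactSupport.toSchwartzMap (f := fun p => (φ p : ℂ))
    (hφc.comp_left Complex.ofReal_zero) (Complex.ofRealCLM.contDiff.comp hφ)
  let φ₂ : 𝓢(ℂ, ℂ) := SchwartzMap.compCLMOfContinuousLinearEquiv ℂ Complex.equivRealProdCLM φ₁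
  let ψ : 𝓢(ℂ, ℂ) := FourierTransformInv.fourierInv φ₂
  -- write the test function as the Fourier transform of `ψ`
  have hψ : ∀ u : ℝ × ℝ, (φ u : ℂ) = ∫ w : ℂ,
      Complex.exp (Complex.I * (-2 * Real.pi * w.re * u.1 + -2 * Real.pi * w.im * u.2 : ℝ)) *
        ψ w := by
    intro u
    have e1 : (φ u : ℂ) = (FourierTransform.fourier ψ : 𝓢(ℂ, ℂ)) ⟨u.1, u.2⟩ := by
      rw [FourierTransform.fourier_fourierInv_eq]
      rfl
    rw [e1, SchwartzMap.fourier_coe, Real.fourier_eq']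
    refine integral_congr_ae (Eventually.of_forall fun w => ?_)
    simp only [smul_eq_mul]
    congr 2
    rw [mul_comm _ Complex.I]
    congr 2
    simp [Complex.inner]
    ring
  have e2 : ∀ u, φ u • g u = ∫ w : ℂ, ψ w * (g u *
      Complex.exp (Complex.I * (-2 * Real.pi * w.re * u.1 + -2 * Real.pi * w.im * u.2 : ℝ))) := by
    intro u
    rw [← Complex.coe_smul, smul_eq_mul, hψ, mul_comm, ← integral_const_mul]
    congr 1 with w
    ring
  simp only [e2]
  rw [integral_integral_swap]
  · simp only [integral_const_mul, h, mul_zero, integral_zero]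
  · have hprod : Integrable (fun q : (ℝ × ℝ) × ℂ => g q.1 * ψ q.2) (volume.prod volume) :=
      hg.mul_prod ψ.integrable
    refine (hprod.bdd_mul (c := 1) (f := fun q : (ℝ × ℝ) × ℂ => Complex.exp (Complex.I *
      (-2 * Real.pi * q.2.re * q.1.1 + -2 * Real.pi * q.2.im * q.1.2 : ℝ)))
      (Continuous.aestronglyMeasurable (by fun_prop))
      (Eventually.of_forall fun q => by rw [norm_cexp_I_mul])).congr
      (Eventually.of_forall fun q => ?_)
    simp only [Function.uncurry]
    ring

/-- A curve of Schwartz functions with pointwise derivative dominated by a fixed `L²` function is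
differentiable in `L²`. -/
theorem tendsto_slope_toLp {φ ψ : ℝ → 𝓢(ℝ × ℝ, ℂ)} {t : ℝ}
    (hd : ∀ s u, HasDerivAt (fun s => φ s u) (ψ s u) s) {B : ℝ × ℝ → ℝ} (hB : MemLp B 2)
    (hb : ∀ s ∈ Metric.ball t 1, ∀ u, ‖ψ s u‖ ≤ B u) :
    Tendsto (fun h : ℝ => (h : ℂ)⁻¹ •
      ((φ (t + h)).toLp 2 volume - (φ t).toLp 2 volume : L2)) (𝓝[≠] 0)
      (𝓝 ((ψ t).toLp 2 volume)) := by
  let χ : ℝ → 𝓢(ℝ × ℝ, ℂ) := fun h => (h : ℂ)⁻¹ • (φ (t + h) - φ t) - ψ t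
  have hχ : ∀ h : ℝ, (h : ℂ)⁻¹ • ((φ (t + h)).toLp 2 volume - (φ t).toLp 2 volume : L2) -
      (ψ t).toLp 2 volume = (χ h).toLp 2 volume := by
    intro h
    simp only [← SchwartzMap.toLpCLM_apply (𝕜 := ℂ), ← map_sub, ← map_smul]
    rfl
  rw [tendsto_iff_norm_sub_tendsto_zero]
  simp only [hχ, SchwartzMap.norm_toLp' (p := 2) (by norm_num) (by norm_num), ENNReal.toReal_ofNat,
    Real.rpow_ofNat]
  have hnear : {h : ℝ | h ∈ Metric.ball 0 1} ∈ 𝓝[≠] (0 : ℝ) :=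
    mem_nhdsWithin_of_mem_nhds (Metric.ball_mem_nhds _ one_pos)
  have hlim : Tendsto (fun h => ∫ u, ‖χ h u‖ ^ 2) (𝓝[≠] 0) (𝓝 (∫ _ : ℝ × ℝ, (0 : ℝ))) := by
    refine tendsto_integral_filter_of_dominated_convergence (fun u => (2 * B u) ^ 2)
      (Eventually.of_forall fun h => ?_) ?_ ?_ (Eventually.of_forall fun u => ?_)
    · exact ((χ h).continuous.norm.pow 2).aestronglyMeasurable
    · filter_upwards [hnear, self_mem_nhdsWithin] with h hh hh0
      refine Eventually.of_forall fun u => ?_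
      rw [Real.norm_of_nonneg (by positivity)]
      refine pow_le_pow_left₀ (norm_nonneg _) ?_ 2
      have hB0 : ‖ψ t u‖ ≤ B u := hb t (Metric.mem_ball_self one_pos) u
      have hth : t + h ∈ Metric.ball t 1 := by simpa [Real.dist_eq] using hh
      have hmv := (convex_ball t 1).norm_image_sub_le_of_norm_hasDerivWithin_le
        (f := fun s => φ s u) (f' := fun s => ψ s u) (C := B u)
        (fun s _ => (hd s u).hasDerivWithinAt) (fun s hs => hb s hs u)
        (Metric.mem_ball_self one_pos) hth
      have hhp : 0 < ‖h‖ := norm_pos_iff.2 hh0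
      have e : ‖χ h u‖ ≤ ‖h‖⁻¹ * ‖φ (t + h) u - φ t u‖ + ‖ψ t u‖ := by
        refine (norm_sub_le _ _).trans (le_of_eq ?_)
        congr 1
        rw [smul_apply, norm_smul, norm_inv, Complex.norm_real]
        rfl
      have e2 : ‖h‖⁻¹ * ‖φ (t + h) u - φ t u‖ ≤ B u := by
        rw [inv_mul_le_iff₀ hhp]
        simpa [mul_comm] using hmv
      linarith
    · exact (hB.const_mul 2).integrable_sq
    · have h1 := (hasDerivAt_iff_tendsto_slope_zero.1 (hd t u)).sub_const (ψ t u)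
      rw [sub_self] at h1
      have h2 := (h1.norm.pow 2)
      simp only [norm_zero, ne_eq, OfNat.ofNat_ne_zero, not_false_eq_true, zero_pow] at h2
      refine h2.congr fun h => ?_
      rw [← Complex.coe_smul, Complex.ofReal_inv]
      rfl
  have := hlim.rpow_const (p := (2 : ℝ)⁻¹) (Or.inr (by positivity))
  simpa using this

namespace Diagonalization

variable {l₁ l₂ : ℝ} (D : Diagonalization l₁ l₂)

theorem exists_schwartz_state (η ζ : ℝ) : ∃ φ : 𝓢(ℝ × ℝ, ℂ), ⇑φ = D.state η ζ := by
  have hdet : (√D.ω * D.a) * (√D.ν * D.d) - (√D.ω * D.b) * (√D.ν * D.c) ≠ 0 := by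
    have e : (√D.ω * D.a) * (√D.ν * D.d) - (√D.ω * D.b) * (√D.ν * D.c) =
      √D.ω * √D.ν * (D.a * D.d - D.b * D.c) := by ring
    rw [e]
    exact mul_ne_zero (mul_ne_zero (Real.sqrt_pos.2 D.ω_pos).ne' (Real.sqrt_pos.2 D.ν_pos).ne')
      D.det_ne_zero
  obtain ⟨φ, hφ⟩ := exists_schwartz_gaussian hdet 0 0
    (hasTemperateGrowth_linear (η * D.a + ζ * D.c) (η * D.b + ζ * D.d))
  refine ⟨Complex.exp (D.norming η ζ) • φ, ?_⟩
  ext u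
  rw [smul_apply, hφ, state_eq, smul_eq_mul, ← Complex.exp_add]
  have h1 : (√D.ω * D.a * u.1 + √D.ω * D.b * u.2 - 0) ^ 2 =
      D.ω * (D.a * u.1 + D.b * u.2) ^ 2 := by
    linear_combination (D.a * u.1 + D.b * u.2) ^ 2 * Real.sq_sqrt D.ω_pos.le
  have h2 : (√D.ν * D.c * u.1 + √D.ν * D.d * u.2 - 0) ^ 2 =
      D.ν * (D.c * u.1 + D.d * u.2) ^ 2 := by
    linear_combination (D.c * u.1 + D.d * u.2) ^ 2 * Real.sq_sqrt D.ν_pos.le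
  rw [h1, h2]
  congr 1
  push_cast
  ring

/-- The coherent states as Schwartz functions. -/
noncomputable def schwartzState (η ζ : ℝ) : 𝓢(ℝ × ℝ, ℂ) := (D.exists_schwartz_state η ζ).choose

theorem coe_schwartzState (η ζ : ℝ) : ⇑(D.schwartzState η ζ) = D.state η ζ :=
  (D.exists_schwartz_state η ζ).choose_spec

theorem state_eq_mul (η ζ : ℝ) (u : ℝ × ℝ) :
    D.state η ζ u = Complex.exp (D.norming η ζ) * (D.state 0 0 u *
      Complex.exp (Complex.I * ((η * D.a + ζ * D.c) * u.1 + (η * D.b + ζ * D.d) * u.2 : ℝ))) := by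
  rw [state_eq, state_eq, ← Complex.exp_add, ← Complex.exp_add]
  congr 1
  simp only [norming]
  push_cast
  ring

theorem norm_state (η ζ : ℝ) (u : ℝ × ℝ) :
    ‖D.state η ζ u‖ = Real.exp (D.norming η ζ) * ‖D.state 0 0 u‖ := by
  rw [state_eq_mul, norm_mul, norm_mul, norm_cexp_I_mul, mul_one, ← Complex.ofReal_exp,
    Complex.norm_real, Real.norm_eq_abs, Real.abs_exp]

/-- The coherent states span a dense subspace: they are the nowhere vanishing ground state times
arbitrary characters, so a function orthogonal to all of them has vanishing Fourier transform after
multiplication by the ground state. -/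
theorem dense_span_schwartzState :
    Dense (Submodule.span ℂ (Set.range fun i : ℝ × ℝ =>
      ((D.schwartzState i.1 i.2).toLp 2 volume : L2)) : Set L2) := by
  set S := Submodule.span ℂ (Set.range fun i : ℝ × ℝ =>
      ((D.schwartzState i.1 i.2).toLp 2 volume : L2))
  have : S.topologicalClosure = ⊤ := by
    rw [Submodule.topologicalClosure_eq_top_iff, Submodule.eq_bot_iff]
    intro f hf
    rw [Submodule.mem_orthogonal'] at hf
    have hint : ∀ η ζ, ∫ u, starRingEnd ℂ (f u) * D.state η ζ u = 0 := by
      intro η ζ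
      have h := hf _ (Submodule.subset_span ⟨(η, ζ), rfl⟩)
      rw [MeasureTheory.L2.inner_def] at h
      rw [← h]
      refine integral_congr_ae ?_
      filter_upwards [(D.schwartzState η ζ).coeFn_toLp 2 volume] with u hu
      rw [hu, RCLike.inner_apply, mul_comm, coe_schwartzState]
    have hg : Integrable fun u => starRingEnd ℂ (f u) * D.state 0 0 u := by
      have h1 : MemLp (fun u => starRingEnd ℂ (f u)) 2 := (Lp.memLp f).star
      have h2 := (D.schwartzState 0 0).memLp 2 volume
      rw [coe_schwartzState] at h2
      exact h1.integrable_mul h2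
    have hz := ae_eq_zero_of_integral_mul_character hg fun θ₁ θ₂ => ?_
    · rw [Lp.eq_zero_iff_ae_eq_zero]
      filter_upwards [hz] with u hu
      have hne : D.state 0 0 u ≠ 0 := Complex.exp_ne_zero _
      simpa [hne] using hu
    · obtain ⟨r1, r2, r3, -⟩ := D.rows
      -- the frequencies of the given character in the rotated coordinates
      have h := hint (D.a * θ₁ + D.b * θ₂) (D.c * θ₁ + D.d * θ₂)
      have e1 : (D.a * θ₁ + D.b * θ₂) * D.a + (D.c * θ₁ + D.d * θ₂) * D.c = θ₁ := by
        linear_combination θ₁ * r1 + θ₂ * r3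
      have e2 : (D.a * θ₁ + D.b * θ₂) * D.b + (D.c * θ₁ + D.d * θ₂) * D.d = θ₂ := by
        linear_combination θ₁ * r3 + θ₂ * r2
      have e3 : ∀ u, starRingEnd ℂ (f u) * D.state (D.a * θ₁ + D.b * θ₂) (D.c * θ₁ + D.d * θ₂) u =
          Complex.exp (D.norming (D.a * θ₁ + D.b * θ₂) (D.c * θ₁ + D.d * θ₂)) *
          (starRingEnd ℂ (f u) * D.state 0 0 u *
            Complex.exp (Complex.I * (θ₁ * u.1 + θ₂ * u.2 : ℝ))) := by
        intro u
        rw [state_eq_mul, e1, e2]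
        ring
      simp only [e3] at h
      rw [integral_const_mul] at h
      exact (mul_eq_zero.1 h).resolve_left (Complex.exp_ne_zero _)
  intro x
  have hx : x ∈ S.topologicalClosure := by rw [this]; trivial
  exact hx

end Diagonalization

namespace Diagonalization

variable {l₁ l₂ : ℝ} (D : Diagonalization l₁ l₂)

/-- The solution of the heat equation with a coherent state as initial value. -/
noncomputable def evolve (i : ℝ × ℝ) (t : ℝ) : 𝓢(ℝ × ℝ, ℂ) :=
  (Real.exp (-(D.ω + D.ν) * t) : ℂ) •
    D.schwartzState (Real.exp (-2 * D.ω * t) * i.1) (Real.exp (-2 * D.ν * t) * i.2)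

theorem evolve_apply (i : ℝ × ℝ) (t : ℝ) (u : ℝ × ℝ) :
    D.evolve i t u = (Real.exp (-(D.ω + D.ν) * t) : ℂ) *
      D.state (Real.exp (-2 * D.ω * t) * i.1) (Real.exp (-2 * D.ν * t) * i.2) u := by
  rw [evolve, smul_apply, smul_eq_mul, coe_schwartzState]

theorem evolve_zero (i : ℝ × ℝ) : D.evolve i 0 = D.schwartzState i.1 i.2 := by
  simp [evolve]

theorem evolve_add (i : ℝ × ℝ) (t s : ℝ) :
    D.evolve i (t + s) = (Real.exp (-(D.ω + D.ν) * t) : ℂ) •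
      D.evolve (Real.exp (-2 * D.ω * t) * i.1, Real.exp (-2 * D.ν * t) * i.2) s := by
  have e : ∀ x, Real.exp (x * (t + s)) = Real.exp (x * t) * Real.exp (x * s) := fun x => by
    rw [← Real.exp_add]; ring_nf
  simp only [evolve, e, smul_smul]
  push_cast
  congr 2 <;> ring

theorem schwartzSublaplacian_evolve (i : ℝ × ℝ) (t : ℝ) (u : ℝ × ℝ) :
    schwartzSublaplacian (dpiSchwartz l₁ l₂) (D.evolve i t) u =
      D.symbol (Real.exp (-2 * D.ω * t) * i.1) (Real.exp (-2 * D.ν * t) * i.2) u.1 u.2 *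
        D.evolve i t u := by
  rw [evolve, map_smul, smul_apply, smul_apply,
    (isSkewRealization_dpi l₁ l₂).coe_schwartzSublaplacian, coe_schwartzState,
    sublaplacian_dpi_state, smul_eq_mul, smul_eq_mul]
  ring

/-- `evolve` solves the heat equation pointwise. -/
theorem hasDerivAt_evolve (i : ℝ × ℝ) (t : ℝ) (u : ℝ × ℝ) :
    HasDerivAt (fun s => D.evolve i s u)
      (-(schwartzSublaplacian (dpiSchwartz l₁ l₂) (D.evolve i t) u)) t := by
  set X := D.a * u.1 + D.b * u.2
  set Y := D.c * u.1 + D.d * u.2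
  have hω := D.ω_pos.ne'
  have hν := D.ν_pos.ne'
  have he : ∀ k : ℝ, HasDerivAt (fun s : ℝ => Real.exp (k * s)) (k * Real.exp (k * t)) t := by
    intro k
    simpa [mul_comm] using ((hasDerivAt_id t).const_mul k).exp
  let η : ℝ → ℝ := fun s => Real.exp (-2 * D.ω * s) * i.1
  let ζ : ℝ → ℝ := fun s => Real.exp (-2 * D.ν * s) * i.2
  have hη : HasDerivAt η (-2 * D.ω * η t) t := by
    simpa [η, mul_assoc] using (he (-2 * D.ω)).mul_const i.1
  have hζ : HasDerivAt ζ (-2 * D.ν * ζ t) t := by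
    simpa [ζ, mul_assoc] using (he (-2 * D.ν)).mul_const i.2
  have hE : HasDerivAt (fun s : ℝ =>
      (((-((D.ω * X ^ 2 + D.ν * Y ^ 2) / 2) - (D.ω + D.ν) * s + D.norming (η s) (ζ s) : ℝ) : ℂ) +
        Complex.I * (η s * X + ζ s * Y : ℝ))) (-D.symbol (η t) (ζ t) u.1 u.2) t := by
    have h1 : HasDerivAt (fun s : ℝ => -((D.ω * X ^ 2 + D.ν * Y ^ 2) / 2) - (D.ω + D.ν) * s +
        D.norming (η s) (ζ s)) (-(D.ω + D.ν + η t ^ 2 + ζ t ^ 2)) t := by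
      refine ((((hasDerivAt_id t).const_mul (D.ω + D.ν)).const_sub _).add
        (((hη.pow 2).div_const (4 * D.ω)).add ((hζ.pow 2).div_const (4 * D.ν)))).congr_deriv ?_
      simp
      field_simp
      ring
    have h2 : HasDerivAt (fun s : ℝ => η s * X + ζ s * Y)
        (-2 * (D.ω * η t * X + D.ν * ζ t * Y)) t := by
      refine ((hη.mul_const X).add (hζ.mul_const Y)).congr_deriv ?_
      ring
    refine (h1.ofReal_comp.add (h2.ofReal_comp.const_mul Complex.I)).congr_deriv ?_
    simp only [symbol, X, Y]
    push_cast
    ring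
  have hval : ∀ s, D.evolve i s u = Complex.exp
      (((-((D.ω * X ^ 2 + D.ν * Y ^ 2) / 2) - (D.ω + D.ν) * s + D.norming (η s) (ζ s) : ℝ) : ℂ) +
        Complex.I * (η s * X + ζ s * Y : ℝ)) := by
    intro s
    rw [evolve_apply, state_eq, Complex.ofReal_exp, ← Complex.exp_add]
    congr 1
    simp only [η, ζ, X, Y]
    push_cast
    ring
  rw [schwartzSublaplacian_evolve, hval]
  simp only [hval]
  refine hE.cexp.congr_deriv ?_
  ring

/-- Locally uniformly in time, the time derivative of `evolve` is dominated by the ground state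
times a polynomial of degree one. -/
theorem exists_bound_schwartzSublaplacian_evolve (i : ℝ × ℝ) (t : ℝ) :
    ∃ B : ℝ × ℝ → ℝ, MemLp B 2 ∧ ∀ s ∈ Metric.ball t 1, ∀ u,
      ‖schwartzSublaplacian (dpiSchwartz l₁ l₂) (D.evolve i s) u‖ ≤ B u := by
  let η : ℝ → ℝ := fun s => Real.exp (-2 * D.ω * s) * i.1
  let ζ : ℝ → ℝ := fun s => Real.exp (-2 * D.ν * s) * i.2
  have bd : ∀ F : ℝ → ℝ, Continuous F → ∃ C, ∀ s ∈ Metric.ball t 1, |F s| ≤ C := by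
    intro F hF
    obtain ⟨C, hC⟩ := (isCompact_closedBall t 1).exists_bound_of_continuousOn hF.continuousOn
    exact ⟨C, fun s hs => hC s (Metric.ball_subset_closedBall hs)⟩
  let N : ℝ → ℝ := fun s => Real.exp (-(D.ω + D.ν) * s) * Real.exp (D.norming (η s) (ζ s))
  have hη : Continuous η := by fun_prop
  have hζ : Continuous ζ := by fun_prop
  have hN : Continuous N := by simp only [N, norming]; fun_prop
  obtain ⟨C₀, hC₀⟩ := bd (fun s => (D.ω + D.ν + η s ^ 2 + ζ s ^ 2) * N s) (by fun_prop)
  obtain ⟨C₁, hC₁⟩ := bd (fun s => 2 * D.ω * η s * N s) (by fun_prop)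
  obtain ⟨C₂, hC₂⟩ := bd (fun s => 2 * D.ν * ζ s * N s) (by fun_prop)
  let g := D.schwartzState 0 0
  let g₁ := mulI (fun u => D.a * u.1 + D.b * u.2) g
  let g₂ := mulI (fun u => D.c * u.1 + D.d * u.2) g
  refine ⟨fun u => C₀ * ‖g u‖ + C₁ * ‖g₁ u‖ + C₂ * ‖g₂ u‖,
    (((g.memLp 2 volume).norm.const_mul C₀).add ((g₁.memLp 2 volume).norm.const_mul C₁)).add
      ((g₂.memLp 2 volume).norm.const_mul C₂), fun s hs u => ?_⟩
  have hg1 : ‖g₁ u‖ = |D.a * u.1 + D.b * u.2| * ‖g u‖ := by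
    rw [mulI_apply (hasTemperateGrowth_linear _ _), norm_mul, norm_mul, Complex.norm_I, one_mul,
      Complex.norm_real, Real.norm_eq_abs]
  have hg2 : ‖g₂ u‖ = |D.c * u.1 + D.d * u.2| * ‖g u‖ := by
    rw [mulI_apply (hasTemperateGrowth_linear _ _), norm_mul, norm_mul, Complex.norm_I, one_mul,
      Complex.norm_real, Real.norm_eq_abs]
  have hN0 : 0 ≤ N s := by positivity
  have hev : ‖D.evolve i s u‖ = N s * ‖g u‖ := by
    rw [evolve_apply, norm_mul, norm_state, ← coe_schwartzState, Complex.norm_real,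
      Real.norm_eq_abs, Real.abs_exp]
    exact (mul_assoc _ _ _).symm
  have hsym : ‖D.symbol (η s) (ζ s) u.1 u.2‖ ≤ |D.ω + D.ν + η s ^ 2 + ζ s ^ 2| +
      (|2 * D.ω * η s| * |D.a * u.1 + D.b * u.2| + |2 * D.ν * ζ s| * |D.c * u.1 + D.d * u.2|) := by
    rw [symbol_ofReal]
    refine (norm_add_le _ _).trans (add_le_add ?_ ?_)
    · rw [Complex.norm_real, Real.norm_eq_abs]
    · rw [norm_mul, norm_mul, Complex.norm_I, Complex.norm_real, Real.norm_eq_abs, mul_one,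
        Complex.norm_ofNat, ← abs_mul, ← abs_mul]
      have e : (2 : ℝ) = |2| := by norm_num
      nth_rw 1 [e]
      rw [← abs_mul]
      refine le_trans (le_of_eq ?_) (abs_add_le _ _)
      congr 1
      ring
  have b0 := hC₀ s hs
  have b1 := hC₁ s hs
  have b2 := hC₂ s hs
  rw [abs_mul, abs_of_nonneg hN0] at b0 b1 b2
  rw [schwartzSublaplacian_evolve, norm_mul, hev]
  calc ‖D.symbol (η s) (ζ s) u.1 u.2‖ * (N s * ‖g u‖)
      ≤ (|D.ω + D.ν + η s ^ 2 + ζ s ^ 2| + (|2 * D.ω * η s| * |D.a * u.1 + D.b * u.2| +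
        |2 * D.ν * ζ s| * |D.c * u.1 + D.d * u.2|)) * (N s * ‖g u‖) := by gcongr
    _ = |D.ω + D.ν + η s ^ 2 + ζ s ^ 2| * N s * ‖g u‖ + |2 * D.ω * η s| * N s * ‖g₁ u‖ +
        |2 * D.ν * ζ s| * N s * ‖g₂ u‖ := by rw [hg1, hg2]; ring
    _ ≤ C₀ * ‖g u‖ + C₁ * ‖g₁ u‖ + C₂ * ‖g₂ u‖ := by gcongr

theorem tendsto_slope_evolve (i : ℝ × ℝ) (t : ℝ) :
    Tendsto (fun h : ℝ => (h : ℂ)⁻¹ •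
      ((D.evolve i (t + h)).toLp 2 volume - (D.evolve i t).toLp 2 volume : L2)) (𝓝[≠] 0)
      (𝓝 (-(schwartzSublaplacian (dpiSchwartz l₁ l₂) (D.evolve i t)).toLp 2 volume)) := by
  obtain ⟨B, hB, hb⟩ := D.exists_bound_schwartzSublaplacian_evolve i t
  have h := tendsto_slope_toLp (φ := D.evolve i)
    (ψ := fun s => -schwartzSublaplacian (dpiSchwartz l₁ l₂) (D.evolve i s)) (t := t)
    (fun s u => D.hasDerivAt_evolve i s u) hB (fun s hs u => by
      rw [neg_apply, norm_neg]; exact hb s hs u)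
  simp only [← SchwartzMap.toLpCLM_apply (𝕜 := ℂ), map_neg] at h ⊢
  exact h

/-- The coherent states form an evolution family for `dπ_λ(𝓛)`. -/
theorem isEvolutionFamily_dpi :
    IsEvolutionFamily (schwartzGraph (dpiSchwartz l₁ l₂))
      (fun (i : ℝ × ℝ) t => ((D.evolve i t).toLp 2 volume : L2))
      (fun i t => (schwartzSublaplacian (dpiSchwartz l₁ l₂) (D.evolve i t)).toLp 2 volume) where
  mem i t := ⟨D.evolve i t, rfl⟩
  deriv := D.tendsto_slope_evolve
  shift i t := ⟨_, _, fun s => by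
    rw [evolve_add]
    exact map_smul (SchwartzMap.toLpCLM ℂ ℂ 2 volume) _ _⟩
  dense := by
    simp only [evolve_zero]
    exact D.dense_span_schwartzState

end Diagonalization

/-! ### The image of the coherent states under the intertwiner -/

namespace Diagonalization

variable {l₁ l₂ : ℝ} (D : Diagonalization l₁ l₂) (η ζ : ℝ)

/-- The coefficient of `z` in the exponent of the Gaussian integrand of `T` at the point `p`. -/
noncomputable def linCoeff (p : ℝ × ℝ) : ℂ :=
  -D.q * p.1 + Complex.I * (η * D.b + ζ * D.d) - Complex.I * l₂ * p.2

/-- The part independent of `z` in the exponent of the Gaussian integrand of `T`. -/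
noncomputable def constCoeff (x : ℝ) : ℂ :=
  -(D.p / 2) * x ^ 2 + Complex.I * (η * D.a + ζ * D.c) * x + D.norming η ζ

theorem cexp_mul_state (p : ℝ × ℝ) (z : ℝ) :
    Complex.exp (-Complex.I * l₂ * p.2 * z) * D.state η ζ (p.1, z) =
      Complex.exp (-(D.r / 2) * (z : ℂ) ^ 2 + D.linCoeff η ζ p * z + D.constCoeff η ζ p.1) := by
  rw [state, quadExp, ← Complex.exp_add, linCoeff, constCoeff]
  congr 1
  ring

/-- The constant produced by the Gaussian integral in `T`. -/
noncomputable def rhoConst : ℂ :=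
  (√(|l₂| / (2 * Real.pi)) : ℝ) * (Real.pi / (D.r / 2)) ^ (1 / 2 : ℂ)

/-- The image of a coherent state under `T`, up to the constant `rhoConst`. -/
noncomputable def rhoState : ℝ × ℝ → ℂ :=
  quadExp (-(D.p / 2) + D.q ^ 2 / (2 * D.r)) (Complex.I * (D.q * l₂ / D.r + l₁ / 2))
    (-(l₂ ^ 2 / (2 * D.r)))
    (Complex.I * ((η * D.a + ζ * D.c) - D.q * (η * D.b + ζ * D.d) / D.r))
    (l₂ * (η * D.b + ζ * D.d) / D.r)
    (D.norming η ζ - (η * D.b + ζ * D.d) ^ 2 / (2 * D.r))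

theorem r_ne_zero : (D.r : ℂ) ≠ 0 := Complex.ofReal_ne_zero.2 D.r_pos.ne'

theorem intertwiner_state :
    intertwiner l₁ l₂ (D.state η ζ) = fun p => D.rhoConst * D.rhoState η ζ p := by
  ext p
  have hr := D.r_ne_zero
  have hre : (-((D.r : ℂ) / 2)).re < 0 := by
    have := D.r_pos
    simpa using this
  simp only [intertwiner, cexp_mul_state]
  rw [integral_cexp_quadratic hre, neg_neg, rhoConst, rhoState, quadExp, mul_assoc, mul_assoc,
    mul_left_comm (Complex.exp _), ← Complex.exp_add]
  rw [← mul_assoc (((√(|l₂| / (2 * Real.pi)) : ℝ) : ℂ))]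
  congr 2
  simp only [linCoeff, constCoeff]
  field_simp
  linear_combination (4 * (η * D.b + ζ * D.d - l₂ * p.2) ^ 2 : ℂ) * Complex.I_sq

theorem integrable_cexp_mul_state (p : ℝ × ℝ) : Integrable fun z : ℝ =>
    Complex.exp (-Complex.I * l₂ * p.2 * z) * D.state η ζ (p.1, z) := by
  rw [← coe_schwartzState]
  exact integrable_partialFourier_integrand p (slice (D.schwartzState η ζ) p.1).integrable

theorem integrable_mul_cexp_mul_state (p : ℝ × ℝ) : Integrable fun z : ℝ =>
    z * (Complex.exp (-Complex.I * l₂ * p.2 * z) * D.state η ζ (p.1, z)) := by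
  let h := mulI (fun u => 0 * u.1 + 1 * u.2) (D.schwartzState η ζ)
  refine ((integrable_partialFourier_integrand (l := l₂) (h := h) p
    (slice h p.1).integrable).const_mul (-Complex.I)).congr (Eventually.of_forall fun z => ?_)
  simp only [h, mulI_apply (hasTemperateGrowth_linear _ _), coe_schwartzState]
  push_cast
  linear_combination (-z * (Complex.exp (-Complex.I * l₂ * p.2 * z) * D.state η ζ (p.1, z))) *
    Complex.I_sq

/-- Integration by parts for the first moment of the Gaussian integrand of `T`. -/
theorem integral_mul_cexp_mul_state (p : ℝ × ℝ) :
    ∫ z : ℝ, z * (Complex.exp (-Complex.I * l₂ * p.2 * z) * D.state η ζ (p.1, z)) =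
      D.linCoeff η ζ p / D.r *
        ∫ z : ℝ, Complex.exp (-Complex.I * l₂ * p.2 * z) * D.state η ζ (p.1, z) := by
  have hr := D.r_ne_zero
  have h0 := D.integrable_cexp_mul_state η ζ p
  have h1 := D.integrable_mul_cexp_mul_state η ζ p
  have h2 := integral_eq_zero_of_hasDerivAt_of_integrable
    (f := fun z : ℝ => Complex.exp (-Complex.I * l₂ * p.2 * z) * D.state η ζ (p.1, z))
    (f' := fun z : ℝ =>
      D.linCoeff η ζ p * (Complex.exp (-Complex.I * l₂ * p.2 * z) * D.state η ζ (p.1, z)) -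
      D.r * (z * (Complex.exp (-Complex.I * l₂ * p.2 * z) * D.state η ζ (p.1, z))))
    (fun z => ?_) ((h0.const_mul _).sub (h1.const_mul _)) h0
  · rw [integral_sub (h0.const_mul _) (h1.const_mul _), integral_const_mul,
      integral_const_mul] at h2
    rw [div_mul_eq_mul_div, eq_div_iff hr]
    linear_combination -h2
  · simp only [cexp_mul_state]
    have hx : HasDerivAt (fun s : ℝ => (s : ℂ)) 1 z := Complex.ofRealCLM.hasDerivAt
    refine ((((hx.pow 2).const_mul (-((D.r : ℂ) / 2))).add (hx.const_mul (D.linCoeff η ζ p))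
      |>.add_const (D.constCoeff η ζ p.1)).cexp).congr_deriv ?_
    simp
    ring

/-- Completing the square in the exponent of `rhoState` exhibits it as a Gaussian wave packet. -/
theorem exists_schwartz_rhoState (hl₂ : l₂ ≠ 0) : ∃ φ : 𝓢(ℝ × ℝ, ℂ), ⇑φ = D.rhoState η ζ := by
  have hr := D.r_pos
  have hα : 0 < D.ω * D.ν / D.r := div_pos (mul_pos D.ω_pos D.ν_pos) hr
  have hdet : √(D.ω * D.ν / D.r) * (l₂ / √D.r) - 0 * 0 ≠ 0 := by
    rw [mul_zero, sub_zero]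
    exact mul_ne_zero (Real.sqrt_pos.2 hα).ne' (div_ne_zero hl₂ (Real.sqrt_pos.2 hr).ne')
  have hR : Function.HasTemperateGrowth fun u : ℝ × ℝ =>
      (D.q * l₂ / D.r + l₁ / 2) * u.1 * u.2 +
        ((η * D.a + ζ * D.c) - D.q * (η * D.b + ζ * D.d) / D.r) * u.1 :=
    (((Function.HasTemperateGrowth.const _).mul hasTemperateGrowth_fst).mul
      hasTemperateGrowth_snd).add ((Function.HasTemperateGrowth.const _).mul hasTemperateGrowth_fst)
  obtain ⟨φ, hφ⟩ := exists_schwartz_gaussian hdet 0 ((η * D.b + ζ * D.d) / √D.r) hR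
  refine ⟨Complex.exp (D.norming η ζ) • φ, ?_⟩
  ext u
  rw [smul_apply, hφ, smul_eq_mul, ← Complex.exp_add, rhoState, quadExp]
  have h1 : (√(D.ω * D.ν / D.r) * u.1 + 0 * u.2 - 0) ^ 2 = (D.p - D.q ^ 2 / D.r) * u.1 ^ 2 := by
    rw [zero_mul, add_zero, sub_zero, mul_pow, Real.sq_sqrt hα.le, ← D.det_sqrt]
    field_simp
  have h2 : (0 * u.1 + l₂ / √D.r * u.2 - (η * D.b + ζ * D.d) / √D.r) ^ 2 =
      (l₂ * u.2 - (η * D.b + ζ * D.d)) ^ 2 / D.r := by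
    rw [zero_mul, zero_add, div_mul_eq_mul_div, ← sub_div, div_pow, Real.sq_sqrt hr.le]
  rw [h1, h2]
  congr 1
  push_cast
  have hr' := D.r_ne_zero
  field_simp
  ring

/-- On `rhoState` the sublaplacian of `dρ_λ` multiplies by the symbol with its second variable
replaced by the mean `linCoeff / r` of the Gaussian integrand of `T`. -/
theorem sublaplacian_drho_rhoState (p : ℝ × ℝ) :
    sublaplacian (drho l₁ l₂) (D.rhoState η ζ) p =
      D.symbol η ζ p.1 (D.linCoeff η ζ p / D.r) * D.rhoState η ζ p := by
  have hr := D.r_ne_zero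
  have h3 : ((D.q : ℂ) ^ 2 + (D.r : ℂ) ^ 2) = l₂ ^ 2 := by exact_mod_cast D.q_sq_add_r_sq
  rw [rhoState, sublaplacian_drho_quadExp, ← symbol_eq]
  congr 1
  set w := D.linCoeff η ζ p / D.r with hw
  have hB : w * D.r = -D.q * p.1 + Complex.I * (η * D.b + ζ * D.d) - Complex.I * l₂ * p.2 := by
    rw [hw, div_mul_cancel₀ _ hr, linCoeff]
  -- the components of the covariant gradient of the exponent
  have e1 : Complex.I * ((η * D.a + ζ * D.c) - D.q * (η * D.b + ζ * D.d) / D.r) +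
      2 * (-(D.p / 2) + D.q ^ 2 / (2 * D.r)) * p.1 +
      (Complex.I * (D.q * l₂ / D.r + l₁ / 2) - Complex.I * (l₁ / 2)) * p.2 =
      Complex.I * (η * D.a + ζ * D.c) - D.p * p.1 - D.q * w := by
    have : w = (-D.q * p.1 + Complex.I * (η * D.b + ζ * D.d) - Complex.I * l₂ * p.2) / D.r := by
      rw [← hB, mul_div_cancel_right₀ _ hr]
    rw [this]
    field_simp
    ring
  have e2 : l₂ * (η * D.b + ζ * D.d) / D.r +
      (Complex.I * (D.q * l₂ / D.r + l₁ / 2) + Complex.I * (l₁ / 2)) * p.1 +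
      2 * (-(l₂ ^ 2 / (2 * D.r))) * p.2 = Complex.I * (l₁ * p.1 - l₂ * w) := by
    have : w = (-D.q * p.1 + Complex.I * (η * D.b + ζ * D.d) - Complex.I * l₂ * p.2) / D.r := by
      rw [← hB, mul_div_cancel_right₀ _ hr]
    rw [this]
    field_simp
    linear_combination (2 * l₂ * (η * D.b + ζ * D.d - l₂ * p.2) : ℂ) * Complex.I_sq
  have e3 : Complex.I * (η * D.b + ζ * D.d) - D.q * p.1 - D.r * w = Complex.I * l₂ * p.2 := by
    linear_combination -hB
  have e4 : -(2 * (-((D.p : ℂ) / 2) + D.q ^ 2 / (2 * D.r))) - 2 * (-((l₂ : ℂ) ^ 2 / (2 * D.r))) =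
      D.p + D.r := by
    field_simp
    linear_combination -h3
  rw [e1, e2, e3]
  linear_combination e4 - ((l₁ * p.1 - l₂ * w) ^ 2 - (l₂ * p.2 : ℂ) ^ 2) * Complex.I_sq

/-- `T` intertwines the two sublaplacians on coherent states. The symbol is affine in the variable
of integration, so integrating it against the Gaussian evaluates it at the mean. -/
theorem intertwiner_symbol_mul_state (p : ℝ × ℝ) :
    intertwiner l₁ l₂ (fun u => D.symbol η ζ u.1 u.2 * D.state η ζ u) p =
      D.rhoConst * sublaplacian (drho l₁ l₂) (D.rhoState η ζ) p := by
  have h0 := D.integrable_cexp_mul_state η ζ p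
  have h1 := D.integrable_mul_cexp_mul_state η ζ p
  have hT := congrFun (D.intertwiner_state η ζ) p
  have hm := D.integral_mul_cexp_mul_state η ζ p
  let s₁ : ℂ := 2 * Complex.I * (D.ω * η * D.b + D.ν * ζ * D.d)
  have hs : ∀ w : ℂ, D.symbol η ζ p.1 w = D.symbol η ζ p.1 0 + s₁ * w := by
    intro w
    simp only [symbol, s₁]
    ring
  have hint : ∫ z : ℝ, Complex.exp (-Complex.I * l₂ * p.2 * z) *
      (D.symbol η ζ p.1 z * D.state η ζ (p.1, z)) =
      D.symbol η ζ p.1 (D.linCoeff η ζ p / D.r) *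
        ∫ z : ℝ, Complex.exp (-Complex.I * l₂ * p.2 * z) * D.state η ζ (p.1, z) := by
    have : ∀ z : ℝ, Complex.exp (-Complex.I * l₂ * p.2 * z) *
      (D.symbol η ζ p.1 z * D.state η ζ (p.1, z)) = D.symbol η ζ p.1 0 *
        (Complex.exp (-Complex.I * l₂ * p.2 * z) * D.state η ζ (p.1, z)) +
        s₁ * (z * (Complex.exp (-Complex.I * l₂ * p.2 * z) * D.state η ζ (p.1, z))) := by
      intro z
      rw [hs z]
      ring
    simp only [this]
    rw [integral_add (h0.const_mul _) (h1.const_mul _), integral_const_mul, integral_const_mul, hm,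
      hs (D.linCoeff η ζ p / D.r)]
    ring
  rw [sublaplacian_drho_rhoState, mul_left_comm, ← hT]
  simp only [intertwiner]
  rw [hint]
  ring

end Diagonalization

namespace Diagonalization

variable {l₁ l₂ : ℝ} (D : Diagonalization l₁ l₂)

theorem intertwiner_const_mul (l₁ l₂ : ℝ) (r : ℂ) (h : ℝ × ℝ → ℂ) (p : ℝ × ℝ) :
    intertwiner l₁ l₂ (fun q => r * h q) p = r * intertwiner l₁ l₂ h p := by
  rw [intertwiner_eq, intertwiner_eq, partialFourier_smul]
  ring

theorem map_mem_schwartzGraph_drho (hl₂ : l₂ ≠ 0) {T : L2 ≃ₗᵢ[ℂ] L2}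
    (hT : ∀ h : 𝓢(ℝ × ℝ, ℂ), T (h.toLp 2 volume) =
      (memLp_intertwiner (l₁ := l₁) hl₂ h).toLp _) (i : ℝ × ℝ) (t : ℝ) :
    (T ((D.evolve i t).toLp 2 volume),
      T ((schwartzSublaplacian (dpiSchwartz l₁ l₂) (D.evolve i t)).toLp 2 volume)) ∈
      schwartzGraph (drhoSchwartz l₁ l₂) := by
  set η := Real.exp (-2 * D.ω * t) * i.1 with hη
  set ζ := Real.exp (-2 * D.ν * t) * i.2 with hζ
  set m : ℂ := (Real.exp (-(D.ω + D.ν) * t) : ℂ) with hm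
  obtain ⟨ψ, hψ⟩ := D.exists_schwartz_rhoState η ζ hl₂
  have hρ := isSkewRealization_drho l₁ l₂
  rw [hρ.mem_schwartzGraph, hT, hT]
  refine ⟨(m * D.rhoConst) • ψ, ?_, ?_⟩
  · refine (MemLp.coeFn_toLp (memLp_intertwiner (l₁ := l₁) hl₂ (D.evolve i t))).trans
      (Eventually.of_forall fun p => ?_)
    have e : ⇑(D.evolve i t) = fun u => m * D.state η ζ u := by
      ext u
      rw [evolve_apply]
    rw [e, intertwiner_const_mul, intertwiner_state, smul_apply, hψ, smul_eq_mul, mul_assoc]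
  · refine (MemLp.coeFn_toLp (memLp_intertwiner (l₁ := l₁) hl₂
      (schwartzSublaplacian (dpiSchwartz l₁ l₂) (D.evolve i t)))).trans
        (Eventually.of_forall fun p => ?_)
    have e : ⇑(schwartzSublaplacian (dpiSchwartz l₁ l₂) (D.evolve i t)) =
        fun u => m * (D.symbol η ζ u.1 u.2 * D.state η ζ u) := by
      ext u
      rw [schwartzSublaplacian_evolve, evolve_apply]
      ring
    rw [e, intertwiner_const_mul, intertwiner_symbol_mul_state, ← hρ.coe_schwartzSublaplacian,
      map_smul, smul_apply, smul_eq_mul, hρ.coe_schwartzSublaplacian, hψ, mul_assoc]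

/-- The images of the coherent states under `T` form an evolution family for `dρ_λ(𝓛)`. -/
theorem isEvolutionFamily_drho (hl₂ : l₂ ≠ 0) {T : L2 ≃ₗᵢ[ℂ] L2}
    (hT : ∀ h : 𝓢(ℝ × ℝ, ℂ), T (h.toLp 2 volume) =
      (memLp_intertwiner (l₁ := l₁) hl₂ h).toLp _) :
    IsEvolutionFamily (schwartzGraph (drhoSchwartz l₁ l₂))
      (fun (i : ℝ × ℝ) t => T ((D.evolve i t).toLp 2 volume))
      (fun i t => T ((schwartzSublaplacian (dpiSchwartz l₁ l₂) (D.evolve i t)).toLp 2 volume)) where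
  mem := D.map_mem_schwartzGraph_drho hl₂ hT
  deriv i t := by
    have h := (T.continuous.tendsto _).comp (D.isEvolutionFamily_dpi.deriv i t)
    rw [map_neg] at h
    refine h.congr fun s => ?_
    rw [Function.comp_apply, map_smul, map_sub]
  shift i t := by
    obtain ⟨c, j, h⟩ := D.isEvolutionFamily_dpi.shift i t
    exact ⟨c, j, fun s => by rw [h, map_smul]⟩
  dense := by
    have h := T.surjective.denseRange.dense_image T.continuous D.isEvolutionFamily_dpi.dense
    have e : T '' (Submodule.span ℂ (Set.range fun i : ℝ × ℝ =>
        ((D.evolve i 0).toLp 2 volume : L2)) : Set L2) =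
        (Submodule.span ℂ (Set.range fun i : ℝ × ℝ =>
          T ((D.evolve i 0).toLp 2 volume)) : Set L2) := by
      have := Submodule.map_span T.toLinearEquiv.toLinearMap
        (Set.range fun i : ℝ × ℝ => ((D.evolve i 0).toLp 2 volume : L2))
      rw [← Set.range_comp] at this
      exact congrArg SetLike.coe this
    rwa [e] at h

end Diagonalization

/-! ### Integral kernels -/

/-- To verify an integral kernel with square integrable rows it suffices to test it on a family
spanning a dense subspace. -/
theorem hasIntegralKernel_of_dense {B : L2 →L[ℂ] L2} {k : ℝ × ℝ → ℝ × ℝ → ℂ}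
    (hk : Measurable (Function.uncurry k)) (hk2 : ∀ u, MemLp (k u) 2) {ι : Type*} {e : ι → L2}
    (hd : Dense (Submodule.span ℂ (Set.range e) : Set L2))
    (he : ∀ i, ∀ᵐ u, B (e i) u = ∫ v, k u v * e i v) : HasIntegralKernel B k := by
  have hint : ∀ (f : L2) u, Integrable fun v => k u v * f v :=
    fun f u => (hk2 u).integrable_mul (Lp.memLp f)
  let K : ℝ × ℝ → L2 →L[ℂ] ℂ := fun u => innerSL ℂ ((hk2 u).star.toLp _)
  have hK : ∀ u f, K u f = ∫ v, k u v * f v := by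
    intro u f
    refine (MeasureTheory.L2.inner_def _ _).trans (integral_congr_ae ?_)
    filter_upwards [(hk2 u).star.coeFn_toLp] with v hv
    rw [hv, RCLike.inner_apply, mul_comm]
    simp
  simp only [← hK] at he
  refine ⟨hk, fun f => Eventually.of_forall (hint f), fun f => ?_⟩
  simp only [← hK]
  have hspan : ∀ f ∈ Submodule.span ℂ (Set.range e), ∀ᵐ u, B f u = K u f := by
    intro f hf
    induction hf using Submodule.span_induction with
    | mem x hx =>
      obtain ⟨i, rfl⟩ := hx
      exact he i
    | zero =>
      rw [map_zero]
      filter_upwards [Lp.coeFn_zero ℂ 2 (volume : Measure (ℝ × ℝ))] with u hu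
      rw [hu, map_zero]
      rfl
    | add x y _ _ hx hy =>
      rw [map_add]
      filter_upwards [hx, hy, Lp.coeFn_add (B x) (B y)] with u h1 h2 h3
      rw [h3, Pi.add_apply, h1, h2, map_add]
    | smul c x _ hx =>
      rw [map_smul]
      filter_upwards [hx, Lp.coeFn_smul c (B x)] with u h1 h2
      rw [h2, Pi.smul_apply, h1, map_smul]
  obtain ⟨g, hg, hgf⟩ := mem_closure_iff_seq_limit.1 (hd f)
  -- a subsequence of `B gₙ` converges pointwise almost everywhere
  obtain ⟨ns, hns, hae⟩ := (tendstoInMeasure_of_tendsto_Lp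
    ((B.continuous.tendsto f).comp hgf)).exists_seq_tendsto_ae
  filter_upwards [hae, ae_all_iff.2 fun n => hspan (g n) (hg n)] with u h1 h2
  refine tendsto_nhds_unique h1 ?_
  simp only [Function.comp_apply, h2]
  exact ((K u).continuous.tendsto f).comp (hgf.comp hns.tendsto_atTop)

/-! ### One-dimensional Mehler kernels -/

section Mehler

variable {t ω : ℝ}

/-- The Mehler kernel in terms of `E = exp (-2 t ω)`. -/
theorem mehlerK_sq_eq (hω : 0 < ω) (x y : ℝ) :
    mehlerK t (ω ^ 2) x y = √ω * Real.exp (-t * ω) *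
      (Real.pi ^ (-1 / 2 : ℝ) * (1 - Real.exp (-2 * t * ω) ^ 2) ^ (-1 / 2 : ℝ)) *
      Real.exp (-(ω * (1 / 2 * (1 + Real.exp (-2 * t * ω) ^ 2) * (x ^ 2 + y ^ 2) -
        2 * Real.exp (-2 * t * ω) * x * y) / (1 - Real.exp (-2 * t * ω) ^ 2))) := by
  have h4 : (ω ^ 2) ^ (1 / 4 : ℝ) = √ω := by
    rw [Real.sqrt_eq_rpow, ← Real.rpow_natCast ω 2, ← Real.rpow_mul hω.le]
    norm_num
  have hE : Real.exp (-4 * (t * ω)) = Real.exp (-2 * t * ω) ^ 2 := by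
    rw [← Real.exp_nat_mul]
    push_cast
    ring_nf
  have hE' : Real.exp (-2 * (t * ω)) = Real.exp (-2 * t * ω) := by ring_nf
  have hs : √ω ^ 2 = ω := Real.sq_sqrt hω.le
  rw [mehlerK, mehlerQ, mehlerExponent, Real.sqrt_sq hω.le, h4, hE, hE', mul_pow, mul_pow, hs]
  have e : 1 / 2 * (1 + Real.exp (-2 * t * ω) ^ 2) * (ω * x ^ 2 + ω * y ^ 2) -
      2 * Real.exp (-2 * t * ω) * (√ω * x) * (√ω * y) =
      ω * (1 / 2 * (1 + Real.exp (-2 * t * ω) ^ 2) * (x ^ 2 + y ^ 2) -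
        2 * Real.exp (-2 * t * ω) * x * y) := by
    linear_combination -2 * Real.exp (-2 * t * ω) * x * y * hs
  rw [e, mul_assoc (√ω * Real.exp (-t * ω)), div_eq_inv_mul (ω * _)]

theorem exp_neg_two_mul_lt_one (ht : 0 < t) (hω : 0 < ω) :
    0 < 1 - Real.exp (-2 * t * ω) ^ 2 := by
  have h : Real.exp (-2 * t * ω) < 1 := by
    rw [Real.exp_lt_one_iff]
    nlinarith [mul_pos ht hω]
  nlinarith [Real.exp_pos (-2 * t * ω)]

theorem continuous_mehlerK (hω : 0 < ω) :
    Continuous fun z : ℝ × ℝ => mehlerK t (ω ^ 2) z.1 z.2 := by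
  simp only [mehlerK_sq_eq hω]
  fun_prop

theorem continuous_mehlerK_right (hω : 0 < ω) (x : ℝ) :
    Continuous fun y => mehlerK t (ω ^ 2) x y := by
  simp only [mehlerK_sq_eq hω]
  fun_prop

theorem mehlerK_nonneg (ht : 0 < t) (hω : 0 < ω) (x y : ℝ) : 0 ≤ mehlerK t (ω ^ 2) x y := by
  have := exp_neg_two_mul_lt_one ht hω
  rw [mehlerK_sq_eq hω]
  positivity

/-- A Gaussian bound, from `½ (1 + E²) (x² + y²) - 2 E x y ≥ ½ (1 - E)² (x² + y²)` for
`E = exp (-2 t ω)`. -/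
theorem exists_mehlerK_le (ht : 0 < t) (hω : 0 < ω) : ∃ C ε : ℝ, 0 < C ∧ 0 < ε ∧
    ∀ x y, mehlerK t (ω ^ 2) x y ≤ C * Real.exp (-ε * (x ^ 2 + y ^ 2)) := by
  have h1 := exp_neg_two_mul_lt_one ht hω
  have hE := Real.exp_pos (-2 * t * ω)
  simp only [mehlerK_sq_eq hω]
  set E := Real.exp (-2 * t * ω)
  have hE1 : 0 < 1 - E := by nlinarith
  refine ⟨√ω * Real.exp (-t * ω) * (Real.pi ^ (-1 / 2 : ℝ) * (1 - E ^ 2) ^ (-1 / 2 : ℝ)),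
    ω * (1 / 2 * (1 - E) ^ 2) / (1 - E ^ 2), by positivity, by positivity, fun x y => ?_⟩
  gcongr
  rw [neg_mul, neg_le_neg_iff, div_mul_eq_mul_div]
  gcongr ?_ / _
  rw [mul_assoc]
  gcongr
  nlinarith [mul_nonneg hE.le (sq_nonneg (x - y))]

/-- The heat evolution of a one-dimensional coherent state. -/
theorem integral_mehlerK_mul (ht : 0 < t) (hω : 0 < ω) (η x : ℝ) :
    ∫ y : ℝ, (mehlerK t (ω ^ 2) x y : ℂ) *
        Complex.exp (-(ω * y ^ 2 / 2 : ℝ) + Complex.I * (η * y : ℝ)) =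
      Complex.exp (-(t * ω + ω * x ^ 2 / 2 : ℝ) + Complex.I * (Real.exp (-2 * t * ω) * η * x : ℝ) -
        (η ^ 2 * (1 - Real.exp (-2 * t * ω) ^ 2) / (4 * ω) : ℝ)) := by
  have h1 := exp_neg_two_mul_lt_one ht hω
  simp only [mehlerK_sq_eq hω]
  set E := Real.exp (-2 * t * ω)
  have hEc : (1 : ℂ) - E ^ 2 ≠ 0 := by exact_mod_cast h1.ne'
  have hωc : (ω : ℂ) ≠ 0 := by exact_mod_cast hω.ne'
  -- the coefficients of the exponent `b y² + c y + d` of the integrand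
  set b : ℂ := ((-(ω / (1 - E ^ 2)) : ℝ) : ℂ) with hb
  have hbre : b.re < 0 := by
    rw [hb, Complex.ofReal_re, neg_lt_zero]
    positivity
  set c : ℂ := (2 * ω * E * x / (1 - E ^ 2) : ℝ) + Complex.I * η with hc
  set d : ℂ := ((-(ω * (1 + E ^ 2) * x ^ 2 / (2 * (1 - E ^ 2))) : ℝ) : ℂ) with hd
  set m : ℝ := √ω * Real.exp (-t * ω) * (Real.pi ^ (-1 / 2 : ℝ) * (1 - E ^ 2) ^ (-1 / 2 : ℝ))
    with hm
  have e1 : ∀ y : ℝ, ((m * Real.exp (-(ω * (1 / 2 * (1 + E ^ 2) * (x ^ 2 + y ^ 2) -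
        2 * E * x * y) / (1 - E ^ 2))) : ℝ) : ℂ) *
        Complex.exp (-(ω * y ^ 2 / 2 : ℝ) + Complex.I * (η * y : ℝ)) =
      m * Complex.exp (b * y ^ 2 + c * y + d) := by
    intro y
    rw [Complex.ofReal_mul, mul_assoc, Complex.ofReal_exp, ← Complex.exp_add]
    congr 2
    simp only [hb, hc, hd]
    push_cast
    field_simp
    ring
  simp only [e1]
  rw [integral_const_mul, integral_cexp_quadratic hbre]
  have hsq : ((Real.pi : ℂ) / -b) ^ (1 / 2 : ℂ) =
      ((Real.pi * (1 - E ^ 2) / ω) ^ (1 / 2 : ℝ) : ℝ) := by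
    rw [Complex.ofReal_cpow (by positivity)]
    congr 1
    · rw [hb]
      push_cast
      field_simp
    · norm_num
  have hconst : m * (Real.pi * (1 - E ^ 2) / ω) ^ (1 / 2 : ℝ) = Real.exp (-t * ω) := by
    rw [hm, Real.div_rpow (by positivity) hω.le, Real.mul_rpow Real.pi_pos.le h1.le,
      ← Real.sqrt_eq_rpow ω]
    have h2 : ∀ z : ℝ, 0 < z → z ^ (-1 / 2 : ℝ) * z ^ (1 / 2 : ℝ) = 1 := fun z hz => by
      rw [← Real.rpow_add hz]
      norm_num
    have h3 := h2 _ Real.pi_pos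
    have h4 := h2 _ h1
    have h5 : √ω ≠ 0 := (Real.sqrt_pos.2 hω).ne'
    generalize Real.pi ^ (-1 / 2 : ℝ) = A at *
    generalize (1 - E ^ 2) ^ (-1 / 2 : ℝ) = B at *
    field_simp
    linear_combination B * (1 - E ^ 2) ^ (1 / 2 : ℝ) * h3 + h4
  rw [hsq, ← mul_assoc, ← Complex.ofReal_mul, hconst, Complex.ofReal_exp, ← Complex.exp_add]
  congr 1
  simp only [hb, hc, hd]
  push_cast
  field_simp
  ring_nf
  simp only [Complex.I_sq]
  ring

end Mehler

/-! ### The kernel of the semigroup of `dπ_λ(𝓛)` -/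

/-- A linear change of variables of determinant `±1` preserves Lebesgue measure. -/
theorem measurePreserving_linear {a b c d : ℝ} (h : (a * d - b * c) ^ 2 = 1) :
    MeasurePreserving (fun v : ℝ × ℝ => (a * v.1 + b * v.2, c * v.1 + d * v.2)) := by
  let L : (ℝ × ℝ) →ₗ[ℝ] ℝ × ℝ := Matrix.toLin (Module.Basis.finTwoProd ℝ)
    (Module.Basis.finTwoProd ℝ) !![a, b; c, d]
  have hdet : LinearMap.det L = a * d - b * c := by
    rw [LinearMap.det_toLin, Matrix.det_fin_two_of]
  have hne : a * d - b * c ≠ 0 := fun h0 => by rw [h0] at h; norm_num at h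
  have habs : |a * d - b * c| = 1 :=
    (pow_eq_one_iff_of_nonneg (abs_nonneg _) two_ne_zero).1 (by rw [sq_abs, h])
  have hL : ⇑L = fun v : ℝ × ℝ => (a * v.1 + b * v.2, c * v.1 + d * v.2) := by
    ext v <;> simp [L, Matrix.toLin_finTwoProd]
  refine ⟨by fun_prop, ?_⟩
  rw [← hL, Measure.map_linearMap_addHaar_eq_smul_addHaar volume (by rwa [hdet]), hdet, abs_inv,
    habs]
  simp

/-- A function dominated by a Gaussian is integrable and square integrable. -/
theorem integrable_and_memLp_of_norm_le_gaussian {f : ℝ × ℝ → ℂ} (hf : AEStronglyMeasurable f)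
    {C ε : ℝ} (hε : 0 < ε)
    (h : ∀ v, ‖f v‖ ≤ C * (Real.exp (-ε * v.1 ^ 2) * Real.exp (-ε * v.2 ^ 2))) :
    Integrable f ∧ MemLp f 2 := by
  have hg : ∀ δ : ℝ, 0 < δ → Integrable fun v : ℝ × ℝ =>
      Real.exp (-δ * v.1 ^ 2) * Real.exp (-δ * v.2 ^ 2) := fun δ hδ =>
    (integrable_exp_neg_mul_sq hδ).mul_prod (integrable_exp_neg_mul_sq hδ)
  refine ⟨((hg ε hε).const_mul C).mono' hf (Eventually.of_forall h), ?_⟩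
  refine MemLp.mono' ?_ hf (Eventually.of_forall h)
  rw [memLp_two_iff_integrable_sq (Continuous.aestronglyMeasurable (by fun_prop))]
  refine ((hg (2 * ε) (by positivity)).const_mul (C ^ 2)).congr (Eventually.of_forall fun v => ?_)
  simp only [mul_pow, ← Real.exp_nat_mul]
  push_cast
  ring_nf

namespace Diagonalization

variable {l₁ l₂ : ℝ} (D : Diagonalization l₁ l₂)

/-- The product of the Mehler kernels in the diagonalising coordinates. -/
noncomputable def heatKernel (t : ℝ) (u v : ℝ × ℝ) : ℝ :=
  mehlerK t (D.ω ^ 2) (D.a * u.1 + D.b * u.2) (D.a * v.1 + D.b * v.2) *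
    mehlerK t (D.ν ^ 2) (D.c * u.1 + D.d * u.2) (D.c * v.1 + D.d * v.2)

variable {t : ℝ}

theorem continuous_heatKernel :
    Continuous fun z : (ℝ × ℝ) × (ℝ × ℝ) => D.heatKernel t z.1 z.2 := by
  refine Continuous.mul ?_ ?_
  · exact (continuous_mehlerK (t := t) D.ω_pos).comp (g := fun z => mehlerK t (D.ω ^ 2) z.1 z.2)
      (f := fun z : (ℝ × ℝ) × (ℝ × ℝ) => (D.a * z.1.1 + D.b * z.1.2, D.a * z.2.1 + D.b * z.2.2))
      (by fun_prop)
  · exact (continuous_mehlerK (t := t) D.ν_pos).comp (g := fun z => mehlerK t (D.ν ^ 2) z.1 z.2)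
      (f := fun z : (ℝ × ℝ) × (ℝ × ℝ) => (D.c * z.1.1 + D.d * z.1.2, D.c * z.2.1 + D.d * z.2.2))
      (by fun_prop)

theorem heatKernel_nonneg (ht : 0 < t) (u v : ℝ × ℝ) : 0 ≤ D.heatKernel t u v :=
  mul_nonneg (mehlerK_nonneg ht D.ω_pos _ _) (mehlerK_nonneg ht D.ν_pos _ _)

theorem sq_add_sq (u : ℝ × ℝ) : (D.a * u.1 + D.b * u.2) ^ 2 + (D.c * u.1 + D.d * u.2) ^ 2 =
    u.1 ^ 2 + u.2 ^ 2 := by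
  obtain ⟨h1, h2, h3, -⟩ := D.rows
  linear_combination u.1 ^ 2 * h1 + u.2 ^ 2 * h2 + 2 * u.1 * u.2 * h3

theorem exists_heatKernel_le (ht : 0 < t) : ∃ C ε : ℝ, 0 < C ∧ 0 < ε ∧
    ∀ u v, D.heatKernel t u v ≤ C * (Real.exp (-ε * u.1 ^ 2) * Real.exp (-ε * u.2 ^ 2) *
      (Real.exp (-ε * v.1 ^ 2) * Real.exp (-ε * v.2 ^ 2))) := by
  obtain ⟨C₁, ε₁, hC₁, hε₁, h₁⟩ := exists_mehlerK_le ht D.ω_pos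
  obtain ⟨C₂, ε₂, hC₂, hε₂, h₂⟩ := exists_mehlerK_le ht D.ν_pos
  refine ⟨C₁ * C₂, min ε₁ ε₂, by positivity, lt_min hε₁ hε₂, fun u v => ?_⟩
  refine (mul_le_mul (h₁ _ _) (h₂ _ _) (mehlerK_nonneg ht D.ν_pos _ _) (by positivity)).trans ?_
  rw [mul_mul_mul_comm, ← Real.exp_add, ← Real.exp_add, ← Real.exp_add, ← Real.exp_add]
  refine mul_le_mul_of_nonneg_left (Real.exp_le_exp.2 ?_) (by positivity)
  have hu := D.sq_add_sq u
  have hv := D.sq_add_sq v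
  have e1 := mul_le_mul_of_nonneg_right (min_le_left ε₁ ε₂)
    (add_nonneg (sq_nonneg (D.a * u.1 + D.b * u.2)) (sq_nonneg (D.a * v.1 + D.b * v.2)))
  have e2 := mul_le_mul_of_nonneg_right (min_le_right ε₁ ε₂)
    (add_nonneg (sq_nonneg (D.c * u.1 + D.d * u.2)) (sq_nonneg (D.c * v.1 + D.d * v.2)))
  linear_combination e1 + e2 - min ε₁ ε₂ * hu - min ε₁ ε₂ * hv

/-- The integral operator with kernel `κ_{t,λ}` maps a coherent state to its evolution. -/
theorem integral_heatKernel_mul_evolve (ht : 0 < t) (i u : ℝ × ℝ) :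
    ∫ v, (D.heatKernel t u v : ℂ) * D.evolve i 0 v = D.evolve i t u := by
  set X := D.a * u.1 + D.b * u.2 with hX
  set Y := D.c * u.1 + D.d * u.2 with hY
  let f : ℝ → ℂ := fun y => (mehlerK t (D.ω ^ 2) X y : ℂ) *
    Complex.exp (-(D.ω * y ^ 2 / 2 : ℝ) + Complex.I * (i.1 * y : ℝ))
  let g : ℝ → ℂ := fun y => (mehlerK t (D.ν ^ 2) Y y : ℂ) *
    Complex.exp (-(D.ν * y ^ 2 / 2 : ℝ) + Complex.I * (i.2 * y : ℝ))
  have hf : Continuous f := 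
    (Complex.continuous_ofReal.comp (continuous_mehlerK_right D.ω_pos X)).mul (by fun_prop)
  have hg : Continuous g := 
    (Complex.continuous_ofReal.comp (continuous_mehlerK_right D.ν_pos Y)).mul (by fun_prop)
  have hR := measurePreserving_linear D.rows.2.2.2
  have e : ∀ v, (D.heatKernel t u v : ℂ) * D.evolve i 0 v =
      Complex.exp (D.norming i.1 i.2) *
        (f (D.a * v.1 + D.b * v.2) * g (D.c * v.1 + D.d * v.2)) := by
    intro v
    have : D.evolve i 0 v = Complex.exp (D.norming i.1 i.2) *
        (Complex.exp (-(D.ω * (D.a * v.1 + D.b * v.2) ^ 2 / 2 : ℝ) +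
          Complex.I * (i.1 * (D.a * v.1 + D.b * v.2) : ℝ)) *
        Complex.exp (-(D.ν * (D.c * v.1 + D.d * v.2) ^ 2 / 2 : ℝ) +
          Complex.I * (i.2 * (D.c * v.1 + D.d * v.2) : ℝ))) := by
      rw [evolve_zero, coe_schwartzState, state_eq, ← Complex.exp_add, ← Complex.exp_add]
      congr 1
      push_cast
      ring
    rw [this, heatKernel, ← hX, ← hY, Complex.ofReal_mul]
    simp only [f, g]
    ring
  have hint : ∫ v : ℝ × ℝ, f (D.a * v.1 + D.b * v.2) * g (D.c * v.1 + D.d * v.2) =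
      (∫ y, f y) * ∫ y, g y := by
    rw [← integral_prod_mul f g, ← Measure.volume_eq_prod]
    conv_rhs => rw [← hR.map_eq]
    rw [integral_map hR.measurable.aemeasurable]
    exact Continuous.aestronglyMeasurable (by fun_prop)
  simp only [e]
  rw [integral_const_mul, hint, integral_mehlerK_mul ht D.ω_pos, integral_mehlerK_mul ht D.ν_pos,
    evolve_apply, state_eq, Complex.ofReal_exp, ← Complex.exp_add, ← Complex.exp_add,
    ← Complex.exp_add, ← hX, ← hY]
  have hω : (D.ω : ℂ) ≠ 0 := by exact_mod_cast D.ω_pos.ne'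
  have hν : (D.ν : ℂ) ≠ 0 := by exact_mod_cast D.ν_pos.ne'
  rw [show -2 * D.ω * t = -2 * t * D.ω by ring, show -2 * D.ν * t = -2 * t * D.ν by ring]
  congr 1
  simp only [norming]
  push_cast
  field_simp
  ring

theorem hasIntegralKernel_heatKernel (ht : 0 < t) {B : L2 →L[ℂ] L2}
    (hB : ∀ i, B ((D.evolve i 0).toLp 2 volume) = (D.evolve i t).toLp 2 volume) :
    HasIntegralKernel B fun u v => (D.heatKernel t u v : ℂ) := by
  have hc := D.continuous_heatKernel (t := t)
  obtain ⟨C, ε, -, hε, hC⟩ := D.exists_heatKernel_le ht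
  refine hasIntegralKernel_of_dense (Complex.continuous_ofReal.comp hc).measurable (fun u => ?_)
    D.isEvolutionFamily_dpi.dense fun i => ?_
  · refine (integrable_and_memLp_of_norm_le_gaussian
      (Complex.continuous_ofReal.comp
        (hc.comp (Continuous.prodMk_right u))).aestronglyMeasurable hε
      (C := C * (Real.exp (-ε * u.1 ^ 2) * Real.exp (-ε * u.2 ^ 2))) fun v => ?_).2
    change ‖((D.heatKernel t u v : ℝ) : ℂ)‖ ≤ _
    rw [Complex.norm_real, Real.norm_of_nonneg (D.heatKernel_nonneg ht u v), mul_assoc]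
    exact hC u v
  · rw [hB]
    filter_upwards [(D.evolve i t).coeFn_toLp 2 volume] with u hu
    rw [hu, ← D.integral_heatKernel_mul_evolve ht]
    refine integral_congr_ae ?_
    filter_upwards [(D.evolve i 0).coeFn_toLp 2 volume] with v hv
    rw [hv]

end Diagonalization

theorem exists_kappa_eq_heatKernel (l₁ : ℝ) {l₂ : ℝ} (hl₂ : l₂ ≠ 0) :
    ∃ D : Diagonalization l₁ l₂, ∀ t, kappa t l₁ l₂ = D.heatKernel t := by
  obtain ⟨D, h1, h2, h3⟩ := exists_diagonalization l₁ hl₂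
  refine ⟨D, fun t => ?_⟩
  ext u v
  rw [kappa, h1, h2, (h3 u).1, (h3 u).2, (h3 v).1, (h3 v).2, Diagonalization.heatKernel]

/-! ### The kernel of the semigroup of `dρ_λ(𝓛)` -/

variable {t l₁ l₂ : ℝ}

theorem continuous_kappa (hl₂ : l₂ ≠ 0) :
    Continuous fun z : (ℝ × ℝ) × (ℝ × ℝ) => kappa t l₁ l₂ z.1 z.2 := by
  obtain ⟨D, hD⟩ := exists_kappa_eq_heatKernel l₁ hl₂
  rw [hD]
  exact D.continuous_heatKernel

theorem exists_norm_kappa_le (ht : 0 < t) (hl₂ : l₂ ≠ 0) : ∃ C ε : ℝ, 0 < C ∧ 0 < ε ∧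
    ∀ u v, ‖(kappa t l₁ l₂ u v : ℂ)‖ ≤
      C * (Real.exp (-ε * u.1 ^ 2) * Real.exp (-ε * u.2 ^ 2) *
        (Real.exp (-ε * v.1 ^ 2) * Real.exp (-ε * v.2 ^ 2))) := by
  obtain ⟨D, hD⟩ := exists_kappa_eq_heatKernel l₁ hl₂
  rw [hD]
  obtain ⟨C, ε, hC, hε, h⟩ := D.exists_heatKernel_le ht
  refine ⟨C, ε, hC, hε, fun u v => ?_⟩
  rw [Complex.norm_real, Real.norm_of_nonneg (D.heatKernel_nonneg ht u v)]
  exact h u v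

theorem exp_neg_mul_sq_le_one {ε : ℝ} (hε : 0 < ε) (x : ℝ) : Real.exp (-ε * x ^ 2) ≤ 1 := by
  rw [Real.exp_le_one_iff]
  nlinarith [mul_nonneg hε.le (sq_nonneg x)]

theorem norm_rhoIntegrand (p q w : ℝ × ℝ) :
    ‖rhoIntegrand t l₁ l₂ p q w‖ = ‖(kappa t l₁ l₂ (p.1, w.1) (q.1, w.2) : ℂ)‖ := by
  have : Complex.I * l₂ * (w.2 * q.2 - p.2 * w.1) =
      Complex.I * (l₂ * (w.2 * q.2 - p.2 * w.1) : ℝ) := by push_cast; ring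
  rw [rhoIntegrand, norm_mul, this, norm_cexp_I_mul, one_mul]

theorem continuous_rhoIntegrand (hl₂ : l₂ ≠ 0) :
    Continuous fun z : ((ℝ × ℝ) × (ℝ × ℝ)) × (ℝ × ℝ) =>
      rhoIntegrand t l₁ l₂ z.1.1 z.1.2 z.2 := by
  have h : Continuous fun z : ((ℝ × ℝ) × (ℝ × ℝ)) × (ℝ × ℝ) =>
      kappa t l₁ l₂ (z.1.1.1, z.2.1) (z.1.2.1, z.2.2) :=
    (continuous_kappa (t := t) (l₁ := l₁) hl₂).comp
      (f := fun z : ((ℝ × ℝ) × (ℝ × ℝ)) × (ℝ × ℝ) => ((z.1.1.1, z.2.1), (z.1.2.1, z.2.2)))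
      (by fun_prop)
  exact Continuous.mul (by fun_prop) (Complex.continuous_ofReal.comp h)

theorem integrable_rhoIntegrand (ht : 0 < t) (hl₂ : l₂ ≠ 0) (p q : ℝ × ℝ) :
    Integrable (rhoIntegrand t l₁ l₂ p q) := by
  obtain ⟨C, ε, hC, hε, h⟩ := exists_norm_kappa_le (l₁ := l₁) ht hl₂
  refine (integrable_and_memLp_of_norm_le_gaussian ((continuous_rhoIntegrand hl₂).comp
    (Continuous.prodMk_right (p, q))).aestronglyMeasurable hε (C := C) fun w => ?_).1
  refine (norm_rhoIntegrand p q w).le.trans ((h _ _).trans ?_)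
  gcongr
  · exact mul_le_of_le_one_left (Real.exp_pos _).le (exp_neg_mul_sq_le_one hε _)
  · exact mul_le_of_le_one_left (Real.exp_pos _).le (exp_neg_mul_sq_le_one hε _)

theorem measurable_rhoKernel (hl₂ : l₂ ≠ 0) :
    Measurable (Function.uncurry (rhoKernel t l₁ l₂)) := by
  have h : StronglyMeasurable fun z : (ℝ × ℝ) × (ℝ × ℝ) =>
      ∫ w : ℝ × ℝ, rhoIntegrand t l₁ l₂ z.1 z.2 w :=
    StronglyMeasurable.integral_prod_right (continuous_rhoIntegrand hl₂).stronglyMeasurable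
  exact Measurable.mul (Continuous.measurable (by fun_prop)) h.measurable

/-- The conjugate of the row at `p` of the kernel of the operator `T e^{-t dπ_λ(𝓛)}`. -/
noncomputable def conjRow (t l₁ l₂ : ℝ) (p v : ℝ × ℝ) : ℂ :=
  starRingEnd ℂ (intertwiner l₁ l₂ (fun u => (kappa t l₁ l₂ u v : ℂ)) p)

theorem measurable_conjRow (hl₂ : l₂ ≠ 0) (p : ℝ × ℝ) : Measurable (conjRow t l₁ l₂ p) := by
  have h : Continuous fun z : (ℝ × ℝ) × ℝ => kappa t l₁ l₂ (p.1, z.2) z.1 :=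
    (continuous_kappa (t := t) (l₁ := l₁) hl₂).comp
      (f := fun z : (ℝ × ℝ) × ℝ => ((p.1, z.2), z.1)) (by fun_prop)
  have h2 : StronglyMeasurable fun v : ℝ × ℝ => ∫ z : ℝ,
      Complex.exp (-Complex.I * l₂ * p.2 * z) * (kappa t l₁ l₂ (p.1, z) v : ℂ) := by
    refine StronglyMeasurable.integral_prod_right (f := fun (v : ℝ × ℝ) (z : ℝ) =>
      Complex.exp (-Complex.I * l₂ * p.2 * z) * (kappa t l₁ l₂ (p.1, z) v : ℂ)) ?_
    exact (Continuous.mul (by fun_prop) (Complex.continuous_ofReal.comp h)).stronglyMeasurable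
  exact Complex.continuous_conj.measurable.comp (h2.measurable.const_mul _)

theorem integrable_and_memLp_conjRow (ht : 0 < t) (hl₂ : l₂ ≠ 0) (p : ℝ × ℝ) :
    Integrable (conjRow t l₁ l₂ p) ∧ MemLp (conjRow t l₁ l₂ p) 2 := by
  obtain ⟨C, ε, hC, hε, h⟩ := exists_norm_kappa_le (l₁ := l₁) ht hl₂
  refine integrable_and_memLp_of_norm_le_gaussian (measurable_conjRow hl₂ p).aestronglyMeasurable hε
    (C := √(|l₂| / (2 * Real.pi)) * ∫ z : ℝ, C * Real.exp (-ε * z ^ 2)) fun v => ?_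
  rw [conjRow, RCLike.norm_conj, norm_intertwiner]
  refine (norm_partialFourier_le _ _ _).trans ?_
  rw [mul_assoc, ← integral_mul_const]
  refine mul_le_mul_of_nonneg_left (integral_mono_of_nonneg
    (Eventually.of_forall fun z => norm_nonneg _)
    (((integrable_exp_neg_mul_sq hε).const_mul C).mul_const _)
    (Eventually.of_forall fun z => ?_)) (Real.sqrt_nonneg _)
  refine (h _ _).trans ?_
  simp only
  rw [mul_assoc C]
  gcongr
  exact mul_le_of_le_one_left (Real.exp_pos _).le (exp_neg_mul_sq_le_one hε _)

/-- The rows of the kernel `Q_{t,λ}` arise by applying `T` twice. -/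
theorem rhoKernel_eq (ht : 0 < t) (hl₂ : l₂ ≠ 0) (p q : ℝ × ℝ) :
    rhoKernel t l₁ l₂ p q = starRingEnd ℂ (intertwiner l₁ l₂ (conjRow t l₁ l₂ p) q) := by
  -- the first component of `w` belongs to the inner application of `T`
  have hF : ∫ w : ℝ × ℝ, rhoIntegrand t l₁ l₂ p q w =
      ∫ z : ℝ, ∫ x : ℝ, rhoIntegrand t l₁ l₂ p q (x, z) :=
    integral_prod_symm _ (integrable_rhoIntegrand ht hl₂ p q)
  have hs : ((√(|l₂| / (2 * Real.pi)) : ℝ) : ℂ) * (√(|l₂| / (2 * Real.pi)) : ℝ) =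
      (|l₂| / (2 * Real.pi) : ℝ) := by
    rw [← Complex.ofReal_mul, Real.mul_self_sqrt (by positivity)]
  set c := √(|l₂| / (2 * Real.pi)) with hc
  have hphase : ∀ x : ℝ, starRingEnd ℂ (Complex.exp (Complex.I * x)) =
      Complex.exp (-(Complex.I * x)) := fun x => by
    rw [← Complex.exp_conj, map_mul, Complex.conj_I, Complex.conj_ofReal, neg_mul]
  have e1 : starRingEnd ℂ (Complex.exp (Complex.I * (l₁ / 2) * q.1 * q.2)) =
      Complex.exp (-(Complex.I * (l₁ / 2) * q.1 * q.2)) := by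
    have := hphase (l₁ / 2 * q.1 * q.2)
    push_cast at this
    convert this using 2 <;> ring_nf
  have e2 : ∀ z : ℝ, starRingEnd ℂ (Complex.exp (-Complex.I * l₂ * q.2 * z)) =
      Complex.exp (Complex.I * l₂ * q.2 * z) := fun z => by
    have := hphase (-l₂ * q.2 * z)
    push_cast at this
    convert this using 2 <;> ring_nf
  rw [rhoKernel, hF, ← hs, intertwiner, map_mul, map_mul, ← hc, Complex.conj_ofReal, e1,
    ← integral_conj]
  simp only [map_mul, e2, conjRow, Complex.conj_conj, intertwiner, ← hc]
  rw [show Complex.I * ((l₁ : ℂ) / 2) * (p.1 * p.2 - q.1 * q.2) =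
      Complex.I * (l₁ / 2) * p.1 * p.2 + -(Complex.I * (l₁ / 2) * q.1 * q.2) by ring,
    Complex.exp_add]
  have e3 : ∀ z : ℝ, Complex.exp (Complex.I * l₂ * q.2 * z) *
      (c * Complex.exp (Complex.I * (l₁ / 2) * p.1 * p.2) *
        ∫ x : ℝ, Complex.exp (-Complex.I * l₂ * p.2 * x) *
          (kappa t l₁ l₂ (p.1, x) (q.1, z) : ℂ)) =
      c * Complex.exp (Complex.I * (l₁ / 2) * p.1 * p.2) *
        ∫ x : ℝ, rhoIntegrand t l₁ l₂ p q (x, z) := by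
    intro z
    rw [mul_left_comm, ← integral_const_mul]
    congr 2 with x
    rw [← mul_assoc, ← Complex.exp_add, rhoIntegrand]
    ring_nf
  simp only [e3]
  rw [integral_const_mul]
  ring

theorem integrable_gaussian_mul {ε : ℝ} (hε : 0 < ε) (g : L2) : Integrable fun v : ℝ × ℝ =>
    ((Real.exp (-ε * v.1 ^ 2) * Real.exp (-ε * v.2 ^ 2) : ℝ) : ℂ) * g v :=
  (integrable_and_memLp_of_norm_le_gaussian (Continuous.aestronglyMeasurable (by fun_prop)) hε
    (C := 1) fun v => by
      rw [Complex.norm_real, Real.norm_of_nonneg (by positivity), one_mul]).2.integrable_mul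
    (Lp.memLp g)

/-- Applying `T` to a function in the range of `e^{-t dπ_λ(𝓛)}`. -/
theorem intertwiner_integral_kappa (ht : 0 < t) (hl₂ : l₂ ≠ 0) (g : L2) (p : ℝ × ℝ) :
    intertwiner l₁ l₂ (fun u => ∫ v, (kappa t l₁ l₂ u v : ℂ) * g v) p =
      ∫ v, starRingEnd ℂ (conjRow t l₁ l₂ p v) * g v := by
  obtain ⟨C, ε, hC, hε, h⟩ := exists_norm_kappa_le (l₁ := l₁) ht hl₂
  have hk : Continuous fun z : ℝ × (ℝ × ℝ) => kappa t l₁ l₂ (p.1, z.1) z.2 :=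
    (continuous_kappa (t := t) (l₁ := l₁) hl₂).comp
      (f := fun z : ℝ × (ℝ × ℝ) => ((p.1, z.1), z.2)) (by fun_prop)
  have hG := integrable_gaussian_mul hε g
  have hint : Integrable (Function.uncurry fun (z : ℝ) (v : ℝ × ℝ) =>
      Complex.exp (-Complex.I * l₂ * p.2 * z) * ((kappa t l₁ l₂ (p.1, z) v : ℂ) * g v))
      (volume.prod volume) := by
    refine Integrable.mono' (((integrable_exp_neg_mul_sq hε).const_mul C).mul_prod hG.norm) ?_
      (Eventually.of_forall fun z => ?_)
    · refine AEStronglyMeasurable.mul (Continuous.aestronglyMeasurable (by fun_prop))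
        (AEStronglyMeasurable.mul (Complex.continuous_ofReal.comp hk).aestronglyMeasurable ?_)
      exact ((Lp.stronglyMeasurable g).comp_measurable measurable_snd).aestronglyMeasurable
    · have e : -Complex.I * l₂ * p.2 * z.1 = Complex.I * (-l₂ * p.2 * z.1 : ℝ) := by
        push_cast; ring
      rw [Function.uncurry_def]
      simp only
      rw [norm_mul, e, norm_cexp_I_mul, one_mul, norm_mul, norm_mul, Complex.norm_real (_ * _),
        Real.norm_of_nonneg (mul_nonneg (Real.exp_pos _).le (Real.exp_pos _).le), ← mul_assoc]
      refine mul_le_mul_of_nonneg_right ((h _ _).trans ?_) (norm_nonneg _)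
      rw [mul_assoc C]
      gcongr
      exact mul_le_of_le_one_left (Real.exp_pos _).le (exp_neg_mul_sq_le_one hε _)
  rw [intertwiner]
  simp only [← integral_const_mul (Complex.exp _)]
  rw [integral_integral_swap hint, ← integral_const_mul]
  congr 1 with v
  rw [conjRow, Complex.conj_conj, intertwiner, mul_assoc _ _ (g v), ← integral_mul_const]
  simp only [mul_assoc]

/-- The kernel of the conjugate by `T` of an operator with kernel `κ_{t,λ}`: by unitarity, pairing
the rows of `Q_{t,λ}` with `T g` amounts to pairing the rows described by `conjRow` with `g`. -/
theorem hasIntegralKernel_rhoKernel (ht : 0 < t) (hl₂ : l₂ ≠ 0) {T : L2 ≃ₗᵢ[ℂ] L2}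
    (hT : ∀ f : 𝓢(ℝ × ℝ, ℂ), T.symm (f.toLp 2 volume) =
      (memLp_intertwinerInv (l₁ := l₁) hl₂ f).toLp _) {B B' : L2 →L[ℂ] L2}
    (hB : HasIntegralKernel B fun u v => (kappa t l₁ l₂ u v : ℂ))
    (hB' : ∀ f, B' f = T (B (T.symm f))) : HasIntegralKernel B' (rhoKernel t l₁ l₂) := by
  have hH := integrable_and_memLp_conjRow (l₁ := l₁) ht hl₂
  have hrow : ∀ p, T ((hH p).2.toLp _) =ᵐ[volume]
      intertwiner l₁ l₂ (conjRow t l₁ l₂ p) := fun p =>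
    unitary_apply_eq_intertwiner hl₂ hT (measurable_conjRow hl₂ p)
      (hH p).1 _
  have hint : ∀ p (f : L2), Integrable fun q => rhoKernel t l₁ l₂ p q * f q := by
    intro p f
    refine (((Lp.memLp (T ((hH p).2.toLp _))).star).integrable_mul
      (Lp.memLp f)).congr ?_
    filter_upwards [hrow p] with q hq
    rw [Pi.mul_apply, Pi.star_apply, hq, rhoKernel_eq ht hl₂]
    rfl
  have hpair : ∀ p (f : L2), ∫ q, rhoKernel t l₁ l₂ p q * f q =
      ∫ v, starRingEnd ℂ (conjRow t l₁ l₂ p v) * T.symm f v := by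
    intro p f
    have h1 := T.inner_map_map ((hH p).2.toLp _) (T.symm f)
    rw [T.apply_symm_apply, L2.inner_def, L2.inner_def] at h1
    refine Eq.trans (integral_congr_ae ?_) (h1.trans (integral_congr_ae ?_))
    · filter_upwards [hrow p] with q hq
      rw [RCLike.inner_apply, hq, rhoKernel_eq ht hl₂, mul_comm]
    · filter_upwards [(hH p).2.coeFn_toLp] with v hv
      rw [RCLike.inner_apply, hv, mul_comm]
  refine ⟨measurable_rhoKernel hl₂, fun f => Eventually.of_forall fun p => hint p f, fun f => ?_⟩
  simp only [hpair, ← intertwiner_integral_kappa ht hl₂]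
  set g := T.symm f
  have hm : Measurable fun u => ∫ v, (kappa t l₁ l₂ u v : ℂ) * g v := by
    have : StronglyMeasurable fun z : (ℝ × ℝ) × (ℝ × ℝ) => (kappa t l₁ l₂ z.1 z.2 : ℂ) * g z.2 :=
      (Complex.continuous_ofReal.comp (continuous_kappa hl₂)).stronglyMeasurable.mul
        ((Lp.stronglyMeasurable g).comp_measurable measurable_snd)
    exact (StronglyMeasurable.integral_prod_right
      (f := fun u v => (kappa t l₁ l₂ u v : ℂ) * g v) this).measurable
  obtain ⟨C, ε, hC, hε, h⟩ := exists_norm_kappa_le (l₁ := l₁) ht hl₂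
  have hG := (integrable_gaussian_mul hε g).norm
  have hb : Integrable (fun u => ∫ v, (kappa t l₁ l₂ u v : ℂ) * g v) ∧
      MemLp (fun u => ∫ v, (kappa t l₁ l₂ u v : ℂ) * g v) 2 := by
    refine integrable_and_memLp_of_norm_le_gaussian hm.aestronglyMeasurable hε (C := C *
      ∫ v, ‖((Real.exp (-ε * v.1 ^ 2) * Real.exp (-ε * v.2 ^ 2) : ℝ) : ℂ) * g v‖) fun u => ?_
    refine (norm_integral_le_integral_norm _).trans ?_
    rw [mul_right_comm, ← integral_const_mul]
    refine integral_mono_of_nonneg (Eventually.of_forall fun v => norm_nonneg _)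
      (hG.const_mul _) (Eventually.of_forall fun v => ?_)
    simp only
    rw [norm_mul, norm_mul, Complex.norm_real (_ * _),
      Real.norm_of_nonneg (mul_nonneg (Real.exp_pos _).le (Real.exp_pos _).le), ← mul_assoc,
      mul_assoc C]
    exact mul_le_mul_of_nonneg_right (h u v) (norm_nonneg _)
  -- `B g` has an integrable representative, so `T` acts on it by its integral formula
  have hBg : B g = hb.2.toLp _ := by
    refine Lp.ext ?_
    filter_upwards [hB.apply_eq g, hb.2.coeFn_toLp] with u h1 h2
    rw [h1, h2]
  rw [hB', hBg]
  exact unitary_apply_eq_intertwiner hl₂ hT hm hb.1 hb.2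

end HeisenbergOscillator

/-! ### Semigroups, kernels and the intertwining relation -/

open HeisenbergOscillator

theorem mainTheorem5 (l₁ l₂ : ℝ) (hl₂ : l₂ ≠ 0) :
    -- `exp (-t dπ_λ(𝓛))` and `exp (-t dρ_λ(𝓛))` are well defined
    (∃! S, HeisenbergOscillator.IsHeatSemigroup (HeisenbergOscillator.closedGraph
      (HeisenbergOscillator.sublaplacian (HeisenbergOscillator.dpi l₁ l₂))) S) ∧
    (∃! S, HeisenbergOscillator.IsHeatSemigroup (HeisenbergOscillator.closedGraph
      (HeisenbergOscillator.sublaplacian (HeisenbergOscillator.drho l₁ l₂))) S) ∧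
    ∀ Sπ Sρ : ℝ≥0 → HeisenbergOscillator.L2 →L[ℂ] HeisenbergOscillator.L2,
      HeisenbergOscillator.IsHeatSemigroup (HeisenbergOscillator.closedGraph
        (HeisenbergOscillator.sublaplacian (HeisenbergOscillator.dpi l₁ l₂))) Sπ →
      HeisenbergOscillator.IsHeatSemigroup (HeisenbergOscillator.closedGraph
        (HeisenbergOscillator.sublaplacian (HeisenbergOscillator.drho l₁ l₂))) Sρ →
      -- the kernel of `exp (-t dπ_λ(𝓛))`
      (∀ t : ℝ≥0, 0 < t → HeisenbergOscillator.HasIntegralKernel (Sπ t)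
        (fun u v => (HeisenbergOscillator.kappa t l₁ l₂ u v : ℂ))) ∧
      -- the kernel of `exp (-t dρ_λ(𝓛))`, given by an absolutely convergent integral
      (∀ t : ℝ≥0, 0 < t →
        (∀ p q : ℝ × ℝ, Integrable (HeisenbergOscillator.rhoIntegrand t l₁ l₂ p q)) ∧
        HeisenbergOscillator.HasIntegralKernel (Sρ t)
          (HeisenbergOscillator.rhoKernel t l₁ l₂)) ∧
      -- `exp (-t dρ_λ(𝓛)) = T exp (-t dπ_λ(𝓛)) T⁻¹` with the unitary operator `T`
      ∃ T : HeisenbergOscillator.L2 ≃ₗᵢ[ℂ] HeisenbergOscillator.L2,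
        (∀ h : 𝓢(ℝ × ℝ, ℂ), T (h.toLp 2) =ᵐ[volume]
          HeisenbergOscillator.intertwiner l₁ l₂ h) ∧
        (∀ f : 𝓢(ℝ × ℝ, ℂ), T.symm (f.toLp 2) =ᵐ[volume]
          HeisenbergOscillator.intertwinerInv l₁ l₂ f) ∧
        ∀ (t : ℝ≥0) (f : HeisenbergOscillator.L2), Sρ t f = T (Sπ t (T.symm f)) := by
  have hπ := isSkewRealization_dpi l₁ l₂
  have hρ := isSkewRealization_drho l₁ l₂
  obtain ⟨D, hD⟩ := exists_kappa_eq_heatKernel l₁ hl₂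
  obtain ⟨T, hT, hT'⟩ := exists_unitary_intertwiner l₁ hl₂
  have hEπ := D.isEvolutionFamily_dpi
  have hEρ := D.isEvolutionFamily_drho hl₂ hT
  rw [hπ.closedGraph_eq, hρ.closedGraph_eq]
  refine ⟨hEπ.existsUnique_isHeatSemigroup hπ.accretive,
    hEρ.existsUnique_isHeatSemigroup hρ.accretive, fun Sπ Sρ hSπ hSρ => ?_⟩
  -- by uniqueness both semigroups are known on a family spanning a dense subspace
  have hSπ_apply : ∀ (i : ℝ × ℝ) (t : ℝ≥0),
      Sπ t ((D.evolve i 0).toLp 2 volume) = (D.evolve i t).toLp 2 volume := by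
    rw [(hEπ.existsUnique_isHeatSemigroup hπ.accretive).unique hSπ
      (hEπ.isHeatSemigroup hπ.accretive)]
    exact hEπ.semigroup_apply_zero hπ.accretive
  have hSρ_apply : ∀ (i : ℝ × ℝ) (t : ℝ≥0),
      Sρ t (T ((D.evolve i 0).toLp 2 volume)) = T ((D.evolve i t).toLp 2 volume) := by
    rw [(hEρ.existsUnique_isHeatSemigroup hρ.accretive).unique hSρ
      (hEρ.isHeatSemigroup hρ.accretive)]
    exact hEρ.semigroup_apply_zero hρ.accretive
  have hTS : ∀ (t : ℝ≥0) (f : L2), Sρ t f = T (Sπ t (T.symm f)) := by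
    intro t f
    have h : (Sρ t).comp T.toContinuousLinearEquiv.toContinuousLinearMap =
        T.toContinuousLinearEquiv.toContinuousLinearMap.comp (Sπ t) := by
      refine ContinuousLinearMap.ext_on hEπ.dense ?_
      rintro _ ⟨i, rfl⟩
      exact (hSρ_apply i t).trans (congrArg T (hSπ_apply i t)).symm
    have := congrArg (fun A : L2 →L[ℂ] L2 => A (T.symm f)) h
    simpa using this
  have hker : ∀ t : ℝ≥0, 0 < t → HasIntegralKernel (Sπ t) fun u v => (kappa t l₁ l₂ u v : ℂ) := by
    intro t ht
    rw [hD]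
    exact D.hasIntegralKernel_heatKernel ht fun i => hSπ_apply i t
  exact ⟨hker, fun t ht => ⟨integrable_rhoIntegrand ht hl₂,
    hasIntegralKernel_rhoKernel ht hl₂ hT' (hker t ht) (hTS t)⟩, T,
    fun h => by rw [hT]; exact MemLp.coeFn_toLp _,
    fun f => by rw [hT']; exact MemLp.coeFn_toLp _, hTS⟩
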